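/- **Setting.** Let $D\subset\mathbb R^2$ be a simply connected domain. A planar $4$-web on $D$ consists of four foliations given by smooth ($C^\infty$) $1$-forms on $D$, any two of which are linearly independent at every point. The forms can be rescaled by nowhere vanishing smooth functions to forms $\omega_1,\dots,\omega_4$ such that $$\omega_1+\omega_2+\omega_3=0,\qquad a\,\omega_1+\omega_2+\omega_4=0$$ for a function $a$ (the basic invariant; $a\neq 0,1$). Fix any such normalization. The *rank* of the web is the dimension of the real vector space of smooth functions $(\lambda_1,\dots,\lambda_4)$ on $D$ with $\sum_i\lambda_i\omega_i=0$ and $d(\lambda_i\omega_i)=0$ for $i=1,\dots,4$ (rescaling the forms does not change it). Let $\gamma=g_1\omega_1+g_2\omega_2$ be the unique $1$-form with $d\omega_i=\omega_i\wedge\gamma$ for $i=1,2,3$, and define $K$ by $d\gamma=K\,\omega_1\wedge\omega_2$. Let $\partial_1,\partial_2$ be the frame dual to $\omega_1,\omega_2$. For a function $h$ of weight $w$ put $\delta_i h=\partial_i h-w g_i h$, which has weight $w+1$. Here $a$ has weight $0$; $K$ and $c_0$ have weight $2$; $c_1$ and $c_2$ have weight $3$; all $G_{ij}$ have weight $6$.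 Indices on $a$ and $K$, and indices after a comma, denote covariant derivatives; those of order two and three are symmetrized: $h_{,12}=\frac12(\delta_1\delta_2+\delta_2\delta_1)h$, and $h_{,112}$, $h_{,122}$ are the means over the three orders of differentiation. Put $$c_0=K+\frac{a_{11}-aa_{22}-2(1-a)a_{12}}{4a(1-a)}+\frac{(-1+2a)a_1^2-a^2a_2^2+2(1-a)^2a_1a_2}{4(1-a)^2a^2},$$ $$\begin{aligned}c_1={}&\frac{K_2-K_1}{4(1-a)}+\frac{(a-4)a_1+(11-20a+12a^2)a_2}{12(1-a)^2a}K+\frac{a_{112}-a_{122}}{4a(1-a)}+\frac{a_1-aa_2}{4a^2(1-a)}a_{22}\\&+\frac{(2a-1)(a_1-aa_2)}{4(1-a)^2a^2}a_{12}-\frac{a_2^2\left((1-2a)a_1+aa_2\right)}{4(1-a)^2a^2},\end{aligned}$$ $$c_2=\frac{aK_2-K_1}{4a(1-a)}+\frac{(1-2a)a_1-(a-2)aa_2}{4(1-a)^2a^2}K,$$ $$J_1=a_2c_1c_2(c_1-c_2)+ac_2^2(c_{1,2}-c_{1,1})+c_1c_2\left(c_{1,1}+a(c_{2,1}-c_{1,2}-c_{2,2})\right)+c_1^2(ac_{2,2}-c_{2,1}),$$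 $$\begin{aligned}J_2={}&c_1^2(c_1-c_2)^2K+(c_{1,11}-c_{1,12})c_1c_2(c_2-c_1)+c_1^2(c_1-c_2)(c_{2,11}-c_{2,12})\\&-c_2(2c_1-c_2)c_{1,1}(c_{1,2}-c_{1,1})+c_1^2c_{2,1}(c_{1,2}-c_{2,2}+c_{2,1})+c_1^2c_{1,1}(c_{2,2}-2c_{2,1}),\end{aligned}$$ $$J_3=(a_{22}-a_{12})(1-a)+a_2(a_2-a_1)-(1-a)^2K,\qquad J_4=a_{12}a-a_1a_2-Ka^2,$$ $$\begin{aligned}G_{11}={}&ac_0(c_{2,2}-c_{2,1})+ac_2(c_{0,1}-c_{0,2})-a(1-a)c_1c_2+(2a_2-a_1-aa_2)c_0c_2-Kc_0^2,\\ G_{12}={}&ac_0(c_{1,2}-c_{1,1})+ac_1(c_{0,1}-c_{0,2})-a(1-a)c_1^2+(2a_2-a_1-2aa_2)c_0c_1+(a_2^2+a_{12}-a_{22})c_0^2,\\ G_{21}={}&c_0(c_{2,1}-ac_{2,2})+c_2(ac_{0,2}-c_{0,1})-2a_2c_0c_2+a(1-a)c_2^2,\\ G_{22}={}&c_0(c_{1,1}-ac_{1,2})+c_1(ac_{0,2}-c_{0,1})+a(1-a)c_1c_2-a_2c_0c_1-a_2(1-a)c_0c_2+(a_{22}-K)c_0^2,\end{aligned}$$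 $J_{10}=G_{11}G_{22}-G_{21}G_{12}$, and, for functions $r,s$ of weight $6$, $$\begin{aligned}J_{11}(r,s)={}&c_0(r_{,1}s-s_{,1}r)+(a_2c_0-ac_1)r^2+(ac_2-a_2c_0+ac_1)rs-ac_2s^2,\\ J_{12}(r,s)={}&c_0(r_{,2}s-s_{,2}r)+(a_2c_0-ac_1)r^2+(ac_2+c_1)rs-c_2s^2.\end{aligned}$$ Write $J_{11}=J_{11}(G_{21},G_{22})$ and $J_{12}=J_{12}(G_{21},G_{22})$. Assume that the web is regular in the following sense: $c_0$ is identically zero or nowhere zero on $D$; if $c_0\equiv0$, then each of $c_1$ and $c_1-c_2$ is identically zero or nowhere zero; if $c_0$ is nowhere zero, then the matrix $G=(G_{ij})$ is identically zero or nowhere the zero matrix. **Theorem.** The web has rank one if and only if one of the following four conditions holds at all points of $D$: 1. $c_0=0$, $J_1=J_2=0$, $c_1\ne c_2$ and $c_1\neq0$; 2. $c_0=0$, $c_1=c_2\neq0$ and $J_3=0$; 3. $c_0=0$, $c_1=0$, $c_2\neq0$ and $J_4=0$; 4. $c_0\neq0$, $G\neq 0$ and $J_{10}=J_{11}=J_{12}=0$;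 at those points, if any, where $G_{21}=G_{22}=0$, also $J_{11}(G_{11},G_{12})=J_{12}(G_{11},G_{12})=0$. -/

import Mathlib

open scoped ContDiff

noncomputable section

namespace PlanarWeb

/-- Differential `1`-forms on the plane with coordinates `x, y`. -/
abbrev OneForm := ℝ × ℝ → (ℝ × ℝ →L[ℝ] ℝ)

/-- The coefficient of `dx ∧ dy` in `α ∧ β`. -/
def wedge (α β : OneForm) (p : ℝ × ℝ) : ℝ :=
  α p (1, 0) * β p (0, 1) - α p (0, 1) * β p (1, 0)

/-- The coefficient of `dx ∧ dy` in `dα`. -/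
def extD (α : OneForm) (p : ℝ × ℝ) : ℝ :=
  fderiv ℝ α p (1, 0) (0, 1) - fderiv ℝ α p (0, 1) (1, 0)

/-- A smooth planar `4`-web on `D`: four foliations, given by smooth `1`-forms any two of which
are linearly independent at every point of `D`. -/
structure FourWeb (D : Set (ℝ × ℝ)) where
  form : Fin 4 → OneForm
  smooth : ∀ i, ContDiffOn ℝ ∞ (form i) D
  transversal : ∀ i j, i ≠ j → ∀ p ∈ D, LinearIndependent ℝ ![form i p, form j p]

namespace FourWeb

variable {D : Set (ℝ × ℝ)}

/-- The solutions on `D` of the abelian equation of the web: smooth functions `l 0, …, l 3` on `D`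
with `∑ l i • ω i = 0` and with all `l i • ω i` closed. A function on `D` is represented by its
extension by zero to the plane. -/
def abelianSolutions (W : FourWeb D) (hD : IsOpen D) :
    Submodule ℝ (Fin 4 → ℝ × ℝ → ℝ) where
  carrier := {l | (∀ i, ∀ p ∉ D, l i p = 0) ∧ (∀ i, ContDiffOn ℝ ∞ (l i) D) ∧
    (∀ p ∈ D, ∑ i, l i p • W.form i p = 0) ∧
    ∀ i, ∀ p ∈ D, extD (fun q => l i q • W.form i q) p = 0}
  zero_mem' := by
    refine ⟨by simp, fun i => contDiffOn_const, by simp, ?_⟩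
    intro i p _
    simp [extD]
  add_mem' := by
    rintro l m ⟨h1, h2, h3, h4⟩ ⟨k1, k2, k3, k4⟩
    refine ⟨fun i p hp => by simp [h1 i p hp, k1 i p hp], fun i => (h2 i).add (k2 i),
      fun p hp => ?_, fun i p hp => ?_⟩
    · have := congrArg₂ (· + ·) (h3 p hp) (k3 p hp)
      simpa [add_smul, Finset.sum_add_distrib] using this
    · have d1 : DifferentiableAt ℝ (fun q => l i q • W.form i q) p :=
        (((h2 i).smul (W.smooth i)).contDiffAt (hD.mem_nhds hp)).differentiableAt (by simp)
      have d2 : DifferentiableAt ℝ (fun q => m i q • W.form i q) p :=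
        (((k2 i).smul (W.smooth i)).contDiffAt (hD.mem_nhds hp)).differentiableAt (by simp)
      have e : (fun q => (l + m) i q • W.form i q) =
          (fun q => l i q • W.form i q) + fun q => m i q • W.form i q := by
        funext q; simp [add_smul]
      have := h4 i p hp
      have := k4 i p hp
      simp only [extD] at *
      rw [e, fderiv_add d1 d2]
      simp only [add_apply]
      linarith
  smul_mem' := by
    rintro c l ⟨h1, h2, h3, h4⟩
    refine ⟨fun i p hp => by simp [h1 i p hp], fun i => (h2 i).const_smul c,
      fun p hp => ?_, fun i p hp => ?_⟩
    · have := congrArg (c • ·) (h3 p hp)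
      simpa [Finset.smul_sum, smul_smul] using this
    · have d1 : DifferentiableAt ℝ (fun q => l i q • W.form i q) p :=
        (((h2 i).smul (W.smooth i)).contDiffAt (hD.mem_nhds hp)).differentiableAt (by simp)
      have e : (fun q => (c • l) i q • W.form i q) = c • fun q => l i q • W.form i q := by
        funext q; simp [smul_smul]
      have := h4 i p hp
      simp only [extD] at *
      rw [e, fderiv_const_smul d1]
      simp only [smul_apply, smul_eq_mul]
      rw [← mul_sub, this, mul_zero]

/-- The rank of the web: the dimension of the solution space of its abelian equation. -/
def rank (W : FourWeb D) (hD : IsOpen D) : ℕ :=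
  Module.finrank ℝ (W.abelianSolutions hD)

/-- A normalization of a web: rescaled forms `ω₁, ω₂, ω₃, ω₄` defining the same foliations, with
`ω₁ + ω₂ + ω₃ = 0` and `a ω₁ + ω₂ + ω₄ = 0`, where `a` is the basic invariant.
The forms `ω₁, …, ω₄` have the indices `0, …, 3`. -/
structure Normalization (W : FourWeb D) where
  scale : Fin 4 → ℝ × ℝ → ℝ
  scale_smooth : ∀ i, ContDiffOn ℝ ∞ (scale i) D
  scale_ne_zero : ∀ i, ∀ p ∈ D, scale i p ≠ 0
  a : ℝ × ℝ → ℝ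
  first_relation : ∀ p ∈ D,
    scale 0 p • W.form 0 p + scale 1 p • W.form 1 p + scale 2 p • W.form 2 p = 0
  second_relation : ∀ p ∈ D,
    a p • scale 0 p • W.form 0 p + scale 1 p • W.form 1 p + scale 3 p • W.form 3 p = 0

namespace Normalization

variable {W : FourWeb D} (N : W.Normalization)

def ω₁ : OneForm := fun p => N.scale 0 p • W.form 0 p

def ω₂ : OneForm := fun p => N.scale 1 p • W.form 1 p

/-- The first vector of the frame dual to `ω₁, ω₂`. -/
def frame₁ (p : ℝ × ℝ) : ℝ × ℝ :=
  (wedge N.ω₁ N.ω₂ p)⁻¹ • (N.ω₂ p (0, 1), -N.ω₂ p (1, 0))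

/-- The second vector of the frame dual to `ω₁, ω₂`. -/
def frame₂ (p : ℝ × ℝ) : ℝ × ℝ :=
  (wedge N.ω₁ N.ω₂ p)⁻¹ • (-N.ω₁ p (0, 1), N.ω₁ p (1, 0))

/-! The coefficients of the connection form `γ = g₁ ω₁ + g₂ ω₂`, the only `1`-form with
`dωᵢ = ωᵢ ∧ γ` for `i = 1, 2, 3`: these equations say that `dω₁ = g₂ ω₁ ∧ ω₂` and
`dω₂ = -g₁ ω₁ ∧ ω₂`. -/

def g₁ (p : ℝ × ℝ) : ℝ := -(extD N.ω₂ p / wedge N.ω₁ N.ω₂ p)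

def g₂ (p : ℝ × ℝ) : ℝ := extD N.ω₁ p / wedge N.ω₁ N.ω₂ p

/-- The connection form of the Chern connection. -/
def γ : OneForm := fun p => N.g₁ p • N.ω₁ p + N.g₂ p • N.ω₂ p

/-- The curvature function of the `3`-subweb `ω₁, ω₂, ω₃`: `dγ = K ω₁ ∧ ω₂`. -/
def K (p : ℝ × ℝ) : ℝ := extD N.γ p / wedge N.ω₁ N.ω₂ p

/-- The covariant derivative along `∂₁` of a function of weight `w`. -/
def δ₁ (w : ℕ) (u : ℝ × ℝ → ℝ) (p : ℝ × ℝ) : ℝ :=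
  fderiv ℝ u p (N.frame₁ p) - w * N.g₁ p * u p

/-- The covariant derivative along `∂₂` of a function of weight `w`. -/
def δ₂ (w : ℕ) (u : ℝ × ℝ → ℝ) (p : ℝ × ℝ) : ℝ :=
  fderiv ℝ u p (N.frame₂ p) - w * N.g₂ p * u p

/-! Second and third covariant derivatives are symmetrized. -/

/-- The derivative `u₁₁` of a function `u` of weight `w`. -/
def δ₁₁ (w : ℕ) (u : ℝ × ℝ → ℝ) : ℝ × ℝ → ℝ := N.δ₁ (w + 1) (N.δ₁ w u)

/-- The derivative `u₂₂` of a function `u` of weight `w`. -/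
def δ₂₂ (w : ℕ) (u : ℝ × ℝ → ℝ) : ℝ × ℝ → ℝ := N.δ₂ (w + 1) (N.δ₂ w u)

/-- The derivative `u₁₂` of a function `u` of weight `w`. -/
def δ₁₂ (w : ℕ) (u : ℝ × ℝ → ℝ) (p : ℝ × ℝ) : ℝ :=
  (N.δ₁ (w + 1) (N.δ₂ w u) p + N.δ₂ (w + 1) (N.δ₁ w u) p) / 2

/-- The derivative `u₁₁₂` of a function `u` of weight `w`. -/
def δ₁₁₂ (w : ℕ) (u : ℝ × ℝ → ℝ) (p : ℝ × ℝ) : ℝ :=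
  (N.δ₁ (w + 2) (N.δ₁ (w + 1) (N.δ₂ w u)) p + N.δ₁ (w + 2) (N.δ₂ (w + 1) (N.δ₁ w u)) p +
    N.δ₂ (w + 2) (N.δ₁ (w + 1) (N.δ₁ w u)) p) / 3

/-- The derivative `u₁₂₂` of a function `u` of weight `w`. -/
def δ₁₂₂ (w : ℕ) (u : ℝ × ℝ → ℝ) (p : ℝ × ℝ) : ℝ :=
  (N.δ₁ (w + 2) (N.δ₂ (w + 1) (N.δ₂ w u)) p + N.δ₂ (w + 2) (N.δ₁ (w + 1) (N.δ₂ w u)) p +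
    N.δ₂ (w + 2) (N.δ₂ (w + 1) (N.δ₁ w u)) p) / 3

/-! The basic invariant `a` has weight `0`, its curvature `K` and `c₀` have weight `2`, the
coefficients `c₁, c₂` have weight `3`, and the `Gᵢⱼ` have weight `6`. -/

def c₀ (p : ℝ × ℝ) : ℝ :=
  let a := N.a p
  let a₁ := N.δ₁ 0 N.a p
  let a₂ := N.δ₂ 0 N.a p
  let a₁₁ := N.δ₁₁ 0 N.a p
  let a₁₂ := N.δ₁₂ 0 N.a p
  let a₂₂ := N.δ₂₂ 0 N.a p
  N.K p + (a₁₁ - a * a₂₂ - 2 * (1 - a) * a₁₂) / (4 * a * (1 - a)) +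
    ((-1 + 2 * a) * a₁ ^ 2 - a ^ 2 * a₂ ^ 2 + 2 * (1 - a) ^ 2 * a₁ * a₂) /
      (4 * (1 - a) ^ 2 * a ^ 2)

def c₁ (p : ℝ × ℝ) : ℝ :=
  let a := N.a p
  let a₁ := N.δ₁ 0 N.a p
  let a₂ := N.δ₂ 0 N.a p
  let a₁₂ := N.δ₁₂ 0 N.a p
  let a₂₂ := N.δ₂₂ 0 N.a p
  let a₁₁₂ := N.δ₁₁₂ 0 N.a p
  let a₁₂₂ := N.δ₁₂₂ 0 N.a p
  let K := N.K p
  let K₁ := N.δ₁ 2 N.K p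
  let K₂ := N.δ₂ 2 N.K p
  (K₂ - K₁) / (4 * (1 - a)) +
    ((a - 4) * a₁ + (11 - 20 * a + 12 * a ^ 2) * a₂) / (12 * (1 - a) ^ 2 * a) * K +
    (a₁₁₂ - a₁₂₂) / (4 * a * (1 - a)) +
    (a₁ - a * a₂) / (4 * a ^ 2 * (1 - a)) * a₂₂ +
    (2 * a - 1) * (a₁ - a * a₂) / (4 * (1 - a) ^ 2 * a ^ 2) * a₁₂ -
    a₂ ^ 2 * ((1 - 2 * a) * a₁ + a * a₂) / (4 * (1 - a) ^ 2 * a ^ 2)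

def c₂ (p : ℝ × ℝ) : ℝ :=
  let a := N.a p
  let a₁ := N.δ₁ 0 N.a p
  let a₂ := N.δ₂ 0 N.a p
  let K := N.K p
  let K₁ := N.δ₁ 2 N.K p
  let K₂ := N.δ₂ 2 N.K p
  (a * K₂ - K₁) / (4 * a * (1 - a)) +
    ((1 - 2 * a) * a₁ - (a - 2) * a * a₂) / (4 * (1 - a) ^ 2 * a ^ 2) * K

def J₁ (p : ℝ × ℝ) : ℝ :=
  let a := N.a p
  let a₂ := N.δ₂ 0 N.a p
  let c₁ := N.c₁ p
  let c₂ := N.c₂ p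
  let c₁₁ := N.δ₁ 3 N.c₁ p
  let c₁₂ := N.δ₂ 3 N.c₁ p
  let c₂₁ := N.δ₁ 3 N.c₂ p
  let c₂₂ := N.δ₂ 3 N.c₂ p
  a₂ * c₁ * c₂ * (c₁ - c₂) + a * c₂ ^ 2 * (c₁₂ - c₁₁) +
    c₁ * c₂ * (c₁₁ + a * (c₂₁ - c₁₂ - c₂₂)) + c₁ ^ 2 * (a * c₂₂ - c₂₁)

def J₂ (p : ℝ × ℝ) : ℝ :=
  let K := N.K p
  let c₁ := N.c₁ p
  let c₂ := N.c₂ p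
  let c₁₁ := N.δ₁ 3 N.c₁ p
  let c₁₂ := N.δ₂ 3 N.c₁ p
  let c₂₁ := N.δ₁ 3 N.c₂ p
  let c₂₂ := N.δ₂ 3 N.c₂ p
  let c₁₁₁ := N.δ₁₁ 3 N.c₁ p
  let c₁₁₂ := N.δ₁₂ 3 N.c₁ p
  let c₂₁₁ := N.δ₁₁ 3 N.c₂ p
  let c₂₁₂ := N.δ₁₂ 3 N.c₂ p
  c₁ ^ 2 * (c₁ - c₂) ^ 2 * K + (c₁₁₁ - c₁₁₂) * c₁ * c₂ * (c₂ - c₁) +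
    c₁ ^ 2 * (c₁ - c₂) * (c₂₁₁ - c₂₁₂) - c₂ * (2 * c₁ - c₂) * c₁₁ * (c₁₂ - c₁₁) +
    c₁ ^ 2 * c₂₁ * (c₁₂ - c₂₂ + c₂₁) + c₁ ^ 2 * c₁₁ * (c₂₂ - 2 * c₂₁)

def J₃ (p : ℝ × ℝ) : ℝ :=
  let a := N.a p
  let a₁ := N.δ₁ 0 N.a p
  let a₂ := N.δ₂ 0 N.a p
  let a₁₂ := N.δ₁₂ 0 N.a p
  let a₂₂ := N.δ₂₂ 0 N.a p
  (a₂₂ - a₁₂) * (1 - a) + a₂ * (a₂ - a₁) - (1 - a) ^ 2 * N.K p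

def J₄ (p : ℝ × ℝ) : ℝ :=
  let a := N.a p
  let a₁ := N.δ₁ 0 N.a p
  let a₂ := N.δ₂ 0 N.a p
  let a₁₂ := N.δ₁₂ 0 N.a p
  a₁₂ * a - a₁ * a₂ - N.K p * a ^ 2

def G₁₁ (p : ℝ × ℝ) : ℝ :=
  let a := N.a p
  let a₁ := N.δ₁ 0 N.a p
  let a₂ := N.δ₂ 0 N.a p
  let c₀ := N.c₀ p
  let c₁ := N.c₁ p
  let c₂ := N.c₂ p
  let c₀₁ := N.δ₁ 2 N.c₀ p
  let c₀₂ := N.δ₂ 2 N.c₀ p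
  let c₂₁ := N.δ₁ 3 N.c₂ p
  let c₂₂ := N.δ₂ 3 N.c₂ p
  a * c₀ * (c₂₂ - c₂₁) + a * c₂ * (c₀₁ - c₀₂) - a * (1 - a) * c₁ * c₂ +
    (2 * a₂ - a₁ - a * a₂) * c₀ * c₂ - N.K p * c₀ ^ 2

def G₁₂ (p : ℝ × ℝ) : ℝ :=
  let a := N.a p
  let a₁ := N.δ₁ 0 N.a p
  let a₂ := N.δ₂ 0 N.a p
  let a₁₂ := N.δ₁₂ 0 N.a p
  let a₂₂ := N.δ₂₂ 0 N.a p
  let c₀ := N.c₀ p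
  let c₁ := N.c₁ p
  let c₀₁ := N.δ₁ 2 N.c₀ p
  let c₀₂ := N.δ₂ 2 N.c₀ p
  let c₁₁ := N.δ₁ 3 N.c₁ p
  let c₁₂ := N.δ₂ 3 N.c₁ p
  a * c₀ * (c₁₂ - c₁₁) + a * c₁ * (c₀₁ - c₀₂) - a * (1 - a) * c₁ ^ 2 +
    (2 * a₂ - a₁ - 2 * a * a₂) * c₀ * c₁ + (a₂ ^ 2 + a₁₂ - a₂₂) * c₀ ^ 2

def G₂₁ (p : ℝ × ℝ) : ℝ :=
  let a := N.a p
  let a₂ := N.δ₂ 0 N.a p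
  let c₀ := N.c₀ p
  let c₂ := N.c₂ p
  let c₀₁ := N.δ₁ 2 N.c₀ p
  let c₀₂ := N.δ₂ 2 N.c₀ p
  let c₂₁ := N.δ₁ 3 N.c₂ p
  let c₂₂ := N.δ₂ 3 N.c₂ p
  c₀ * (c₂₁ - a * c₂₂) + c₂ * (a * c₀₂ - c₀₁) - 2 * a₂ * c₀ * c₂ + a * (1 - a) * c₂ ^ 2

def G₂₂ (p : ℝ × ℝ) : ℝ :=
  let a := N.a p
  let a₂ := N.δ₂ 0 N.a p
  let a₂₂ := N.δ₂₂ 0 N.a p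
  let c₀ := N.c₀ p
  let c₁ := N.c₁ p
  let c₂ := N.c₂ p
  let c₀₁ := N.δ₁ 2 N.c₀ p
  let c₀₂ := N.δ₂ 2 N.c₀ p
  let c₁₁ := N.δ₁ 3 N.c₁ p
  let c₁₂ := N.δ₂ 3 N.c₁ p
  c₀ * (c₁₁ - a * c₁₂) + c₁ * (a * c₀₂ - c₀₁) + a * (1 - a) * c₁ * c₂ - a₂ * c₀ * c₁ -
    a₂ * (1 - a) * c₀ * c₂ + (a₂₂ - N.K p) * c₀ ^ 2

/-- The matrix with the entries `Gᵢⱼ`. -/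
def G (p : ℝ × ℝ) : Matrix (Fin 2) (Fin 2) ℝ := !![N.G₁₁ p, N.G₁₂ p; N.G₂₁ p, N.G₂₂ p]

def J₁₀ (p : ℝ × ℝ) : ℝ := N.G₁₁ p * N.G₂₂ p - N.G₂₁ p * N.G₁₂ p

/-- The expression `J₁₁` formed from a pair `(r, s)` of functions of weight `6`. -/
def J₁₁ (r s : ℝ × ℝ → ℝ) (p : ℝ × ℝ) : ℝ :=
  let a := N.a p
  let a₂ := N.δ₂ 0 N.a p
  let c₀ := N.c₀ p
  let c₁ := N.c₁ p
  let c₂ := N.c₂ p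
  c₀ * (N.δ₁ 6 r p * s p - N.δ₁ 6 s p * r p) + (a₂ * c₀ - a * c₁) * r p ^ 2 +
    (a * c₂ - a₂ * c₀ + a * c₁) * r p * s p - a * c₂ * s p ^ 2

/-- The expression `J₁₂` formed from a pair `(r, s)` of functions of weight `6`. -/
def J₁₂ (r s : ℝ × ℝ → ℝ) (p : ℝ × ℝ) : ℝ :=
  let a := N.a p
  let a₂ := N.δ₂ 0 N.a p
  let c₀ := N.c₀ p
  let c₁ := N.c₁ p
  let c₂ := N.c₂ p
  c₀ * (N.δ₂ 6 r p * s p - N.δ₂ 6 s p * r p) + (a₂ * c₀ - a * c₁) * r p ^ 2 +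
    (a * c₂ + c₁) * r p * s p - c₂ * s p ^ 2

/-- The invariants by which the cases are distinguished are identically zero on `D` or vanish
nowhere on `D`: first `c₀`; then, if `c₀` is zero, `c₁` and `c₁ - c₂`, and otherwise the
matrix `G`. -/
def IsRegular : Prop :=
  ((∀ p ∈ D, N.c₀ p = 0) ∧
      ((∀ p ∈ D, N.c₁ p = 0) ∨ ∀ p ∈ D, N.c₁ p ≠ 0) ∧
      ((∀ p ∈ D, N.c₁ p = N.c₂ p) ∨ ∀ p ∈ D, N.c₁ p ≠ N.c₂ p)) ∨
    ((∀ p ∈ D, N.c₀ p ≠ 0) ∧ ((∀ p ∈ D, N.G p = 0) ∨ ∀ p ∈ D, N.G p ≠ 0))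

end Normalization

end FourWeb

end PlanarWeb

end

/-! Write v = λ₃ and u = λ₄. The relation ∑ λᵢωᵢ = 0 forces λ₁ = v + au and λ₂ = v + u, so the
abelian equation becomes a first order system for v and u in which only w = δ₂u is left free.
Comparing the mixed covariant derivatives of u and of v determines both derivatives of w, because
a(a − 1) ≠ 0. Hence the solutions are the parallel sections of a linear connection of rank three,
`conn₃`. Only the last row of its curvature survives, and it is 4(c₂, c₁, c₀); since curvature
annihilates parallel sections (`Connection.sum_curv_mul`), every solution satisfies c₂v + c₁u + c₀w
= 0 (`IsSolution.relation`).

Let c₀ = 0. If c₁ = c₂ = 0 as well, `conn₃` is flat and solutions can be prescribed too freely for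
rank one. Otherwise the relation fixes the ratio of v and u, and the solutions have the form (ρφ,
σφ) with φ parallel for a connection of rank one. J₂, J₃ and J₄ are, up to sign, the numerators of
its curvature in the three cases; J₁ expresses the one equation that the generic case has not yet
used.

Let c₀ ≠ 0. The relation eliminates w and leaves a connection `conn₂` of rank two, with curvature
−G/c₀². If G = 0, then v and u can be prescribed at a point. If G ≠ 0, a nonzero solution has no
zeros and lies in the kernel of G, so J₁₀ = det G = 0, and the kernel line is invariant, which is
J₁₁ = J₁₂ = 0 for a nonzero row of G. Conversely, the connection induced on an invariant line has as
its curvature the restriction of the ambient one (`Connection.curv_line`), which vanishes on the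
kernel of G; so nothing more is needed. Either row describes the kernel where that row is nonzero,
which is why the first row enters at the zeros of the second.

The analytic input is the Frobenius theorem for linear connections (`exists_parallel_on_ball`),
uniqueness of parallel sections (`parallel_eqOn`), and the passage from local to global sections on
a simply connected domain (`LocalSystem.exists_section`). -/

noncomputable section

namespace PlanarWeb

open Set Metric Filter Topology

/-! ### Frobenius theorem for flat linear connections. -/

section LinearConnection

set_option maxSynthPendingDepth 3

variable {V : Type*} [NormedAddCommGroup V] [NormedSpace ℝ V]
  {E : Type*} [NormedAddCommGroup E] [NormedSpace ℝ E]

lemma ray_mem {p₀ q p : V} {r τ : ℝ} (hq : q ∈ closedBall p₀ r) (hp : p ∈ closedBall p₀ r)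
    (hτ : τ ∈ Icc (0 : ℝ) 1) : q + τ • (p - q) ∈ closedBall p₀ r :=
  (convex_closedBall p₀ r).add_smul_sub_mem hq hp hτ

/-- The integral equation along the rays from `q` of the parallel transport equation of a
connection on a small ball. -/
lemma exists_ray_integral [ProperSpace V] [CompleteSpace E] {Ω : V → E →L[ℝ] V →L[ℝ] E}
    {p₀ : V} {r M : ℝ} (hΩ : ContinuousOn Ω (closedBall p₀ r))
    (hM : ∀ p ∈ closedBall p₀ r, ‖Ω p‖ ≤ M) (hr : M * (2 * r) ≤ 1 / 2)
    {q : V} (hq : q ∈ closedBall p₀ r) (e : E) :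
    ∃ s : V → E, ContinuousOn s (closedBall p₀ r) ∧ ∀ p ∈ closedBall p₀ r,
      s p = e + ∫ τ in (0 : ℝ)..1, Ω (q + τ • (p - q)) (s (q + τ • (p - q))) (p - q) := by
  set R := closedBall p₀ r with hR
  have : CompactSpace R := isCompact_iff_compactSpace.mp (isCompact_closedBall p₀ r)
  have : Nonempty R := ⟨⟨q, hq⟩⟩
  have hM0 : 0 ≤ M := le_trans (norm_nonneg (Ω q)) (hM q hq)
  -- The ray parameter is clamped to [0, 1], so that γ is continuous on all of R × ℝ with values in
  -- the ball.
  let γ : R × ℝ → R := fun z => ⟨q + (projIcc (0 : ℝ) 1 zero_le_one z.2 : ℝ) • (z.1.1 - q),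
    ray_mem hq z.1.2 (projIcc (0 : ℝ) 1 zero_le_one z.2).2⟩
  have hγ : Continuous γ := by
    refine Continuous.subtype_mk ?_ _
    have : Continuous fun z : R × ℝ => (projIcc (0 : ℝ) 1 zero_le_one z.2 : ℝ) :=
      continuous_subtype_val.comp (continuous_projIcc.comp continuous_snd)
    fun_prop
  have hΩR : Continuous fun x : R => Ω x.1 := hΩ.domRestrict
  have hint : ∀ s : C(R, E), Continuous fun z : R × ℝ => Ω (γ z).1 (s (γ z)) (z.1.1 - q) := by
    intro s
    have h1 := hΩR.comp hγ
    have h2 := s.continuous.comp hγ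
    exact (h1.clm_apply h2).clm_apply (by fun_prop)
  let T : C(R, E) → C(R, E) := fun s =>
    ⟨fun p => e + ∫ τ in (0 : ℝ)..1, Ω (γ (p, τ)).1 (s (γ (p, τ))) (p.1 - q),
      continuous_const.add
        (intervalIntegral.continuous_parametric_intervalIntegral_of_continuous'
          (f := fun (p : R) (τ : ℝ) => Ω (γ (p, τ)).1 (s (γ (p, τ))) (p.1 - q)) (hint s) 0 1)⟩
  -- Since ‖p − q‖ ≤ 2r and M · 2r ≤ 1/2, the Picard operator halves distances. Solving for all
  -- endpoints at once in C(R, E) gives continuity in the endpoint for free.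
  have hT : ContractingWith (1 / 2) T := by
    refine ⟨by norm_num, LipschitzWith.of_dist_le_mul fun s t => ?_⟩
    have hst : 0 ≤ dist s t := dist_nonneg
    rw [ContinuousMap.dist_le (by positivity)]
    intro p
    have e1 : T s p - T t p = ∫ τ in (0 : ℝ)..1,
        Ω (γ (p, τ)).1 (s (γ (p, τ)) - t (γ (p, τ))) (p.1 - q) := by
      simp only [T, ContinuousMap.coe_mk, add_sub_add_left_eq_sub]
      rw [← intervalIntegral.integral_sub]
      · simp
      · exact ((hint s).comp (Continuous.prodMk_right p)).intervalIntegrable _ _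
      · exact ((hint t).comp (Continuous.prodMk_right p)).intervalIntegrable _ _
    rw [dist_eq_norm, e1]
    have hd : ‖p.1 - q‖ ≤ 2 * r := by
      rw [← dist_eq_norm]
      have := dist_triangle_right p.1 q p₀
      have h1 := mem_closedBall.mp p.2
      have h2 := mem_closedBall.mp hq
      linarith
    have := intervalIntegral.norm_integral_le_of_norm_le_const (a := (0 : ℝ)) (b := 1)
      (C := M * dist s t * (2 * r))
      (f := fun τ => Ω (γ (p, τ)).1 (s (γ (p, τ)) - t (γ (p, τ))) (p.1 - q)) (by
        intro τ _
        refine (ContinuousLinearMap.le_opNorm _ _).trans ?_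
        refine mul_le_mul ?_ hd (norm_nonneg _) (by positivity)
        refine (ContinuousLinearMap.le_opNorm _ _).trans ?_
        refine mul_le_mul (hM _ (γ (p, τ)).2) ?_ (norm_nonneg _) hM0
        rw [← dist_eq_norm]
        exact ContinuousMap.dist_apply_le_dist _)
    refine this.trans ?_
    simp only [sub_zero, abs_one, mul_one, NNReal.coe_div, NNReal.coe_one, NNReal.coe_ofNat]
    nlinarith
  obtain ⟨s, hs⟩ : ∃ s, T s = s := ⟨_, hT.fixedPoint_isFixedPt⟩
  classical
  let S : V → E := fun p => if h : p ∈ R then s ⟨p, h⟩ else 0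
  have hS : ∀ p (h : p ∈ R), S p = s ⟨p, h⟩ := fun p h => dif_pos h
  refine ⟨S, ?_, fun p hp => ?_⟩
  · rw [continuousOn_iff_continuous_domRestrict]
    convert s.continuous using 1
    funext p
    exact hS p.1 p.2
  · rw [hS p hp, ← hs]
    simp only [T, ContinuousMap.coe_mk]
    congr 1
    refine intervalIntegral.integral_congr fun τ hτ => ?_
    rw [uIcc_of_le zero_le_one] at hτ
    have : γ (⟨p, hp⟩, τ) = ⟨q + τ • (p - q), ray_mem hq hp hτ⟩ := by
      simp only [γ, projIcc_of_mem zero_le_one hτ]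
    simp only [this, hS _ (ray_mem hq hp hτ)]

/-- A solution of the integral equation along rays is parallel along the rays. -/
lemma hasDerivWithinAt_ray [CompleteSpace E] {Ω : V → E →L[ℝ] V →L[ℝ] E}
    {p₀ : V} {r : ℝ} (hΩ : ContinuousOn Ω (closedBall p₀ r))
    {q : V} (hq : q ∈ closedBall p₀ r) {e : E} {s : V → E}
    (hs : ContinuousOn s (closedBall p₀ r))
    (hint : ∀ p ∈ closedBall p₀ r,
      s p = e + ∫ τ in (0 : ℝ)..1, Ω (q + τ • (p - q)) (s (q + τ • (p - q))) (p - q))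
    {p : V} (hp : p ∈ closedBall p₀ r) {τ : ℝ} (hτ : τ ∈ Icc (0 : ℝ) 1) :
    HasDerivWithinAt (fun τ : ℝ => s (q + τ • (p - q)))
      (Ω (q + τ • (p - q)) (s (q + τ • (p - q))) (p - q)) (Icc 0 1) τ := by
  set β : ℝ → E := fun σ => Ω (q + σ • (p - q)) (s (q + σ • (p - q))) (p - q) with hβ
  have hline : ContinuousOn (fun σ : ℝ => q + σ • (p - q)) (Icc 0 1) := by fun_prop
  have hmaps : MapsTo (fun σ : ℝ => q + σ • (p - q)) (Icc 0 1) (closedBall p₀ r) :=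
    fun σ hσ => ray_mem hq hp hσ
  have hβc : ContinuousOn β (Icc 0 1) :=
    ((hΩ.comp hline hmaps).clm_apply (hs.comp hline hmaps)).clm_apply continuousOn_const
  let β' : ℝ → E := fun σ => β (projIcc (0 : ℝ) 1 zero_le_one σ)
  have hβ' : Continuous β' := by
    have : Continuous ((Icc (0:ℝ) 1).domRestrict β) := hβc.domRestrict
    exact this.comp continuous_projIcc
  have heq : ∀ σ ∈ Icc (0 : ℝ) 1, β' σ = β σ := fun σ hσ => by
    simp only [β', projIcc_of_mem zero_le_one hσ]
  -- The substitution t ↦ σt turns the equation at the point with parameter σ into an integral over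
  -- [0, σ] along one fixed ray.
  have hform : ∀ σ ∈ Icc (0 : ℝ) 1, s (q + σ • (p - q)) = e + ∫ t in (0 : ℝ)..σ, β' t := by
    intro σ hσ
    rw [hint _ (hmaps hσ)]
    congr 1
    have h1 : ∀ t : ℝ, q + t • (q + σ • (p - q) - q) = q + (σ * t) • (p - q) := by
      intro t; rw [add_sub_cancel_left, smul_smul, mul_comm]
    have h2 : (∫ t in (0 : ℝ)..1, Ω (q + t • (q + σ • (p - q) - q))
        (s (q + t • (q + σ • (p - q) - q))) (q + σ • (p - q) - q)) =
        ∫ t in (0 : ℝ)..1, σ • β (σ * t) := by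
      refine intervalIntegral.integral_congr fun t _ => ?_
      simp only [hβ, add_sub_cancel_left, map_smul, smul_smul, mul_comm t σ]
    rw [h2, intervalIntegral.integral_smul, intervalIntegral.smul_integral_comp_mul_left,
      mul_zero, mul_one]
    refine intervalIntegral.integral_congr fun t ht => ?_
    rw [uIcc_of_le hσ.1] at ht
    exact (heq t ⟨ht.1, ht.2.trans hσ.2⟩).symm
  have h := ((hβ'.integral_hasStrictDerivAt 0 τ).hasDerivAt.const_add e).hasDerivWithinAt
    (s := Icc 0 1)
  rw [heq τ hτ] at h
  exact h.congr hform (hform τ hτ)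

/-- Uniform first order Taylor estimate on a compact convex set. -/
lemma exists_uniform_taylor {F : Type*} [NormedAddCommGroup F] [NormedSpace ℝ F]
    {f : V → F} {f' : V → V →L[ℝ] F} {R : Set V}
    (hR : IsCompact R) (hconv : Convex ℝ R) (hf : ∀ x ∈ R, HasFDerivWithinAt f (f' x) R x)
    (hf' : ContinuousOn f' R) {η : ℝ} (hη : 0 < η) :
    ∃ δ > 0, ∀ x ∈ R, ∀ y ∈ R, dist y x < δ → ‖f y - f x - f' x (y - x)‖ ≤ η * ‖y - x‖ := by
  have hu := hR.uniformContinuousOn_of_continuous hf'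
  rw [Metric.uniformContinuousOn_iff_le] at hu
  obtain ⟨δ, hδ, h⟩ := hu η hη
  refine ⟨δ, hδ, fun x hx y hy hxy => ?_⟩
  refine Convex.norm_image_sub_le_of_norm_hasFDerivWithin_le' (s := R ∩ ball x δ) (f' := f')
    (fun z hz => (hf z hz.1).mono inter_subset_left) (fun z hz => ?_)
    (hconv.inter (convex_ball x δ)) ⟨hx, mem_ball_self hδ⟩ ⟨hy, hxy⟩
  rw [← dist_eq_norm]
  exact h z hz.1 x hx (mem_ball.mp hz.2).le

/-- The equation of flatness of the linear connection `Ω` at the point `p`. -/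
def IsFlatAt (Ω : V → E →L[ℝ] V →L[ℝ] E) (p : V) : Prop :=
  ∀ (x : E) (ξ η : V), fderiv ℝ Ω p ξ x η + Ω p (Ω p x ξ) η =
    fderiv ℝ Ω p η x ξ + Ω p (Ω p x η) ξ

/-- The section is parallel along rays only; flatness supplies the other directions. The defect of
the first order expansion between the rays to p and to p + k satisfies a linear differential
inequality whose inhomogeneity is o(‖k‖), and it starts from zero. -/
lemma hasFDerivAt_of_ray [ProperSpace V] [CompleteSpace E] {Ω : V → E →L[ℝ] V →L[ℝ] E}
    {D : Set V} (hD : IsOpen D) (hΩ : ContDiffOn ℝ 1 Ω D) (hflat : ∀ p ∈ D, IsFlatAt Ω p)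
    {p₀ : V} {r M : ℝ} (hsub : closedBall p₀ r ⊆ D)
    (hM : ∀ p ∈ closedBall p₀ r, ‖Ω p‖ ≤ M) (hr : M * (2 * r) ≤ 1 / 2)
    {q : V} (hq : q ∈ closedBall p₀ r) {s : V → E} (hs : ContinuousOn s (closedBall p₀ r))
    (hder : ∀ p ∈ closedBall p₀ r, ∀ τ ∈ Icc (0 : ℝ) 1,
      HasDerivWithinAt (fun τ : ℝ => s (q + τ • (p - q)))
        (Ω (q + τ • (p - q)) (s (q + τ • (p - q))) (p - q)) (Icc 0 1) τ)
    {p : V} (hp : p ∈ ball p₀ r) : HasFDerivAt s (Ω p (s p)) p := by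
  set R := closedBall p₀ r with hR
  have hRc : IsCompact R := isCompact_closedBall p₀ r
  have hpR : p ∈ R := ball_subset_closedBall hp
  have hM0 : 0 ≤ M := le_trans (norm_nonneg (Ω q)) (hM q hq)
  have hr0 : 0 < r := dist_nonneg.trans_lt (mem_ball.mp hp)
  have hΩd : ∀ x ∈ R, HasFDerivAt Ω (fderiv ℝ Ω x) x := fun x hx =>
    ((hΩ.contDiffAt (hD.mem_nhds (hsub hx))).differentiableAt (by simp)).hasFDerivAt
  have hΩc : ContinuousOn Ω R := hΩ.continuousOn.mono hsub
  have hΩ'c : ContinuousOn (fderiv ℝ Ω) R :=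
    ((contDiffOn_succ_iff_fderiv_of_isOpen (n := 0) hD).mp (by simpa using hΩ)).2.2.continuousOn.mono
      hsub
  obtain ⟨N₁, hN₁⟩ := hRc.exists_bound_of_continuousOn hs
  obtain ⟨N₂, hN₂⟩ : ∃ N, ∀ x ∈ R, ‖fderiv ℝ Ω x‖ ≤ N :=
    hRc.exists_bound_of_continuousOn (f := fderiv ℝ Ω) hΩ'c
  have hN₁0 : 0 ≤ N₁ := le_trans (norm_nonneg (s q)) (hN₁ q hq)
  have hN₂0 : 0 ≤ N₂ := le_trans (norm_nonneg (fderiv ℝ Ω q)) (hN₂ q hq)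
  have hd : ‖p - q‖ ≤ 2 * r := by
    rw [← dist_eq_norm]
    have := dist_triangle_right p q p₀
    have h1 := mem_closedBall.mp hpR
    have h2 := mem_closedBall.mp hq
    linarith
  rw [hasFDerivAt_iff_isLittleO_nhds_zero, Asymptotics.isLittleO_iff]
  intro c hc
  -- C collects the coefficients of η‖k‖ in the bound of ρ' below; η = c/(2C) makes the final
  -- estimate come out as c‖k‖.
  set C := N₁ * (2 * r) + N₂ * (2 * r) + 1 with hC
  have hC0 : 0 < C := by positivity
  set η := c / (2 * C) with hη
  have hη0 : 0 < η := by positivity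
  obtain ⟨δ₁, hδ₁, H₁⟩ := exists_uniform_taylor hRc (convex_closedBall p₀ r)
    (fun x hx => (hΩd x hx).hasFDerivWithinAt) hΩ'c hη0
  have hu₂ := hRc.uniformContinuousOn_of_continuous hs
  have hu₃ := hRc.uniformContinuousOn_of_continuous (hΩc.clm_apply hs)
  rw [Metric.uniformContinuousOn_iff_le] at hu₂ hu₃
  obtain ⟨δ₂, hδ₂, H₂⟩ := hu₂ η hη0
  obtain ⟨δ₃, hδ₃, H₃⟩ := hu₃ η hη0
  have hball : ∀ᶠ k in 𝓝 (0 : V), p + k ∈ R := by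
    have : Tendsto (fun k : V => p + k) (𝓝 0) (𝓝 p) := by
      simpa using (by fun_prop : Continuous fun k : V => p + k).tendsto 0
    exact (this.eventually_mem (isOpen_ball.mem_nhds hp)).mono
      fun k hk => ball_subset_closedBall hk
  filter_upwards [hball, Metric.ball_mem_nhds (0 : V) hδ₁, Metric.ball_mem_nhds (0 : V) hδ₂,
    Metric.ball_mem_nhds (0 : V) hδ₃] with k hk hk₁ hk₂ hk₃
  rw [mem_ball_zero_iff] at hk₁ hk₂ hk₃
  set x : ℝ → V := fun τ => q + τ • (p - q) with hx
  set y : ℝ → V := fun τ => q + τ • (p + k - q) with hy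
  have hxR : ∀ τ ∈ Icc (0 : ℝ) 1, x τ ∈ R := fun τ hτ => ray_mem hq hpR hτ
  have hyR : ∀ τ ∈ Icc (0 : ℝ) 1, y τ ∈ R := fun τ hτ => ray_mem hq hk hτ
  have hyx : ∀ τ, y τ - x τ = τ • k := fun τ => by
    simp only [hx, hy]; rw [add_sub_add_left_eq_sub, ← smul_sub]; congr 1; abel
  have hτk : ∀ τ ∈ Icc (0 : ℝ) 1, ‖τ • k‖ ≤ ‖k‖ := fun τ hτ => by
    rw [norm_smul, Real.norm_eq_abs, abs_of_nonneg hτ.1]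
    exact mul_le_of_le_one_left (norm_nonneg _) hτ.2
  -- ρ is the defect along the pair of rays. It vanishes at 0, and its value at 1 is the remainder
  -- to be estimated.
  set ρ : ℝ → E := fun τ => s (y τ) - s (x τ) - Ω (x τ) (s (x τ)) (τ • k) with hρ
  set ρ' : ℝ → E := fun τ =>
    (Ω (y τ) - Ω (x τ) - fderiv ℝ Ω (x τ) (τ • k)) (s (y τ)) (p - q) +
      fderiv ℝ Ω (x τ) (τ • k) (s (y τ) - s (x τ)) (p - q) +
      Ω (x τ) (ρ τ) (p - q) + (Ω (y τ) (s (y τ)) - Ω (x τ) (s (x τ))) k with hρ'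
  have hxd : ∀ τ, HasDerivAt x (p - q) τ := fun τ => by
    have := ((hasDerivAt_id τ).smul_const (p - q)).const_add q
    rwa [one_smul] at this
  have hρd : ∀ τ ∈ Icc (0 : ℝ) 1, HasDerivWithinAt ρ (ρ' τ) (Icc 0 1) τ := by
    intro τ hτ
    have d1 := hder (p + k) hk τ hτ
    have d2 := hder p hpR τ hτ
    have d3 : HasDerivWithinAt (fun τ => Ω (x τ)) (fderiv ℝ Ω (x τ) (p - q)) (Icc 0 1) τ :=
      ((hΩd (x τ) (hxR τ hτ)).comp_hasDerivAt τ (hxd τ)).hasDerivWithinAt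
    have d4 : HasDerivWithinAt (fun τ : ℝ => τ • k) k (Icc 0 1) τ := by
      simpa using ((hasDerivAt_id τ).smul_const k).hasDerivWithinAt
    have d := (d1.sub d2).sub ((d3.clm_apply d2).clm_apply d4)
    refine d.congr_deriv ?_
    -- Flatness interchanges the directions p − q and τk. What is left of the derivative is Ω ρ,
    -- which is absorbed, and three terms that are small by uniform continuity.
    have hf := hflat (x τ) (hsub (hxR τ hτ)) (s (x τ)) (p - q) (τ • k)
    have e : p + k - q = (p - q) + k := by abel
    simp only [hρ', hρ]
    change Ω (y τ) (s (y τ)) (p + k - q) - Ω (x τ) (s (x τ)) (p - q) -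
      ((fderiv ℝ Ω (x τ) (p - q) (s (x τ)) + Ω (x τ) (Ω (x τ) (s (x τ)) (p - q))) (τ • k) +
        Ω (x τ) (s (x τ)) k) = _
    rw [e, add_apply, hf]
    simp only [sub_apply, map_sub, map_add]
    abel
  have hρc : ContinuousOn ρ (Icc 0 1) := fun τ hτ => (hρd τ hτ).continuousWithinAt
  obtain ⟨τ₀, hτ₀, hmax⟩ := isCompact_Icc.exists_isMaxOn (nonempty_Icc.mpr zero_le_one) hρc.norm
  set S := ‖ρ τ₀‖ with hS
  have hSmax : ∀ τ ∈ Icc (0 : ℝ) 1, ‖ρ τ‖ ≤ S := fun τ hτ => hmax hτ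
  have hbound : ∀ τ ∈ Icc (0 : ℝ) 1, ‖ρ' τ‖ ≤ S / 2 + C * (η * ‖k‖) := by
    intro τ hτ
    have hdist : dist (y τ) (x τ) ≤ ‖k‖ := by rw [dist_eq_norm, hyx]; exact hτk τ hτ
    have b1 : ‖Ω (y τ) - Ω (x τ) - fderiv ℝ Ω (x τ) (τ • k)‖ ≤ η * ‖k‖ := by
      have := H₁ (x τ) (hxR τ hτ) (y τ) (hyR τ hτ) (hdist.trans_lt hk₁)
      rw [hyx] at this
      exact this.trans (by gcongr; exact hτk τ hτ)
    have b2 : ‖s (y τ) - s (x τ)‖ ≤ η := by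
      rw [← dist_eq_norm]
      exact H₂ _ (hyR τ hτ) _ (hxR τ hτ) (hdist.trans hk₂.le)
    have b3 : ‖Ω (y τ) (s (y τ)) - Ω (x τ) (s (x τ))‖ ≤ η := by
      rw [← dist_eq_norm]
      exact H₃ _ (hyR τ hτ) _ (hxR τ hτ) (hdist.trans hk₃.le)
    have c1 : ‖(Ω (y τ) - Ω (x τ) - fderiv ℝ Ω (x τ) (τ • k)) (s (y τ)) (p - q)‖ ≤
        (η * ‖k‖) * N₁ * (2 * r) :=
      (ContinuousLinearMap.le_opNorm₂ _ _ _).trans (by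
        gcongr
        exact hN₁ _ (hyR τ hτ))
    have c2 : ‖fderiv ℝ Ω (x τ) (τ • k) (s (y τ) - s (x τ)) (p - q)‖ ≤
        (N₂ * ‖k‖) * η * (2 * r) := by
      refine (ContinuousLinearMap.le_opNorm₂ _ _ _).trans ?_
      have := (ContinuousLinearMap.le_opNorm (fderiv ℝ Ω (x τ)) (τ • k)).trans
        (mul_le_mul (hN₂ _ (hxR τ hτ)) (hτk τ hτ) (norm_nonneg _) hN₂0)
      gcongr
    have c3 : ‖Ω (x τ) (ρ τ) (p - q)‖ ≤ S / 2 := by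
      refine (ContinuousLinearMap.le_opNorm₂ _ _ _).trans ?_
      have h1 : ‖Ω (x τ)‖ * ‖ρ τ‖ * ‖p - q‖ ≤ M * S * (2 * r) := by
        gcongr
        · exact hM _ (hxR τ hτ)
        · exact hSmax τ hτ
      have hS0 : 0 ≤ S := norm_nonneg _
      nlinarith
    have c4 : ‖(Ω (y τ) (s (y τ)) - Ω (x τ) (s (x τ))) k‖ ≤ η * ‖k‖ :=
      (ContinuousLinearMap.le_opNorm _ _).trans (by gcongr)
    have := norm_add₄_le (a := (Ω (y τ) - Ω (x τ) - fderiv ℝ Ω (x τ) (τ • k)) (s (y τ)) (p - q))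
      (b := fderiv ℝ Ω (x τ) (τ • k) (s (y τ) - s (x τ)) (p - q))
      (c := Ω (x τ) (ρ τ) (p - q)) (d := (Ω (y τ) (s (y τ)) - Ω (x τ) (s (x τ))) k)
    simp only [hρ', hC]
    refine this.trans ?_
    linarith
  have hρ0 : ρ 0 = 0 := by simp [hρ, hx, hy]
  have hmean := fun τ (hτ : τ ∈ Icc (0 : ℝ) 1) =>
    Convex.norm_image_sub_le_of_norm_hasDerivWithin_le hρd hbound (convex_Icc 0 1)
      (left_mem_Icc.mpr zero_le_one) hτ
  -- The term S/2 comes from Ω ρ and the smallness of the ball; moving it to the left replaces a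
  -- Gronwall argument.
  have hSle : S ≤ S / 2 + C * (η * ‖k‖) := by
    have h := hmean τ₀ hτ₀
    rw [hρ0, sub_zero, sub_zero, Real.norm_eq_abs, abs_of_nonneg hτ₀.1] at h
    refine h.trans (mul_le_of_le_one_right ?_ hτ₀.2)
    have : 0 ≤ S := norm_nonneg _
    positivity
  have h1 := hSmax 1 (right_mem_Icc.mpr zero_le_one)
  have e1 : ρ 1 = s (p + k) - s p - Ω p (s p) k := by simp [hρ, hx, hy]
  rw [e1] at h1
  have e2 : C * (η * ‖k‖) = c / 2 * ‖k‖ := by rw [hη]; field_simp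
  rw [e2] at hSle
  refine h1.trans ?_
  linarith

/-- **Frobenius theorem** for linear connections: a flat connection has local parallel sections
with arbitrary initial values. -/
lemma exists_parallel_on_ball [ProperSpace V] [CompleteSpace E] {Ω : V → E →L[ℝ] V →L[ℝ] E}
    {D : Set V} (hD : IsOpen D) (hΩ : ContDiffOn ℝ 1 Ω D) (hflat : ∀ p ∈ D, IsFlatAt Ω p)
    {p₀ : V} (hp₀ : p₀ ∈ D) :
    ∃ r > 0, ball p₀ r ⊆ D ∧ ∀ q ∈ ball p₀ r, ∀ e : E, ∃ s : V → E,
      (∀ p ∈ ball p₀ r, HasFDerivAt s (Ω p (s p)) p) ∧ s q = e := by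
  obtain ⟨r₀, hr₀, hsub⟩ := Metric.nhds_basis_closedBall.mem_iff.mp (hD.mem_nhds hp₀)
  obtain ⟨M, hM⟩ := (isCompact_closedBall p₀ r₀).exists_bound_of_continuousOn
    (hΩ.continuousOn.mono hsub)
  have hM0 : 0 ≤ M := le_trans (norm_nonneg (Ω p₀)) (hM p₀ (mem_closedBall_self hr₀.le))
  -- With r ≤ 1/(4(M + 1)) one has M · 2r ≤ M/(2(M + 1)) ≤ 1/2.
  set r := min r₀ (1 / (4 * (M + 1))) with hr
  have hrpos : 0 < r := by positivity
  have hrr : closedBall p₀ r ⊆ closedBall p₀ r₀ := closedBall_subset_closedBall (min_le_left _ _)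
  have hM' : ∀ p ∈ closedBall p₀ r, ‖Ω p‖ ≤ M := fun p hp => hM p (hrr hp)
  have hsmall : M * (2 * r) ≤ 1 / 2 := by
    have h1 : r ≤ 1 / (4 * (M + 1)) := min_le_right _ _
    rw [le_div_iff₀ (by positivity)] at h1
    nlinarith
  have hΩc : ContinuousOn Ω (closedBall p₀ r) := hΩ.continuousOn.mono (hrr.trans hsub)
  refine ⟨r, hrpos, (ball_subset_closedBall.trans hrr).trans hsub, fun q hq e => ?_⟩
  have hqR := ball_subset_closedBall hq
  obtain ⟨s, hs, hint⟩ := exists_ray_integral hΩc hM' hsmall hqR e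
  refine ⟨s, fun p hp => hasFDerivAt_of_ray hD hΩ hflat (hrr.trans hsub) hM' hsmall hqR hs
    (fun p hp τ hτ => hasDerivWithinAt_ray hΩc hqR hs hint hp hτ) hp, ?_⟩
  rw [hint q hqR]
  simp

/-- Parallel sections on a connected open set which agree at a point are equal. -/
lemma parallel_eqOn {Ω : V → E →L[ℝ] V →L[ℝ] E} {U : Set V} (hU : IsOpen U)
    (hUc : IsPreconnected U) (hΩ : ContinuousOn Ω U) {s t : V → E}
    (hs : ∀ p ∈ U, HasFDerivAt s (Ω p (s p)) p) (ht : ∀ p ∈ U, HasFDerivAt t (Ω p (t p)) p)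
    {q : V} (hq : q ∈ U) (hst : s q = t q) : EqOn s t U := by
  set f : V → E := fun p => s p - t p with hf
  have hfd : ∀ p ∈ U, HasFDerivAt f (Ω p (f p)) p := fun p hp => by
    simpa only [hf, map_sub] using! (hs p hp).sub (ht p hp)
  have hfc : ContinuousOn f U := fun p hp => (hfd p hp).continuousAt.continuousWithinAt
  have key : ∀ p ∈ U, f p = 0 → ∀ᶠ x in 𝓝 p, f x = 0 := by
    intro p hp h0
    have hnb : ∀ᶠ x in 𝓝 p, x ∈ U ∧ ‖Ω x‖ < ‖Ω p‖ + 1 :=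
      (hU.eventually_mem hp).and
        ((hΩ.continuousAt (hU.mem_nhds hp)).norm.eventually_lt_const (lt_add_one ‖Ω p‖))
    obtain ⟨ε, hε, hball⟩ := Metric.eventually_nhds_iff_ball.mp hnb
    refine Metric.eventually_nhds_iff_ball.mpr ⟨ε, hε, fun x hx => ?_⟩
    have hseg : ∀ τ ∈ Icc (0 : ℝ) 1, p + τ • (x - p) ∈ ball p ε := fun τ hτ =>
      (convex_ball p ε).add_smul_sub_mem (mem_ball_self hε) hx hτ
    have hd : ∀ τ ∈ Icc (0 : ℝ) 1, HasDerivAt (fun τ : ℝ => f (p + τ • (x - p)))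
        (Ω (p + τ • (x - p)) (f (p + τ • (x - p))) (x - p)) τ := fun τ hτ => by
      have hl : HasDerivAt (fun τ : ℝ => p + τ • (x - p)) (x - p) τ := by
        have := ((hasDerivAt_id τ).smul_const (x - p)).const_add p
        rwa [one_smul] at this
      exact (hfd _ (hball _ (hseg τ hτ)).1).comp_hasDerivAt τ hl
    -- Gronwall on the segment from p to x: the difference of two parallel sections solves a linear
    -- equation with bounded coefficients and vanishes at p.
    have := eq_zero_of_abs_deriv_le_mul_abs_self_of_eq_zero_right (a := (0 : ℝ)) (b := 1)
      (f := fun τ : ℝ => f (p + τ • (x - p))) (K := (‖Ω p‖ + 1) * ‖x - p‖)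
      (fun τ hτ => (hd τ hτ).continuousAt.continuousWithinAt)
      (fun τ hτ => (hd τ ⟨hτ.1, hτ.2.le⟩).hasDerivWithinAt) (by simpa using h0)
      (fun τ hτ => by
        refine (ContinuousLinearMap.le_opNorm₂ _ _ _).trans ?_
        rw [mul_right_comm]
        gcongr
        exact (hball _ (hseg τ ⟨hτ.1, hτ.2.le⟩)).2.le) 1 (right_mem_Icc.mpr zero_le_one)
    simpa using this
  have hopen : IsOpen {p | p ∈ U ∧ f p = 0} := by
    rw [isOpen_iff_mem_nhds]
    rintro p ⟨hp, h0⟩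
    exact (hU.eventually_mem hp).and (key p hp h0)
  -- The zero set is open by `key` and closed in U by continuity, and U is connected.
  have hsub : U ⊆ {p | p ∈ U ∧ f p = 0} := by
    refine hUc.subset_of_closure_inter_subset hopen ⟨q, hq, hq, by simp [hf, hst]⟩ ?_
    rintro p ⟨hp, hpU⟩
    refine ⟨hpU, ?_⟩
    by_contra hne
    have : ∀ᶠ x in 𝓝 p, f x ≠ 0 := (hfc.continuousAt (hU.mem_nhds hpU)).eventually_ne hne
    obtain ⟨x, hx, hx'⟩ := mem_closure_iff_nhds.mp hp _ this
    exact hx hx'.2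
  exact fun p hp => sub_eq_zero.mp (hsub hp).2

/-- Solutions of a smooth total differential equation are smooth. -/
lemma contDiffOn_of_parallel {Ω : V → E →L[ℝ] V →L[ℝ] E} {U : Set V} (hU : IsOpen U)
    (hΩ : ContDiffOn ℝ ∞ Ω U) {s : V → E} (hs : ∀ p ∈ U, HasFDerivAt s (Ω p (s p)) p) :
    ContDiffOn ℝ ∞ s U := by
  rw [contDiffOn_infty]
  intro n
  induction n with
  | zero => exact contDiffOn_zero.mpr fun p hp => (hs p hp).continuousAt.continuousWithinAt
  | succ n ih =>
    rw [Nat.cast_add, Nat.cast_one, contDiffOn_succ_iff_fderiv_of_isOpen hU]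
    refine ⟨fun p hp => (hs p hp).differentiableAt.differentiableWithinAt, by simp, ?_⟩
    refine ContDiffOn.congr (f := fun p => Ω p (s p)) ?_ fun p hp => (hs p hp).fderiv
    exact (hΩ.of_le (by exact_mod_cast le_top)).clm_apply ih

end LinearConnection

end PlanarWeb

end

/-! ### From local to global sections: the étale space as a covering. -/

noncomputable section

namespace PlanarWeb

open Set Metric Filter Topology

/-- A system of local sections over the open subset `dom` of `V`: near every point there are
sections through all points of the fibre, and sections are determined by one value. -/
structure LocalSystem (V E : Type*) [TopologicalSpace V] where
  dom : Set V
  fiber : V → Set E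
  /-- `IsSec s x` says that `s` is a section at the point `x`. -/
  IsSec : (V → E) → V → Prop
  mem_fiber : ∀ {s x}, IsSec s x → s x ∈ fiber x
  exists_sec : ∀ p ∈ dom, ∃ U, IsOpen U ∧ IsPreconnected U ∧ p ∈ U ∧ U ⊆ dom ∧
    ∀ q ∈ U, ∀ e ∈ fiber q, ∃ s, (∀ x ∈ U, IsSec s x) ∧ s q = e
  eqOn : ∀ {U}, IsOpen U → IsPreconnected U → U ⊆ dom → ∀ {s t}, (∀ x ∈ U, IsSec s x) →
    (∀ x ∈ U, IsSec t x) → ∀ {q}, q ∈ U → s q = t q → EqOn s t U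

namespace LocalSystem

variable {V E : Type*} [TopologicalSpace V] (S : LocalSystem V E)

/-- The points of the étale space of the local system. -/
structure Total where
  pt : V
  val : E
  pt_mem : pt ∈ S.dom
  val_mem : val ∈ S.fiber pt

variable {S}

lemma Total.ext' {z w : S.Total} (h₁ : z.pt = w.pt) (h₂ : z.val = w.val) : z = w := by
  cases z; cases w; simp_all

/-- The final topology for all local sections: a set is open if its preimage under each of them is
open. -/
instance : TopologicalSpace S.Total where
  IsOpen O := ∀ (U : Set V) (s : V → E), IsOpen U → U ⊆ S.dom → (∀ x ∈ U, S.IsSec s x) →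
    IsOpen {x | x ∈ U ∧ ∃ z ∈ O, z.pt = x ∧ z.val = s x}
  isOpen_univ U s hU hUD hs := by
    convert hU using 1
    ext x
    exact ⟨fun h => h.1, fun h => ⟨h, ⟨x, s x, hUD h, S.mem_fiber (hs x h)⟩, trivial, rfl, rfl⟩⟩
  isOpen_inter O O' h h' U s hU hUD hs := by
    convert (h U s hU hUD hs).inter (h' U s hU hUD hs) using 1
    ext x
    constructor
    · rintro ⟨hx, z, ⟨hz, hz'⟩, e⟩
      exact ⟨⟨hx, z, hz, e⟩, hx, z, hz', e⟩
    · rintro ⟨⟨hx, z, hz, e₁, e₂⟩, -, z', hz', e₁', e₂'⟩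
      obtain rfl : z = z' := Total.ext' (e₁.trans e₁'.symm) (e₂.trans e₂'.symm)
      exact ⟨hx, z, ⟨hz, hz'⟩, e₁, e₂⟩
  isOpen_sUnion 𝒪 h U s hU hUD hs := by
    convert isOpen_biUnion fun O (hO : O ∈ 𝒪) => h O hO U s hU hUD hs using 1
    ext x
    simp only [mem_ofPred_eq, mem_sUnion, mem_iUnion]
    constructor
    · rintro ⟨hx, z, ⟨O, hO, hz⟩, e⟩
      exact ⟨O, hO, hx, z, hz, e⟩
    · rintro ⟨O, hO, hx, z, hz, e⟩
      exact ⟨hx, z, ⟨O, hO, hz⟩, e⟩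

lemma isOpen_total {O : Set S.Total} : IsOpen O ↔ ∀ (U : Set V) (s : V → E), IsOpen U →
    U ⊆ S.dom → (∀ x ∈ U, S.IsSec s x) →
    IsOpen {x | x ∈ U ∧ ∃ z ∈ O, z.pt = x ∧ z.val = s x} := Iff.rfl

lemma continuous_pt : Continuous (Total.pt : S.Total → V) := by
  refine ⟨fun W hW => isOpen_total.mpr fun U s hU hUD hs => ?_⟩
  convert hU.inter hW using 1
  ext x
  constructor
  · rintro ⟨hx, z, hz, rfl, e⟩
    exact ⟨hx, hz⟩
  · rintro ⟨hx, hx'⟩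
    exact ⟨hx, ⟨x, s x, hUD hx, S.mem_fiber (hs x hx)⟩, hx', rfl, rfl⟩

/-- The image of a local section is open in the étale space. -/
lemma isOpen_sheet [LocallyConnectedSpace V] {U : Set V} (hU : IsOpen U) (hUD : U ⊆ S.dom)
    {s : V → E} (hs : ∀ x ∈ U, S.IsSec s x) :
    IsOpen {z : S.Total | z.pt ∈ U ∧ z.val = s z.pt} := by
  refine isOpen_total.mpr fun U' s' hU' hUD' hs' => ?_
  rw [isOpen_iff_mem_nhds]
  rintro x ⟨hx', z, ⟨hx, e⟩, rfl, e'⟩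
  obtain ⟨W, hWsub, hWo, hxW, hWc⟩ := locallyConnectedSpace_iff_subsets_isOpen_isConnected.mp
    inferInstance z.pt (U ∩ U') ((hU.inter hU').mem_nhds ⟨hx, hx'⟩)
  -- Two sections through one point agree on a connected neighbourhood; this is what makes sheets
  -- open.
  have heq : EqOn s s' W := S.eqOn hWo hWc.isPreconnected (fun y hy => hUD (hWsub hy).1)
    (fun y hy => hs y (hWsub hy).1) (fun y hy => hs' y (hWsub hy).2) hxW (e.symm.trans e')
  filter_upwards [hWo.mem_nhds hxW] with y hy
  exact ⟨(hWsub hy).2, ⟨y, s y, hUD (hWsub hy).1, S.mem_fiber (hs y (hWsub hy).1)⟩,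
    ⟨(hWsub hy).1, rfl⟩, rfl, heq hy⟩

lemma continuous_section {U : Set V} (hU : IsOpen U) (hUD : U ⊆ S.dom)
    {s : V → E} (hs : ∀ x ∈ U, S.IsSec s x) :
    Continuous fun x : U => (⟨x.1, s x.1, hUD x.2, S.mem_fiber (hs x.1 x.2)⟩ : S.Total) := by
  refine ⟨fun O hO => ?_⟩
  rw [isOpen_induced_iff]
  refine ⟨_, isOpen_total.mp hO U s hU hUD hs, ?_⟩
  ext x
  constructor
  · rintro ⟨hx, z, hz, e₁, e₂⟩
    rw [mem_preimage]
    convert hz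
    exacts [e₁.symm, e₂.symm]
  · intro hx
    exact ⟨x.2, _, hx, rfl, rfl⟩

/-- Over a neighbourhood U of p as in `exists_sec`, a point of the étale space is labelled by the
value at p of the unique section over U through it. This identifies the part over U with U times the
discrete fibre at p. -/
lemma isEvenlyCovered [LocallyConnectedSpace V] {p : V} (hp : p ∈ S.dom) :
    IsEvenlyCovered (Total.pt : S.Total → V) p (Total.pt ⁻¹' {p} : Set S.Total) := by
  obtain ⟨U, hU, hUc, hpU, hUD, hsec⟩ := S.exists_sec p hp
  choose σ hσ hσp using fun e : S.fiber p => hsec p hpU e e.2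
  let _ : TopologicalSpace (S.fiber p) := ⊥
  have : DiscreteTopology (S.fiber p) := ⟨rfl⟩
  refine IsEvenlyCovered.to_isEvenlyCovered_preimage (I := S.fiber p) ⟨inferInstance, U, hpU, hU,
    hU.preimage continuous_pt, ?_⟩
  let g : U × S.fiber p → (Total.pt ⁻¹' U : Set S.Total) := fun y =>
    ⟨⟨y.1.1, σ y.2 y.1.1, hUD y.1.2, S.mem_fiber (hσ y.2 y.1.1 y.1.2)⟩, y.1.2⟩
  have hg : Continuous g := by
    rw [continuous_prod_of_discrete_right]
    intro e
    exact (continuous_section hU hUD (hσ e)).subtype_mk _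
  have hginj : Function.Injective g := by
    rintro ⟨x, e⟩ ⟨y, f⟩ h
    have h' := congrArg Subtype.val h
    simp only [g, Total.mk.injEq] at h'
    obtain ⟨h₁, h₂⟩ := h'
    obtain rfl : x = y := Subtype.ext h₁
    have := S.eqOn hU hUc hUD (hσ e) (hσ f) x.2 h₂ hpU
    rw [hσp e, hσp f] at this
    rw [Subtype.ext this]
  have hgsurj : Function.Surjective g := by
    rintro ⟨z, hz⟩
    obtain ⟨s, hs, hsz⟩ := hsec z.pt hz z.val z.val_mem
    have hsp := S.mem_fiber (hs p hpU)
    refine ⟨(⟨z.pt, hz⟩, ⟨s p, hsp⟩), Subtype.ext (Total.ext' rfl ?_)⟩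
    exact (S.eqOn hU hUc hUD (hσ ⟨_, hsp⟩) hs hpU (hσp ⟨_, hsp⟩) hz).trans hsz
  have hgo : IsOpenMap g := by
    intro O hO
    have : g '' O = ⋃ e : S.fiber p, Subtype.val ⁻¹' {z : S.Total |
        z.pt ∈ Subtype.val '' ((fun x : U => (x, e)) ⁻¹' O) ∧ z.val = σ e z.pt} := by
      ext z
      simp only [mem_iUnion]
      constructor
      · rintro ⟨⟨x, e⟩, hx, rfl⟩
        exact ⟨e, ⟨x, hx, rfl⟩, rfl⟩
      · rintro ⟨e, ⟨x, hx, hxz⟩, hz⟩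
        exact ⟨(x, e), hx, Subtype.ext (Total.ext' hxz (by rw [hz, ← hxz]))⟩
    rw [this]
    refine isOpen_iUnion fun e => (isOpen_sheet ?_ ?_ ?_).preimage continuous_subtype_val
    · exact hU.isOpenMap_subtype_val _ (hO.preimage (Continuous.prodMk_left e))
    · rintro _ ⟨x, -, rfl⟩
      exact hUD x.2
    · rintro _ ⟨x, -, rfl⟩
      exact hσ e x x.2
  refine ⟨((Equiv.ofBijective g ⟨hginj, hgsurj⟩).toHomeomorphOfContinuousOpen hg hgo).symm, ?_⟩
  intro z
  obtain ⟨y, rfl⟩ := hgsurj z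
  have : ((Equiv.ofBijective g ⟨hginj, hgsurj⟩).toHomeomorphOfContinuousOpen hg hgo).symm (g y) = y :=
    Homeomorph.symm_apply_apply _ y
  rw [this]

/-- A local system on a simply connected open set has global sections through every point. -/
theorem exists_section [LocallyPathConnectedSpace V] (hD : IsOpen S.dom)
    (hD' : IsSimplyConnected S.dom)
    (hloc : ∀ s t x, s =ᶠ[𝓝 x] t → S.IsSec s x → S.IsSec t x)
    {p : V} (hp : p ∈ S.dom) {e : E} (he : e ∈ S.fiber p) :
    ∃ s, (∀ x ∈ S.dom, S.IsSec s x) ∧ s p = e := by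
  have := hD'.simplyConnectedSpace
  have := hD.locallyPathConnectedSpace
  have cov : IsCoveringMapOn (Total.pt : S.Total → V) S.dom := fun x hx => isEvenlyCovered hx
  -- A global section is a lift of the inclusion of `dom`; it exists because `dom` is simply
  -- connected and locally path connected.
  obtain ⟨Φ, ⟨hΦp, hΦ⟩, -⟩ := cov.existsUnique_continuousMap_lifts
    (⟨Subtype.val, continuous_subtype_val⟩ : C(S.dom, V)) (a₀ := ⟨p, hp⟩) (e₀ := ⟨p, e, hp, he⟩)
    rfl (fun a => a.2)
  have hΦ' : ∀ x : S.dom, (Φ x).pt = x := fun x => congrFun hΦ x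
  classical
  refine ⟨fun x => if h : x ∈ S.dom then (Φ ⟨x, h⟩).val else e, fun x hx => ?_, ?_⟩
  · obtain ⟨U, hU, -, hxU, hUD, hsec⟩ := S.exists_sec x hx
    have hmem := (Φ ⟨x, hx⟩).val_mem
    rw [hΦ'] at hmem
    obtain ⟨s, hs, hsx⟩ := hsec x hxU _ hmem
    refine hloc s _ x ?_ (hs x hxU)
    -- Near x the lift stays in the open sheet of s, so its value has the same germ as s, and `hloc`
    -- applies.
    have hopen := hD.isOpenMap_subtype_val _ ((isOpen_sheet hU hUD hs).preimage Φ.continuous)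
    have hx' : x ∈ Subtype.val '' (Φ ⁻¹' {z | z.pt ∈ U ∧ z.val = s z.pt}) := by
      refine ⟨⟨x, hx⟩, ⟨?_, ?_⟩, rfl⟩
      · rw [hΦ']; exact hxU
      · rw [hΦ', hsx]
    filter_upwards [hopen.mem_nhds hx'] with y hy
    obtain ⟨y, ⟨-, hy⟩, rfl⟩ := hy
    rw [dif_pos y.2]
    rw [hΦ'] at hy
    exact hy.symm
  · simp only [dif_pos hp, hΦp]

end LocalSystem

end PlanarWeb

end

/-! ### The dual frame and the calculus of weighted covariant derivatives. -/

noncomputable section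

namespace PlanarWeb

open Set Filter Topology

lemma wedge_ne_zero {α β : OneForm} {p : ℝ × ℝ} (h : LinearIndependent ℝ ![α p, β p]) :
    wedge α β p ≠ 0 := by
  intro h0
  simp only [wedge] at h0
  rw [LinearIndependent.pair_iff] at h
  have ext : ∀ φ : ℝ × ℝ →L[ℝ] ℝ, φ (1, 0) = 0 → φ (0, 1) = 0 → φ = 0 := by
    intro φ h1 h2
    ext <;> simpa
  have h1 := h (β p (1, 0)) (-α p (1, 0)) (ext _ (by simp; ring) (by simp; linarith))
  have h2 := h (β p (0, 1)) (-α p (0, 1)) (ext _ (by simp; linarith) (by simp; ring))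
  have h3 := h 1 0 (ext _ (by simpa using h1.2) (by simpa using h2.2))
  exact one_ne_zero h3.1

/-- Alternating bilinear forms on the plane are multiples of the determinant. This converts `extD`,
written in coordinates, to the frame. -/
lemma bilin_alt (A : ℝ × ℝ →L[ℝ] ℝ × ℝ →L[ℝ] ℝ) (ξ η : ℝ × ℝ) :
    A ξ η - A η ξ = (ξ.1 * η.2 - ξ.2 * η.1) * (A (1, 0) (0, 1) - A (0, 1) (1, 0)) := by
  have e : ∀ v : ℝ × ℝ, v = v.1 • ((1 : ℝ), (0 : ℝ)) + v.2 • ((0 : ℝ), (1 : ℝ)) := by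
    intro v; ext <;> simp
  conv_lhs => rw [e ξ, e η]
  simp only [map_add, map_smul, add_apply, smul_apply, smul_eq_mul]
  ring

lemma contDiffOn_apply {α : OneForm} {D : Set (ℝ × ℝ)} (h : ContDiffOn ℝ ∞ α D) (v : ℝ × ℝ) :
    ContDiffOn ℝ ∞ (fun p => α p v) D := h.clm_apply contDiffOn_const

lemma contDiffOn_wedge {α β : OneForm} {D : Set (ℝ × ℝ)} (h : ContDiffOn ℝ ∞ α D)
    (h' : ContDiffOn ℝ ∞ β D) : ContDiffOn ℝ ∞ (wedge α β) D :=
  ((contDiffOn_apply h _).mul (contDiffOn_apply h' _)).sub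
    ((contDiffOn_apply h _).mul (contDiffOn_apply h' _))

lemma contDiffOn_extD {α : OneForm} {D : Set (ℝ × ℝ)} (hD : IsOpen D) (h : ContDiffOn ℝ ∞ α D) :
    ContDiffOn ℝ ∞ (extD α) D := by
  have := h.fderiv_of_isOpen (m := ∞) hD (by simp)
  exact ((this.clm_apply contDiffOn_const).clm_apply contDiffOn_const).sub
    ((this.clm_apply contDiffOn_const).clm_apply contDiffOn_const)

namespace FourWeb

namespace Normalization

variable {D : Set (ℝ × ℝ)} {W : FourWeb D} (N : W.Normalization)

lemma smooth_ω₁ : ContDiffOn ℝ ∞ N.ω₁ D := (N.scale_smooth 0).smul (W.smooth 0)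

lemma smooth_ω₂ : ContDiffOn ℝ ∞ N.ω₂ D := (N.scale_smooth 1).smul (W.smooth 1)

lemma smooth_scaled (i : Fin 4) : ContDiffOn ℝ ∞ (fun p => N.scale i p • W.form i p) D :=
  (N.scale_smooth i).smul (W.smooth i)

lemma wedge_scaled_ne_zero {i j : Fin 4} (hij : i ≠ j) {p : ℝ × ℝ} (hp : p ∈ D) :
    wedge (fun p => N.scale i p • W.form i p) (fun p => N.scale j p • W.form j p) p ≠ 0 := by
  have h := wedge_ne_zero (α := W.form i) (β := W.form j) (W.transversal i j hij p hp)
  have e : wedge (fun p => N.scale i p • W.form i p) (fun p => N.scale j p • W.form j p) p =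
      N.scale i p * N.scale j p * wedge (W.form i) (W.form j) p := by
    simp [wedge]; ring
  rw [e]
  exact mul_ne_zero (mul_ne_zero (N.scale_ne_zero i p hp) (N.scale_ne_zero j p hp)) h

lemma wedge_ω_ne_zero {p : ℝ × ℝ} (hp : p ∈ D) : wedge N.ω₁ N.ω₂ p ≠ 0 :=
  N.wedge_scaled_ne_zero (i := 0) (j := 1) (by decide) hp

/-- The wedge product of the second relation with ω₄ isolates `a`. Smoothness of `a` and a ≠ 0 are
not part of a normalization; they are read off from this quotient. -/
lemma a_eq {p : ℝ × ℝ} (hp : p ∈ D) : N.a p =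
    -wedge N.ω₂ (fun p => N.scale 3 p • W.form 3 p) p /
      wedge N.ω₁ (fun p => N.scale 3 p • W.form 3 p) p := by
  have h : wedge N.ω₁ (fun p => N.scale 3 p • W.form 3 p) p ≠ 0 :=
    N.wedge_scaled_ne_zero (i := 0) (j := 3) (by decide) hp
  rw [eq_div_iff h]
  have h2 := N.second_relation p hp
  have e1 := congrArg (fun φ : ℝ × ℝ →L[ℝ] ℝ => φ (1, 0)) h2
  have e2 := congrArg (fun φ : ℝ × ℝ →L[ℝ] ℝ => φ (0, 1)) h2
  simp [wedge, ω₁, ω₂] at e1 e2 ⊢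
  linear_combination (N.scale 3 p * W.form 3 p (0, 1)) * e1 -
    (N.scale 3 p * W.form 3 p (1, 0)) * e2

lemma smooth_a : ContDiffOn ℝ ∞ N.a D :=
  ((contDiffOn_wedge N.smooth_ω₂ (N.smooth_scaled 3)).neg.div
    (contDiffOn_wedge N.smooth_ω₁ (N.smooth_scaled 3))
      fun _ hp => N.wedge_scaled_ne_zero (i := 0) (j := 3) (by decide) hp).congr
    fun _ hp => N.a_eq hp

lemma a_ne_zero {p : ℝ × ℝ} (hp : p ∈ D) : N.a p ≠ 0 := by
  rw [N.a_eq hp]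
  exact div_ne_zero (neg_ne_zero.mpr (N.wedge_scaled_ne_zero (i := 1) (j := 3) (by decide) hp))
    (N.wedge_scaled_ne_zero (i := 0) (j := 3) (by decide) hp)

lemma a_ne_one {p : ℝ × ℝ} (hp : p ∈ D) : N.a p ≠ 1 := by
  intro ha
  refine N.wedge_scaled_ne_zero (i := 2) (j := 3) (by decide) hp ?_
  have h1 := N.first_relation p hp
  have h2 := N.second_relation p hp
  rw [ha, one_smul] at h2
  have e : N.scale 2 p • W.form 2 p = N.scale 3 p • W.form 3 p :=
    add_left_cancel (h1.trans h2.symm)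
  simp only [wedge, e]
  ring

lemma one_sub_a_ne_zero {p : ℝ × ℝ} (hp : p ∈ D) : 1 - N.a p ≠ 0 :=
  sub_ne_zero.mpr (N.a_ne_one hp).symm

lemma smooth_frame₁ : ContDiffOn ℝ ∞ N.frame₁ D :=
  ((contDiffOn_wedge N.smooth_ω₁ N.smooth_ω₂).inv fun _ hp => N.wedge_ω_ne_zero hp).smul
    ((contDiffOn_apply N.smooth_ω₂ _).prodMk (contDiffOn_apply N.smooth_ω₂ _).neg)

lemma smooth_frame₂ : ContDiffOn ℝ ∞ N.frame₂ D :=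
  ((contDiffOn_wedge N.smooth_ω₁ N.smooth_ω₂).inv fun _ hp => N.wedge_ω_ne_zero hp).smul
    ((contDiffOn_apply N.smooth_ω₁ _).neg.prodMk (contDiffOn_apply N.smooth_ω₁ _))

lemma covector_apply (φ : ℝ × ℝ →L[ℝ] ℝ) (x y : ℝ) : φ (x, y) = x * φ (1, 0) + y * φ (0, 1) := by
  have : ((x, y) : ℝ × ℝ) = x • ((1 : ℝ), (0 : ℝ)) + y • ((0 : ℝ), (1 : ℝ)) := by simp
  rw [this, map_add, map_smul, map_smul, smul_eq_mul, smul_eq_mul]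

lemma ω₁_frame₁ {p : ℝ × ℝ} (hp : p ∈ D) : N.ω₁ p (N.frame₁ p) = 1 := by
  have h := N.wedge_ω_ne_zero hp
  rw [frame₁, map_smul, covector_apply, smul_eq_mul, inv_mul_eq_one₀ h, wedge]
  ring

lemma ω₂_frame₁ (p : ℝ × ℝ) : N.ω₂ p (N.frame₁ p) = 0 := by
  rw [frame₁, map_smul, covector_apply, smul_eq_mul]
  ring

lemma ω₁_frame₂ (p : ℝ × ℝ) : N.ω₁ p (N.frame₂ p) = 0 := by
  rw [frame₂, map_smul, covector_apply, smul_eq_mul]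
  ring

lemma ω₂_frame₂ {p : ℝ × ℝ} (hp : p ∈ D) : N.ω₂ p (N.frame₂ p) = 1 := by
  have h := N.wedge_ω_ne_zero hp
  rw [frame₂, map_smul, covector_apply, smul_eq_mul, inv_mul_eq_one₀ h, wedge]
  ring

lemma eq_frame {p : ℝ × ℝ} (hp : p ∈ D) (ξ : ℝ × ℝ) :
    ξ = N.ω₁ p ξ • N.frame₁ p + N.ω₂ p ξ • N.frame₂ p := by
  have h := N.wedge_ω_ne_zero hp
  obtain ⟨x, y⟩ := ξ
  simp only [frame₁, frame₂, covector_apply _ x y, Prod.smul_mk, smul_eq_mul, Prod.mk_add_mk]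
  ext <;> simp only [] <;> field_simp <;> simp only [wedge] <;> ring

lemma frame_det {p : ℝ × ℝ} (hp : p ∈ D) :
    (N.frame₁ p).1 * (N.frame₂ p).2 - (N.frame₁ p).2 * (N.frame₂ p).1 =
      (wedge N.ω₁ N.ω₂ p)⁻¹ := by
  have h := N.wedge_ω_ne_zero hp
  simp only [frame₁, frame₂, Prod.smul_mk, smul_eq_mul]
  field_simp
  simp only [wedge]
  ring

lemma extD_frame (α : OneForm) {p : ℝ × ℝ} (hp : p ∈ D) :
    fderiv ℝ α p (N.frame₁ p) (N.frame₂ p) - fderiv ℝ α p (N.frame₂ p) (N.frame₁ p) =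
      extD α p / wedge N.ω₁ N.ω₂ p := by
  rw [bilin_alt, N.frame_det hp, extD]
  ring

variable {N}

lemma smooth_g₁ (hD : IsOpen D) : ContDiffOn ℝ ∞ N.g₁ D :=
  ((contDiffOn_extD hD N.smooth_ω₂).div (contDiffOn_wedge N.smooth_ω₁ N.smooth_ω₂)
    fun _ hp => N.wedge_ω_ne_zero hp).neg

lemma smooth_g₂ (hD : IsOpen D) : ContDiffOn ℝ ∞ N.g₂ D :=
  (contDiffOn_extD hD N.smooth_ω₁).div (contDiffOn_wedge N.smooth_ω₁ N.smooth_ω₂)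
    fun _ hp => N.wedge_ω_ne_zero hp

lemma smooth_γ (hD : IsOpen D) : ContDiffOn ℝ ∞ N.γ D :=
  ((smooth_g₁ hD).smul N.smooth_ω₁).add ((smooth_g₂ hD).smul N.smooth_ω₂)

lemma smooth_K (hD : IsOpen D) : ContDiffOn ℝ ∞ N.K D :=
  (contDiffOn_extD hD (smooth_γ hD)).div (contDiffOn_wedge N.smooth_ω₁ N.smooth_ω₂)
    fun _ hp => N.wedge_ω_ne_zero hp

lemma smooth_δ₁ (hD : IsOpen D) (w : ℕ) {u : ℝ × ℝ → ℝ} (hu : ContDiffOn ℝ ∞ u D) :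
    ContDiffOn ℝ ∞ (N.δ₁ w u) D :=
  ((hu.fderiv_of_isOpen (m := ∞) hD (by simp)).clm_apply N.smooth_frame₁).sub
    ((contDiffOn_const.mul (smooth_g₁ hD)).mul hu)

lemma smooth_δ₂ (hD : IsOpen D) (w : ℕ) {u : ℝ × ℝ → ℝ} (hu : ContDiffOn ℝ ∞ u D) :
    ContDiffOn ℝ ∞ (N.δ₂ w u) D :=
  ((hu.fderiv_of_isOpen (m := ∞) hD (by simp)).clm_apply N.smooth_frame₂).sub
    ((contDiffOn_const.mul (smooth_g₂ hD)).mul hu)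

lemma differentiableAt_of_smooth {F : Type*} [NormedAddCommGroup F] [NormedSpace ℝ F]
    (hD : IsOpen D) {u : ℝ × ℝ → F} (hu : ContDiffOn ℝ ∞ u D) {p : ℝ × ℝ} (hp : p ∈ D) :
    DifferentiableAt ℝ u p :=
  (hu.contDiffAt (hD.mem_nhds hp)).differentiableAt (by simp)

/-- Derivative of the pairing of a `1`-form with a vector field. -/
lemma fderiv_pairing {α : OneForm} {X : ℝ × ℝ → ℝ × ℝ} {p : ℝ × ℝ}
    (hα : DifferentiableAt ℝ α p) (hX : DifferentiableAt ℝ X p) (ξ : ℝ × ℝ) :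
    fderiv ℝ (fun q => α q (X q)) p ξ = fderiv ℝ α p ξ (X p) + α p (fderiv ℝ X p ξ) := by
  rw [fderiv_clm_apply hα hX]
  simp [add_comm]

lemma fderiv_eq_of_eqOn (hD : IsOpen D) {F : Type*} [NormedAddCommGroup F] [NormedSpace ℝ F]
    {u v : ℝ × ℝ → F} (h : ∀ q ∈ D, u q = v q) {p : ℝ × ℝ} (hp : p ∈ D) :
    fderiv ℝ u p = fderiv ℝ v p :=
  Filter.EventuallyEq.fderiv_eq ((hD.eventually_mem hp).mono h)

/-- The bracket of the frame fields: `[∂₁, ∂₂] = -g₂ ∂₁ + g₁ ∂₂`. -/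
lemma frame_bracket (hD : IsOpen D) {p : ℝ × ℝ} (hp : p ∈ D) :
    fderiv ℝ N.frame₂ p (N.frame₁ p) - fderiv ℝ N.frame₁ p (N.frame₂ p) =
      -N.g₂ p • N.frame₁ p + N.g₁ p • N.frame₂ p := by
  have d1 := differentiableAt_of_smooth hD N.smooth_ω₁ hp
  have d2 := differentiableAt_of_smooth hD N.smooth_ω₂ hp
  have e1 := differentiableAt_of_smooth hD N.smooth_frame₁ hp
  have e2 := differentiableAt_of_smooth hD N.smooth_frame₂ hp
  have h11 := fderiv_pairing d1 e1 (N.frame₂ p)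
  have h12 := fderiv_pairing d1 e2 (N.frame₁ p)
  have h21 := fderiv_pairing d2 e1 (N.frame₂ p)
  have h22 := fderiv_pairing d2 e2 (N.frame₁ p)
  -- The pairings of coframe and frame are constant, so their derivatives vanish and ωᵢ([∂₁, ∂₂]) =
  -- −dωᵢ(∂₁, ∂₂).
  rw [fderiv_eq_of_eqOn hD (fun q hq => N.ω₁_frame₁ hq) hp, fderiv_fun_const] at h11
  rw [fderiv_eq_of_eqOn hD (fun q _ => N.ω₁_frame₂ q) hp, fderiv_fun_const] at h12
  rw [fderiv_eq_of_eqOn hD (fun q _ => N.ω₂_frame₁ q) hp, fderiv_fun_const] at h21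
  rw [fderiv_eq_of_eqOn hD (fun q hq => N.ω₂_frame₂ hq) hp, fderiv_fun_const] at h22
  simp only [Pi.zero_apply, zero_apply] at h11 h12 h21 h22
  have x1 := N.extD_frame N.ω₁ hp
  have x2 := N.extD_frame N.ω₂ hp
  rw [N.eq_frame hp (fderiv ℝ N.frame₂ p (N.frame₁ p) - fderiv ℝ N.frame₁ p (N.frame₂ p))]
  simp only [map_sub]
  congr 2
  · rw [g₂]; linarith
  · rw [g₁]; linarith

lemma γ_frame₁ {p : ℝ × ℝ} (hp : p ∈ D) : N.γ p (N.frame₁ p) = N.g₁ p := by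
  simp [γ, N.ω₁_frame₁ hp, N.ω₂_frame₁]

lemma γ_frame₂ {p : ℝ × ℝ} (hp : p ∈ D) : N.γ p (N.frame₂ p) = N.g₂ p := by
  simp [γ, N.ω₂_frame₂ hp, N.ω₁_frame₂]

/-- Cartan's formula for dγ(∂₁, ∂₂); its bracket term γ([∂₁, ∂₂]) = −g₂g₁ + g₁g₂ cancels. -/
lemma K_eq (hD : IsOpen D) {p : ℝ × ℝ} (hp : p ∈ D) :
    N.K p = fderiv ℝ N.g₂ p (N.frame₁ p) - fderiv ℝ N.g₁ p (N.frame₂ p) := by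
  have d := differentiableAt_of_smooth hD (smooth_γ (N := N) hD) hp
  have e1 := differentiableAt_of_smooth hD N.smooth_frame₁ hp
  have e2 := differentiableAt_of_smooth hD N.smooth_frame₂ hp
  have h1 := fderiv_pairing d e1 (N.frame₂ p)
  have h2 := fderiv_pairing d e2 (N.frame₁ p)
  rw [fderiv_eq_of_eqOn hD (fun q hq => γ_frame₁ hq) hp] at h1
  rw [fderiv_eq_of_eqOn hD (fun q hq => γ_frame₂ hq) hp] at h2
  have hb := congrArg (N.γ p) (frame_bracket (N := N) hD hp)
  rw [map_sub, map_add, map_smul, map_smul, γ_frame₁ hp, γ_frame₂ hp, smul_eq_mul,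
    smul_eq_mul] at hb
  rw [K, ← N.extD_frame N.γ hp, h1, h2]
  linarith

/-- The commutator of the covariant derivatives. -/
lemma δ_comm (hD : IsOpen D) (w : ℕ) {u : ℝ × ℝ → ℝ} (hu : ContDiffOn ℝ ∞ u D) {p : ℝ × ℝ}
    (hp : p ∈ D) :
    N.δ₁ (w + 1) (N.δ₂ w u) p = N.δ₂ (w + 1) (N.δ₁ w u) p - w * N.K p * u p := by
  have du := differentiableAt_of_smooth hD hu hp
  have ddu := differentiableAt_of_smooth hD (hu.fderiv_of_isOpen (m := ∞) hD (by simp)) hp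
  have e1 := differentiableAt_of_smooth hD N.smooth_frame₁ hp
  have e2 := differentiableAt_of_smooth hD N.smooth_frame₂ hp
  have dg1 := differentiableAt_of_smooth hD (smooth_g₁ (N := N) hD) hp
  have dg2 := differentiableAt_of_smooth hD (smooth_g₂ (N := N) hD) hp
  have hsymm := ((hu.contDiffAt (hD.mem_nhds hp)).isSymmSndFDerivAt
    (by simpa using WithTop.coe_le_coe.mpr (le_top : (2 : ℕ∞) ≤ ⊤))).eq (N.frame₁ p) (N.frame₂ p)
  have A : fderiv ℝ (N.δ₂ w u) p (N.frame₁ p) =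
      fderiv ℝ (fderiv ℝ u) p (N.frame₁ p) (N.frame₂ p) +
        fderiv ℝ u p (fderiv ℝ N.frame₂ p (N.frame₁ p)) -
        (w * fderiv ℝ N.g₂ p (N.frame₁ p) * u p + w * N.g₂ p * fderiv ℝ u p (N.frame₁ p)) := by
    have := ((ddu.hasFDerivAt.clm_apply e2.hasFDerivAt).sub
      ((dg2.hasFDerivAt.const_mul (w : ℝ)).mul du.hasFDerivAt)).fderiv
    change fderiv ℝ (N.δ₂ w u) p = _ at this
    rw [this]
    simp
    ring
  have B : fderiv ℝ (N.δ₁ w u) p (N.frame₂ p) =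
      fderiv ℝ (fderiv ℝ u) p (N.frame₂ p) (N.frame₁ p) +
        fderiv ℝ u p (fderiv ℝ N.frame₁ p (N.frame₂ p)) -
        (w * fderiv ℝ N.g₁ p (N.frame₂ p) * u p + w * N.g₁ p * fderiv ℝ u p (N.frame₂ p)) := by
    have := ((ddu.hasFDerivAt.clm_apply e1.hasFDerivAt).sub
      ((dg1.hasFDerivAt.const_mul (w : ℝ)).mul du.hasFDerivAt)).fderiv
    change fderiv ℝ (N.δ₁ w u) p = _ at this
    rw [this]
    simp
    ring
  have hb := congrArg (fderiv ℝ u p) (frame_bracket (N := N) hD hp)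
  rw [map_sub, map_add, map_smul, map_smul, smul_eq_mul, smul_eq_mul] at hb
  have hA : N.δ₁ (w + 1) (N.δ₂ w u) p = fderiv ℝ (N.δ₂ w u) p (N.frame₁ p) -
      ((w + 1 : ℕ) : ℝ) * N.g₁ p * (fderiv ℝ u p (N.frame₂ p) - w * N.g₂ p * u p) := rfl
  have hB : N.δ₂ (w + 1) (N.δ₁ w u) p = fderiv ℝ (N.δ₁ w u) p (N.frame₂ p) -
      ((w + 1 : ℕ) : ℝ) * N.g₂ p * (fderiv ℝ u p (N.frame₁ p) - w * N.g₁ p * u p) := rfl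
  rw [hA, hB, A, B, K_eq hD hp]
  push_cast
  linear_combination hsymm + hb

variable (N) in
/-- The function `f` of weight `w` is differentiable at `p`, with the covariant derivatives
`x` and `y`. -/
def HasCov (w : ℕ) (f : ℝ × ℝ → ℝ) (p : ℝ × ℝ) (x y : ℝ) : Prop :=
  DifferentiableAt ℝ f p ∧ N.δ₁ w f p = x ∧ N.δ₂ w f p = y

namespace HasCov

variable {w w' : ℕ} {f f' : ℝ × ℝ → ℝ} {p : ℝ × ℝ} {x y x' y' : ℝ}

lemma of_smooth (hD : IsOpen D) (w : ℕ) (hf : ContDiffOn ℝ ∞ f D) (hp : p ∈ D) :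
    N.HasCov w f p (N.δ₁ w f p) (N.δ₂ w f p) :=
  ⟨differentiableAt_of_smooth hD hf hp, rfl, rfl⟩

lemma add (h : N.HasCov w f p x y) (h' : N.HasCov w f' p x' y') :
    N.HasCov w (fun q => f q + f' q) p (x + x') (y + y') := by
  obtain ⟨d, rfl, rfl⟩ := h
  obtain ⟨d', rfl, rfl⟩ := h'
  refine ⟨d.add d', ?_, ?_⟩ <;> simp only [δ₁, δ₂, fderiv_fun_add d d', add_apply] <;> ring

lemma sub (h : N.HasCov w f p x y) (h' : N.HasCov w f' p x' y') :
    N.HasCov w (fun q => f q - f' q) p (x - x') (y - y') := by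
  obtain ⟨d, rfl, rfl⟩ := h
  obtain ⟨d', rfl, rfl⟩ := h'
  refine ⟨d.sub d', ?_, ?_⟩ <;>
    simp only [δ₁, δ₂, fderiv_fun_sub d d', sub_apply] <;> ring

lemma neg (h : N.HasCov w f p x y) : N.HasCov w (fun q => -f q) p (-x) (-y) := by
  obtain ⟨d, rfl, rfl⟩ := h
  refine ⟨d.neg, ?_, ?_⟩ <;> simp only [δ₁, δ₂, fderiv_fun_neg, neg_apply] <;> ring

lemma mul (h : N.HasCov w f p x y) (h' : N.HasCov w' f' p x' y') :
    N.HasCov (w + w') (fun q => f q * f' q) p (x * f' p + f p * x') (y * f' p + f p * y') := by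
  obtain ⟨d, rfl, rfl⟩ := h
  obtain ⟨d', rfl, rfl⟩ := h'
  refine ⟨d.mul d', ?_, ?_⟩ <;>
    simp only [δ₁, δ₂, fderiv_fun_mul d d', add_apply, smul_apply,
      smul_eq_mul] <;> push_cast <;> ring

lemma const (c : ℝ) : N.HasCov 0 (fun _ => c) p 0 0 := by
  refine ⟨differentiableAt_const c, ?_, ?_⟩ <;> simp [δ₁, δ₂]

lemma const_mul (c : ℝ) (h : N.HasCov w f p x y) :
    N.HasCov w (fun q => c * f q) p (c * x) (c * y) := by
  have := (const (N := N) (p := p) c).mul h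
  simpa using this

lemma sum {ι : Type*} [Fintype ι] {f : ι → ℝ × ℝ → ℝ} {x y : ι → ℝ}
    (h : ∀ i, N.HasCov w (f i) p (x i) (y i)) :
    N.HasCov w (fun q => ∑ i, f i q) p (∑ i, x i) (∑ i, y i) := by
  have hd := fun i => (h i).1
  have e := HasFDerivAt.fun_sum fun i (_ : i ∈ Finset.univ) => (hd i).hasFDerivAt
  refine ⟨e.differentiableAt, ?_, ?_⟩
  · rw [δ₁, e.fderiv, sum_apply, Finset.mul_sum, ← Finset.sum_sub_distrib]
    exact Finset.sum_congr rfl fun i _ => (h i).2.1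
  · rw [δ₂, e.fderiv, sum_apply, Finset.mul_sum, ← Finset.sum_sub_distrib]
    exact Finset.sum_congr rfl fun i _ => (h i).2.2

lemma zero (w : ℕ) : N.HasCov w (fun _ => 0) p 0 0 := by
  refine ⟨differentiableAt_const 0, ?_, ?_⟩ <;> simp [δ₁, δ₂]

/-- The quotient rule. -/
lemma div (h : N.HasCov (w + w') f p x y) (h' : N.HasCov w' f' p x' y') (h0 : f' p ≠ 0) :
    N.HasCov w (fun q => f q / f' q) p ((x * f' p - f p * x') / f' p ^ 2)
      ((y * f' p - f p * y') / f' p ^ 2) := by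
  obtain ⟨d, rfl, rfl⟩ := h
  obtain ⟨d', rfl, rfl⟩ := h'
  have e := d.hasFDerivAt.fun_mul ((hasDerivAt_inv h0).comp_hasFDerivAt p d'.hasFDerivAt)
  simp only [Function.comp_apply, ← div_eq_mul_inv] at e
  refine ⟨e.differentiableAt, ?_, ?_⟩ <;>
    simp only [δ₁, δ₂, e.fderiv, add_apply, smul_apply, smul_eq_mul] <;> push_cast <;>
    field_simp <;> ring

/-- The device for differentiating identities: a function whose covariant derivatives are computed
in two ways yields two new equations. -/
lemma unique (h : N.HasCov w f p x y) (h' : N.HasCov w f p x' y') : x = x' ∧ y = y' :=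
  ⟨h.2.1.symm.trans h'.2.1, h.2.2.symm.trans h'.2.2⟩

lemma congr {U : Set (ℝ × ℝ)} (hU : IsOpen U) (hp : p ∈ U) (h : N.HasCov w f p x y)
    (e : ∀ q ∈ U, f' q = f q) : N.HasCov w f' p x y := by
  obtain ⟨d, rfl, rfl⟩ := h
  have e' : f' =ᶠ[𝓝 p] f := (hU.eventually_mem hp).mono e
  refine ⟨d.congr_of_eventuallyEq e', ?_, ?_⟩ <;> simp only [δ₁, δ₂, e'.fderiv_eq, e p hp]

end HasCov

end Normalization

end FourWeb

end PlanarWeb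

end

/-! ### Linear connections with weights: flatness, curvature and parallel sections. -/

noncomputable section

namespace PlanarWeb

open Set Filter Topology

namespace FourWeb

namespace Normalization

variable {D : Set (ℝ × ℝ)} {W : FourWeb D} {N : W.Normalization}

/-- A linear connection on the trivial bundle with the fibre `ℝⁿ` over a web: the covariant
derivatives of the components of a parallel section, which have the weights `wt`, are given by the
matrices `M₁` and `M₂`. -/
structure Connection (n : ℕ) where
  wt : Fin n → ℕ
  /-- The weights of the entries of the matrices. -/
  d : Fin n → Fin n → ℕ
  wt_add : ∀ i j, wt j + d i j = wt i + 1
  M₁ : Fin n → Fin n → ℝ × ℝ → ℝ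
  M₂ : Fin n → Fin n → ℝ × ℝ → ℝ

namespace Connection

variable {n : ℕ} (C : Connection n)

/-- The matrices of the connection are smooth on `U`. -/
def SmoothOn (U : Set (ℝ × ℝ)) : Prop :=
  ∀ i j, ContDiffOn ℝ ∞ (C.M₁ i j) U ∧ ContDiffOn ℝ ∞ (C.M₂ i j) U

variable (N) in
/-- The section `s` is parallel at `p`. -/
def IsParallel (s : ℝ × ℝ → Fin n → ℝ) (p : ℝ × ℝ) : Prop :=
  ∀ i, N.HasCov (C.wt i) (fun q => s q i) p (∑ j, C.M₁ i j p * s p j) (∑ j, C.M₂ i j p * s p j)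

variable (N) in
/-- The entries of the curvature of the connection. -/
def curv (i j : Fin n) (p : ℝ × ℝ) : ℝ :=
  N.δ₁ (C.d i j) (C.M₂ i j) p - N.δ₂ (C.d i j) (C.M₁ i j) p +
    ∑ k, (C.M₂ i k p * C.M₁ k j p - C.M₁ i k p * C.M₂ k j p) +
    -- The weight term compensates for the commutator of δ₁ and δ₂, which is −wK on functions of
    -- weight w.
    (if i = j then C.wt i * N.K p else 0)

variable (N) in
/-- The curvature of the connection vanishes on `U`. -/
def IsFlatOn (U : Set (ℝ × ℝ)) : Prop := ∀ p ∈ U, ∀ i j, C.curv N i j p = 0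

/-- The operator of a matrix of functions and a weight term. -/
def op (wt : Fin n → ℕ) (M : Fin n → Fin n → ℝ × ℝ → ℝ) (g : ℝ × ℝ → ℝ) (p : ℝ × ℝ) :
    (Fin n → ℝ) →L[ℝ] (Fin n → ℝ) :=
  LinearMap.toContinuousLinearMap
    { toFun := fun x i => ∑ j, M i j p * x j + wt i * g p * x i
      map_add' := fun x y => by
        funext i
        simp only [Pi.add_apply, mul_add, Finset.sum_add_distrib]
        ring
      map_smul' := fun c x => by
        funext i
        simp only [Pi.smul_apply, smul_eq_mul, RingHom.id_apply, mul_add, Finset.mul_sum]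
        congr 1
        · exact Finset.sum_congr rfl fun j _ => by ring
        · ring }

lemma op_apply (wt : Fin n → ℕ) (M : Fin n → Fin n → ℝ × ℝ → ℝ) (g : ℝ × ℝ → ℝ) (p : ℝ × ℝ)
    (x : Fin n → ℝ) (i : Fin n) :
    op wt M g p x i = ∑ j, M i j p * x j + wt i * g p * x i := rfl

lemma smooth_op {U : Set (ℝ × ℝ)} {wt : Fin n → ℕ} {M : Fin n → Fin n → ℝ × ℝ → ℝ}
    {g : ℝ × ℝ → ℝ} (hM : ∀ i j, ContDiffOn ℝ ∞ (M i j) U) (hg : ContDiffOn ℝ ∞ g U) :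
    ContDiffOn ℝ ∞ (op wt M g) U := by
  rw [contDiffOn_clm_apply]
  intro x
  rw [contDiffOn_pi]
  intro i
  simp only [op_apply]
  exact (ContDiffOn.sum fun j _ => (hM i j).mul contDiffOn_const).add
    ((contDiffOn_const.mul hg).mul contDiffOn_const)

variable (N) in
/-- The connection form. -/
def form (p : ℝ × ℝ) : (Fin n → ℝ) →L[ℝ] ℝ × ℝ →L[ℝ] (Fin n → ℝ) :=
  (ContinuousLinearMap.smulRightL ℝ (ℝ × ℝ) (Fin n → ℝ) (N.ω₁ p)).comp (op C.wt C.M₁ N.g₁ p) +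
    (ContinuousLinearMap.smulRightL ℝ (ℝ × ℝ) (Fin n → ℝ) (N.ω₂ p)).comp (op C.wt C.M₂ N.g₂ p)

variable {C}

lemma form_apply (p : ℝ × ℝ) (x : Fin n → ℝ) (ξ : ℝ × ℝ) :
    C.form N p x ξ = N.ω₁ p ξ • op C.wt C.M₁ N.g₁ p x + N.ω₂ p ξ • op C.wt C.M₂ N.g₂ p x := by
  simp [form]

set_option maxSynthPendingDepth 3 in
lemma smooth_form (hD : IsOpen D) {U : Set (ℝ × ℝ)} (hU : U ⊆ D) (hC : C.SmoothOn U) :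
    ContDiffOn ℝ ∞ (C.form N) U := by
  have h1 := (ContinuousLinearMap.smulRightL ℝ (ℝ × ℝ) (Fin n → ℝ)).contDiff.comp_contDiffOn
    (N.smooth_ω₁.mono hU)
  have h2 := (ContinuousLinearMap.smulRightL ℝ (ℝ × ℝ) (Fin n → ℝ)).contDiff.comp_contDiffOn
    (N.smooth_ω₂.mono hU)
  exact (h1.clm_comp (smooth_op (fun i j => (hC i j).1) ((smooth_g₁ hD).mono hU))).add
    (h2.clm_comp (smooth_op (fun i j => (hC i j).2) ((smooth_g₂ hD).mono hU)))

/-- The weight terms in `op` restore ordinary derivatives from covariant ones, so that parallelism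
becomes a total differential equation to which the Frobenius theorem applies. -/
lemma isParallel_iff {s : ℝ × ℝ → Fin n → ℝ} {p : ℝ × ℝ} (hp : p ∈ D) :
    C.IsParallel N s p ↔ HasFDerivAt s (C.form N p (s p)) p := by
  rw [hasFDerivAt_pi']
  refine forall_congr' fun i => ?_
  constructor
  · rintro ⟨hd, h1, h2⟩
    convert! hd.hasFDerivAt using 1
    refine ContinuousLinearMap.ext fun ξ => ?_
    simp only [δ₁, δ₂] at h1 h2
    conv_rhs => rw [N.eq_frame hp ξ]
    rw [map_add, map_smul, map_smul]
    simp only [ContinuousLinearMap.comp_apply, ContinuousLinearMap.proj_apply, form_apply,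
      Pi.add_apply, Pi.smul_apply, op_apply, smul_eq_mul, ← h1, ← h2]
    ring
  · intro h
    have e : ∀ ξ, fderiv ℝ (fun q => s q i) p ξ = C.form N p (s p) ξ i := fun ξ => by
      rw [h.fderiv]; rfl
    refine ⟨h.differentiableAt, ?_, ?_⟩
    · rw [δ₁, e, form_apply, N.ω₁_frame₁ hp, N.ω₂_frame₁]
      simp [op_apply]
    · rw [δ₂, e, form_apply, N.ω₂_frame₂ hp, N.ω₁_frame₂]
      simp [op_apply]

lemma fderiv_op_apply {wt : Fin n → ℕ} {M : Fin n → Fin n → ℝ × ℝ → ℝ}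
    {g : ℝ × ℝ → ℝ} {p : ℝ × ℝ} (hM : ∀ i j, DifferentiableAt ℝ (M i j) p)
    (hg : DifferentiableAt ℝ g p) (hop : DifferentiableAt ℝ (op wt M g) p)
    (x : Fin n → ℝ) (i : Fin n) (ξ : ℝ × ℝ) :
    fderiv ℝ (op wt M g) p ξ x i =
      ∑ j, fderiv ℝ (M i j) p ξ * x j + wt i * fderiv ℝ g p ξ * x i := by
  have h1 := hasFDerivAt_pi'.mp (hop.hasFDerivAt.clm_apply (hasFDerivAt_const x p)) i
  have h2 : HasFDerivAt (fun q => ∑ j, M i j q * x j + wt i * g q * x i) _ p :=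
    (HasFDerivAt.fun_sum fun j (_ : j ∈ Finset.univ) => (hM i j).hasFDerivAt.mul_const (x j)).add
      ((hg.hasFDerivAt.const_mul (wt i : ℝ)).mul_const (x i))
  have h := congrArg (fun φ : ℝ × ℝ →L[ℝ] ℝ => φ ξ) (h1.unique h2)
  simp only [ContinuousLinearMap.comp_apply, ContinuousLinearMap.proj_apply, add_apply,
    ContinuousLinearMap.flip_apply, zero_apply, map_zero, sum_apply, smul_apply,
    smul_eq_mul] at h
  simpa [mul_comm, mul_left_comm] using h

set_option maxSynthPendingDepth 3 in
lemma fderiv_form_apply {p : ℝ × ℝ} (h₁ : DifferentiableAt ℝ N.ω₁ p)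
    (h₂ : DifferentiableAt ℝ N.ω₂ p) (k₁ : DifferentiableAt ℝ (op C.wt C.M₁ N.g₁) p)
    (k₂ : DifferentiableAt ℝ (op C.wt C.M₂ N.g₂) p) (hf : DifferentiableAt ℝ (C.form N) p)
    (x : Fin n → ℝ) (ξ η : ℝ × ℝ) :
    fderiv ℝ (C.form N) p ξ x η =
      fderiv ℝ N.ω₁ p ξ η • op C.wt C.M₁ N.g₁ p x + N.ω₁ p η • fderiv ℝ (op C.wt C.M₁ N.g₁) p ξ x +
      (fderiv ℝ N.ω₂ p ξ η • op C.wt C.M₂ N.g₂ p x +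
        N.ω₂ p η • fderiv ℝ (op C.wt C.M₂ N.g₂) p ξ x) := by
  have e1 := (hf.hasFDerivAt.clm_apply (hasFDerivAt_const x p)).clm_apply (hasFDerivAt_const η p)
  have e2 : HasFDerivAt (fun q => N.ω₁ q η • op C.wt C.M₁ N.g₁ q x +
      N.ω₂ q η • op C.wt C.M₂ N.g₂ q x) _ p :=
    ((h₁.hasFDerivAt.clm_apply (hasFDerivAt_const η p)).smul
      (k₁.hasFDerivAt.clm_apply (hasFDerivAt_const x p))).add
    ((h₂.hasFDerivAt.clm_apply (hasFDerivAt_const η p)).smul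
      (k₂.hasFDerivAt.clm_apply (hasFDerivAt_const x p)))
  simp only [form_apply] at e1
  have h := congrArg (fun φ : ℝ × ℝ →L[ℝ] (Fin n → ℝ) => φ ξ) (e1.unique e2)
  simp at h
  rw [h]
  abel

lemma wedge_apply (α β : OneForm) (p ξ η : ℝ × ℝ) :
    wedge α β p * (ξ.1 * η.2 - ξ.2 * η.1) = α p ξ * β p η - α p η * β p ξ := by
  obtain ⟨x, y⟩ := ξ
  obtain ⟨z, t⟩ := η
  rw [covector_apply (α p) x y, covector_apply (β p) x y, covector_apply (α p) z t,
    covector_apply (β p) z t, wedge]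
  ring

set_option maxSynthPendingDepth 3 in
-- The flatness equation is alternating in ξ and η, hence it is its value on the frame (`key`) times
-- (ω₁ ∧ ω₂)(ξ, η). On the frame, dωᵢ contributes the terms in gᵢ and the weights contribute K
-- through `K_eq`.
lemma isFlatAt_form (hD : IsOpen D) {U : Set (ℝ × ℝ)} (hUo : IsOpen U) (hU : U ⊆ D)
    (hC : C.SmoothOn U) (hflat : C.IsFlatOn N U) {p : ℝ × ℝ} (hp : p ∈ U) :
    IsFlatAt (C.form N) p := by
  have dω₁ := differentiableAt_of_smooth hD N.smooth_ω₁ (hU hp)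
  have dω₂ := differentiableAt_of_smooth hD N.smooth_ω₂ (hU hp)
  have dg₁ := differentiableAt_of_smooth hD (smooth_g₁ (N := N) hD) (hU hp)
  have dg₂ := differentiableAt_of_smooth hD (smooth_g₂ (N := N) hD) (hU hp)
  have dM₁ := fun i j => differentiableAt_of_smooth hUo (hC i j).1 hp
  have dM₂ := fun i j => differentiableAt_of_smooth hUo (hC i j).2 hp
  have dop₁ := differentiableAt_of_smooth hUo
    (smooth_op (wt := C.wt) (fun i j => (hC i j).1) ((smooth_g₁ (N := N) hD).mono hU)) hp
  have dop₂ := differentiableAt_of_smooth hUo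
    (smooth_op (wt := C.wt) (fun i j => (hC i j).2) ((smooth_g₂ (N := N) hD).mono hU)) hp
  have dform := differentiableAt_of_smooth hUo (smooth_form (N := N) hD hU hC) hp
  have hw := N.wedge_ω_ne_zero (hU hp)
  have hext₁ : ∀ ξ η, fderiv ℝ N.ω₁ p ξ η - fderiv ℝ N.ω₁ p η ξ =
      N.g₂ p * (N.ω₁ p ξ * N.ω₂ p η - N.ω₁ p η * N.ω₂ p ξ) := fun ξ η => by
    rw [bilin_alt, ← wedge_apply, g₂, extD]
    field_simp
  have hext₂ : ∀ ξ η, fderiv ℝ N.ω₂ p ξ η - fderiv ℝ N.ω₂ p η ξ =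
      -N.g₁ p * (N.ω₁ p ξ * N.ω₂ p η - N.ω₁ p η * N.ω₂ p ξ) := fun ξ η => by
    rw [bilin_alt, ← wedge_apply, g₁, extD]
    field_simp
  intro x ξ η
  rw [fderiv_form_apply dω₁ dω₂ dop₁ dop₂ dform, fderiv_form_apply dω₁ dω₂ dop₁ dop₂ dform]
  simp only [form_apply, map_add, map_smul]
  set O₁ := op C.wt C.M₁ N.g₁ with hO₁
  set O₂ := op C.wt C.M₂ N.g₂ with hO₂
  have hdec : ∀ (A : ℝ × ℝ →L[ℝ] (Fin n → ℝ) →L[ℝ] (Fin n → ℝ)) (ζ : ℝ × ℝ) (i : Fin n),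
      A ζ x i = N.ω₁ p ζ * A (N.frame₁ p) x i + N.ω₂ p ζ * A (N.frame₂ p) x i := fun A ζ i => by
    conv_lhs => rw [N.eq_frame (hU hp) ζ, map_add, map_smul, map_smul]
    rfl
  funext i
  have key : N.g₂ p * O₁ p x i - N.g₁ p * O₂ p x i + fderiv ℝ O₂ p (N.frame₁ p) x i -
      fderiv ℝ O₁ p (N.frame₂ p) x i + O₂ p (O₁ p x) i - O₁ p (O₂ p x) i = 0 := by
    rw [hO₁, hO₂, fderiv_op_apply dM₁ dg₁ dop₁, fderiv_op_apply dM₂ dg₂ dop₂]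
    simp only [op_apply]
    have hsum : ∑ j, (N.δ₁ (C.d i j) (C.M₂ i j) p - N.δ₂ (C.d i j) (C.M₁ i j) p +
        ∑ k, (C.M₂ i k p * C.M₁ k j p - C.M₁ i k p * C.M₂ k j p) +
        (if i = j then C.wt i * N.K p else 0)) * x j = 0 :=
      Finset.sum_eq_zero fun j _ => by rw [← curv, hflat p hp i j, zero_mul]
    have e₁ : ∀ j, N.δ₁ (C.d i j) (C.M₂ i j) p * x j =
        fderiv ℝ (C.M₂ i j) p (N.frame₁ p) * x j - (C.wt i + 1) * N.g₁ p * (C.M₂ i j p * x j) +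
          N.g₁ p * (C.M₂ i j p * (C.wt j * x j)) := fun j => by
      -- The entry (i, j) has weight wt i + 1 − wt j; with this weight the terms in g₁ and g₂ match
      -- those produced by `op`.
      have : (C.wt j : ℝ) + C.d i j = C.wt i + 1 := by exact_mod_cast C.wt_add i j
      rw [δ₁, show (C.d i j : ℝ) = C.wt i + 1 - C.wt j by linarith]
      ring
    have e₂ : ∀ j, N.δ₂ (C.d i j) (C.M₁ i j) p * x j =
        fderiv ℝ (C.M₁ i j) p (N.frame₂ p) * x j - (C.wt i + 1) * N.g₂ p * (C.M₁ i j p * x j) +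
          N.g₂ p * (C.M₁ i j p * (C.wt j * x j)) := fun j => by
      have : (C.wt j : ℝ) + C.d i j = C.wt i + 1 := by exact_mod_cast C.wt_add i j
      rw [δ₂, show (C.d i j : ℝ) = C.wt i + 1 - C.wt j by linarith]
      ring
    have e₃ : ∑ j, (∑ k, (C.M₂ i k p * C.M₁ k j p - C.M₁ i k p * C.M₂ k j p)) * x j =
        ∑ k, C.M₂ i k p * (∑ j, C.M₁ k j p * x j) -
          ∑ k, C.M₁ i k p * (∑ j, C.M₂ k j p * x j) := by
      simp only [Finset.sum_mul, Finset.mul_sum, sub_mul, Finset.sum_sub_distrib, mul_assoc]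
      congr 1 <;> exact Finset.sum_comm
    have e₄ : ∑ j, (if i = j then (C.wt i : ℝ) * N.K p else 0) * x j = C.wt i * N.K p * x i := by
      simp
    have e₅ : ∀ (M : Fin n → ℝ) (g : ℝ) (y : Fin n → ℝ),
        ∑ k, M k * (y k + C.wt k * g * x k) = ∑ k, M k * y k + g * ∑ k, M k * (C.wt k * x k) :=
      fun M g y => by
        rw [Finset.mul_sum, ← Finset.sum_add_distrib]
        exact Finset.sum_congr rfl fun k _ => by ring
    have hs : ∑ j, N.δ₁ (C.d i j) (C.M₂ i j) p * x j - ∑ j, N.δ₂ (C.d i j) (C.M₁ i j) p * x j +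
        ∑ j, (∑ k, (C.M₂ i k p * C.M₁ k j p - C.M₁ i k p * C.M₂ k j p)) * x j +
        ∑ j, (if i = j then (C.wt i : ℝ) * N.K p else 0) * x j = 0 := by
      refine Eq.trans ?_ hsum
      rw [← Finset.sum_sub_distrib, ← Finset.sum_add_distrib, ← Finset.sum_add_distrib]
      exact Finset.sum_congr rfl fun k _ => by ring
    rw [e₃, e₄] at hs
    simp only [e₁, e₂, Finset.sum_add_distrib, Finset.sum_sub_distrib, ← Finset.mul_sum] at hs
    rw [e₅, e₅]
    rw [K_eq hD (hU hp)] at hs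
    linear_combination hs
  have k1 := hext₁ ξ η
  have k2 := hext₂ ξ η
  simp only [Pi.add_apply, Pi.smul_apply, smul_eq_mul, add_apply, smul_apply, form_apply]
  rw [hdec _ ξ, hdec _ ξ, hdec _ η, hdec _ η]
  linear_combination (O₁ p x i) * k1 + (O₂ p x i) * k2 +
    (N.ω₁ p ξ * N.ω₂ p η - N.ω₁ p η * N.ω₂ p ξ) * key

lemma smooth_of_isParallel (hD : IsOpen D) (hC : C.SmoothOn D) {s : ℝ × ℝ → Fin n → ℝ}
    (hs : ∀ p ∈ D, C.IsParallel N s p) (i : Fin n) : ContDiffOn ℝ ∞ (fun p => s p i) D :=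
  contDiffOn_pi.mp (contDiffOn_of_parallel hD (smooth_form (N := N) hD subset_rfl hC)
    fun p hp => (isParallel_iff hp).mp (hs p hp)) i

lemma eqOn_of_isParallel (hD : IsOpen D) {U : Set (ℝ × ℝ)} (hUo : IsOpen U)
    (hUc : IsPreconnected U) (hU : U ⊆ D) (hC : C.SmoothOn U) {s t : ℝ × ℝ → Fin n → ℝ}
    (hs : ∀ p ∈ U, C.IsParallel N s p) (ht : ∀ p ∈ U, C.IsParallel N t p) {q : ℝ × ℝ}
    (hq : q ∈ U) (hst : s q = t q) : EqOn s t U :=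
  parallel_eqOn hUo hUc (smooth_form (N := N) hD hU hC).continuousOn
    (fun p hp => (isParallel_iff (hU hp)).mp (hs p hp))
    (fun p hp => (isParallel_iff (hU hp)).mp (ht p hp)) hq hst

/-- The curvature vanishes on parallel sections. -/
lemma sum_curv_mul (hD : IsOpen D) (hC : C.SmoothOn D) {s : ℝ × ℝ → Fin n → ℝ}
    (hs : ∀ p ∈ D, C.IsParallel N s p) {p : ℝ × ℝ} (hp : p ∈ D) (i : Fin n) :
    ∑ j, C.curv N i j p * s p j = 0 := by
  have hsm := smooth_of_isParallel hD hC hs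
  have key : ∀ (M : Fin n → Fin n → ℝ × ℝ → ℝ), (∀ i j, ContDiffOn ℝ ∞ (M i j) D) →
      N.HasCov (C.wt i + 1) (fun q => ∑ j, M i j q * s q j) p
        (∑ j, (N.δ₁ (C.d i j) (M i j) p * s p j + M i j p * ∑ k, C.M₁ j k p * s p k))
        (∑ j, (N.δ₂ (C.d i j) (M i j) p * s p j + M i j p * ∑ k, C.M₂ j k p * s p k)) := by
    intro M hM
    refine HasCov.sum fun j => ?_
    rw [← C.wt_add i j, add_comm]
    exact (HasCov.of_smooth hD _ (hM i j) hp).mul (hs p hp j)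
  have k1 := key C.M₁ fun i j => (hC i j).1
  have k2 := key C.M₂ fun i j => (hC i j).2
  have h1 := (HasCov.of_smooth (N := N) hD (C.wt i + 1)
    (smooth_δ₁ (N := N) hD (C.wt i) (hsm i)) hp).unique
    (k1.congr hD hp fun q hq => (hs q hq i).2.1)
  have h2 := (HasCov.of_smooth (N := N) hD (C.wt i + 1)
    (smooth_δ₂ (N := N) hD (C.wt i) (hsm i)) hp).unique
    (k2.congr hD hp fun q hq => (hs q hq i).2.2)
  -- Both mixed second derivatives of the component are known from the parallel equation; their
  -- commutator supplies the weight term of `curv`.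
  have hc := δ_comm (N := N) hD (C.wt i) (hsm i) hp
  rw [h1.2, h2.1] at hc
  have e₃ : ∑ j, (∑ k, (C.M₂ i k p * C.M₁ k j p - C.M₁ i k p * C.M₂ k j p)) * s p j =
      ∑ k, C.M₂ i k p * (∑ j, C.M₁ k j p * s p j) -
        ∑ k, C.M₁ i k p * (∑ j, C.M₂ k j p * s p j) := by
    simp only [Finset.sum_mul, Finset.mul_sum, sub_mul, Finset.sum_sub_distrib, mul_assoc]
    congr 1 <;> exact Finset.sum_comm
  have e₄ : ∑ j, (if i = j then (C.wt i : ℝ) * N.K p else 0) * s p j = C.wt i * N.K p * s p i := by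
    simp
  have e₅ : ∑ j, C.curv N i j p * s p j =
      ∑ j, N.δ₁ (C.d i j) (C.M₂ i j) p * s p j - ∑ j, N.δ₂ (C.d i j) (C.M₁ i j) p * s p j +
        ∑ j, (∑ k, (C.M₂ i k p * C.M₁ k j p - C.M₁ i k p * C.M₂ k j p)) * s p j +
        ∑ j, (if i = j then (C.wt i : ℝ) * N.K p else 0) * s p j := by
    rw [← Finset.sum_sub_distrib, ← Finset.sum_add_distrib, ← Finset.sum_add_distrib]
    exact Finset.sum_congr rfl fun k _ => by rw [curv]; ring
  rw [e₅, e₃, e₄]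
  simp only [Finset.sum_add_distrib] at hc
  linarith

/-- A flat connection has local parallel sections. -/
lemma exists_local_parallel (hD : IsOpen D) {U : Set (ℝ × ℝ)} (hUo : IsOpen U) (hU : U ⊆ D)
    (hC : C.SmoothOn U) (hflat : C.IsFlatOn N U) {p : ℝ × ℝ} (hp : p ∈ U) :
    ∃ B, IsOpen B ∧ IsPreconnected B ∧ p ∈ B ∧ B ⊆ U ∧ ∀ q ∈ B, ∀ e : Fin n → ℝ,
      ∃ s, (∀ x ∈ B, C.IsParallel N s x) ∧ s q = e := by
  obtain ⟨r, hr, hsub, h⟩ := exists_parallel_on_ball hUo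
    ((smooth_form (N := N) hD hU hC).of_le (by simp))
    (fun x hx => isFlatAt_form hD hUo hU hC hflat hx) hp
  refine ⟨Metric.ball p r, Metric.isOpen_ball, (convex_ball p r).isPreconnected,
    Metric.mem_ball_self hr, hsub, fun q hq e => ?_⟩
  obtain ⟨s, hs, hsq⟩ := h q hq e
  exact ⟨s, fun x hx => (isParallel_iff (hU (hsub hx))).mpr (hs x hx), hsq⟩

/-- Parallel sections of a subbundle of a connection which exist locally exist globally. -/
theorem exists_global_parallel (hD : IsOpen D) (hD' : IsSimplyConnected D) (hC : C.SmoothOn D)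
    (F : ℝ × ℝ → Set (Fin n → ℝ))
    (hloc : ∀ p ∈ D, ∃ B, IsOpen B ∧ IsPreconnected B ∧ p ∈ B ∧ B ⊆ D ∧ ∀ q ∈ B, ∀ e ∈ F q,
      ∃ s, (∀ x ∈ B, C.IsParallel N s x ∧ s x ∈ F x) ∧ s q = e)
    {p : ℝ × ℝ} (hp : p ∈ D) {e : Fin n → ℝ} (he : e ∈ F p) :
    ∃ s, (∀ x ∈ D, C.IsParallel N s x ∧ s x ∈ F x) ∧ s p = e :=
  LocalSystem.exists_section
    (S := { dom := D
            fiber := F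
            IsSec := fun s x => C.IsParallel N s x ∧ s x ∈ F x
            mem_fiber := fun h => h.2
            exists_sec := hloc
            eqOn := fun hUo hUc hU _ _ hs ht _ hq hst => eqOn_of_isParallel hD hUo hUc hU
              (fun i j => ⟨(hC i j).1.mono hU, (hC i j).2.mono hU⟩) (fun x hx => (hs x hx).1)
              (fun x hx => (ht x hx).1) hq hst })
    hD hD' (fun s t x hst hs => by
      refine ⟨fun i => ?_, hst.eq_of_nhds ▸ hs.2⟩
      have e : (fun q => t q i) =ᶠ[𝓝 x] fun q => s q i := hst.symm.mono fun q hq => congrFun hq i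
      obtain ⟨d, h₁, h₂⟩ := hs.1 i
      rw [hst.eq_of_nhds] at h₁ h₂
      refine ⟨d.congr_of_eventuallyEq e, ?_, ?_⟩
      · rw [← h₁]; simp only [δ₁, e.fderiv_eq, e.eq_of_nhds]
      · rw [← h₂]; simp only [δ₂, e.fderiv_eq, e.eq_of_nhds]) hp he

theorem exists_parallel (hD : IsOpen D) (hD' : IsSimplyConnected D) (hC : C.SmoothOn D)
    (hflat : C.IsFlatOn N D) {p : ℝ × ℝ} (hp : p ∈ D) (e : Fin n → ℝ) :
    ∃ s, (∀ x ∈ D, C.IsParallel N s x) ∧ s p = e := by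
  obtain ⟨s, hs, hsp⟩ := exists_global_parallel (N := N) hD hD' hC (fun _ => univ)
    (fun p hp => by
      obtain ⟨B, hB, hBc, hpB, hBD, h⟩ := exists_local_parallel hD hD subset_rfl hC hflat hp
      refine ⟨B, hB, hBc, hpB, hBD, fun q hq e _ => ?_⟩
      obtain ⟨s, hs, hsq⟩ := h q hq e
      exact ⟨s, fun x hx => ⟨hs x hx, mem_univ _⟩, hsq⟩) hp (mem_univ e)
  exact ⟨s, fun x hx => (hs x hx).1, hsp⟩

end Connection

end Normalization

end FourWeb

end PlanarWeb

end

/-! ### The abelian equation as a system for λ₃ and λ₄. -/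

noncomputable section

namespace PlanarWeb

open Set Filter Topology

lemma extD_congr {D : Set (ℝ × ℝ)} (hD : IsOpen D) {α β : OneForm} (h : ∀ q ∈ D, α q = β q)
    {p : ℝ × ℝ} (hp : p ∈ D) : extD α p = extD β p := by
  have e : α =ᶠ[𝓝 p] β := (hD.eventually_mem hp).mono h
  rw [extD, extD, e.fderiv_eq]

lemma extD_smul {f : ℝ × ℝ → ℝ} {α : OneForm} {p : ℝ × ℝ} (hf : DifferentiableAt ℝ f p)
    (hα : DifferentiableAt ℝ α p) :
    extD (fun q => f q • α q) p =
      fderiv ℝ f p (1, 0) * α p (0, 1) - fderiv ℝ f p (0, 1) * α p (1, 0) + f p * extD α p := by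
  rw [extD, extD, fderiv_fun_smul hf hα]
  simp
  ring

lemma extD_add {α β : OneForm} {p : ℝ × ℝ} (hα : DifferentiableAt ℝ α p)
    (hβ : DifferentiableAt ℝ β p) : extD (fun q => α q + β q) p = extD α p + extD β p := by
  rw [extD, extD, extD, fderiv_fun_add hα hβ]
  simp
  ring

namespace FourWeb

namespace Normalization

variable {D : Set (ℝ × ℝ)} {W : FourWeb D} {N : W.Normalization}

lemma fderiv_frame {p : ℝ × ℝ} (hp : p ∈ D) (f : ℝ × ℝ → ℝ) (ξ : ℝ × ℝ) :
    fderiv ℝ f p ξ = N.ω₁ p ξ * fderiv ℝ f p (N.frame₁ p) +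
      N.ω₂ p ξ * fderiv ℝ f p (N.frame₂ p) := by
  conv_lhs => rw [N.eq_frame hp ξ, map_add, map_smul, map_smul]
  rfl

/-- Weight one absorbs dω₁ = g₂ ω₁ ∧ ω₂: the term −g₂f in δ₂f is the contribution of f dω₁.
Coefficients of abelian relations therefore have weight one. -/
lemma extD_smul_ω₁ (hD : IsOpen D) {f : ℝ × ℝ → ℝ} (hf : ContDiffOn ℝ ∞ f D) {p : ℝ × ℝ}
    (hp : p ∈ D) : extD (fun q => f q • N.ω₁ q) p = -N.δ₂ 1 f p * wedge N.ω₁ N.ω₂ p := by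
  have hw := N.wedge_ω_ne_zero hp
  rw [extD_smul (differentiableAt_of_smooth hD hf hp)
    (differentiableAt_of_smooth hD N.smooth_ω₁ hp), fderiv_frame (N := N) hp f (1, 0),
    fderiv_frame (N := N) hp f (0, 1), δ₂, g₂]
  field_simp
  rw [wedge]
  push_cast
  ring

lemma extD_smul_ω₂ (hD : IsOpen D) {f : ℝ × ℝ → ℝ} (hf : ContDiffOn ℝ ∞ f D) {p : ℝ × ℝ}
    (hp : p ∈ D) : extD (fun q => f q • N.ω₂ q) p = N.δ₁ 1 f p * wedge N.ω₁ N.ω₂ p := by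
  have hw := N.wedge_ω_ne_zero hp
  rw [extD_smul (differentiableAt_of_smooth hD hf hp)
    (differentiableAt_of_smooth hD N.smooth_ω₂ hp), fderiv_frame (N := N) hp f (1, 0),
    fderiv_frame (N := N) hp f (0, 1), δ₁, g₁]
  field_simp
  rw [wedge]
  push_cast
  ring

lemma extD_smul_add (hD : IsOpen D) {f h : ℝ × ℝ → ℝ} (hf : ContDiffOn ℝ ∞ f D)
    (hh : ContDiffOn ℝ ∞ h D) {p : ℝ × ℝ} (hp : p ∈ D) :
    extD (fun q => f q • N.ω₁ q + h q • N.ω₂ q) p =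
      (N.δ₁ 1 h p - N.δ₂ 1 f p) * wedge N.ω₁ N.ω₂ p := by
  rw [extD_add (α := fun q => f q • N.ω₁ q) (β := fun q => h q • N.ω₂ q)
    (differentiableAt_of_smooth hD (hf.smul N.smooth_ω₁) hp)
    (differentiableAt_of_smooth hD (hh.smul N.smooth_ω₂) hp), extD_smul_ω₁ hD hf hp,
    extD_smul_ω₂ hD hh hp]
  ring

lemma scaled_two {p : ℝ × ℝ} (hp : p ∈ D) : N.scale 2 p • W.form 2 p = -(N.ω₁ p + N.ω₂ p) :=
  (neg_eq_of_add_eq_zero_right (N.first_relation p hp)).symm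

lemma scaled_three {p : ℝ × ℝ} (hp : p ∈ D) :
    N.scale 3 p • W.form 3 p = -(N.a p • N.ω₁ p + N.ω₂ p) :=
  (neg_eq_of_add_eq_zero_right (N.second_relation p hp)).symm

variable (N) in
/-- The abelian equation of a normalized web, written for the coefficients `v = λ₃` and
`u = λ₄`. -/
def IsSolution (v u : ℝ × ℝ → ℝ) : Prop :=
  ContDiffOn ℝ ∞ v D ∧ ContDiffOn ℝ ∞ u D ∧ ∀ p ∈ D, N.δ₁ 1 v p = -N.δ₁ 1 u p ∧
    N.δ₂ 1 v p = -N.δ₁ 1 u p ∧ N.δ₁ 1 u p = N.a p * N.δ₂ 1 u p + N.δ₂ 0 N.a p * u p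

variable (N) in
/-- The tuple of functions with the coefficients `v = λ₃` and `u = λ₄`. -/
def tuple (v u : ℝ × ℝ → ℝ) (i : Fin 4) : ℝ × ℝ → ℝ :=
  -- The first two coefficients are forced by ∑ λᵢωᵢ = 0 in the coframe. The factor `scale` passes
  -- to the original forms, and the extension by zero follows `abelianSolutions`.
  D.indicator fun p => ![v p + N.a p * u p, v p + u p, v p, u p] i * N.scale i p

lemma tuple_apply (v u : ℝ × ℝ → ℝ) (i : Fin 4) {p : ℝ × ℝ} (hp : p ∈ D) :
    N.tuple v u i p = ![v p + N.a p * u p, v p + u p, v p, u p] i * N.scale i p :=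
  indicator_of_mem hp _

lemma smooth_tuple {v u : ℝ × ℝ → ℝ} (hv : ContDiffOn ℝ ∞ v D) (hu : ContDiffOn ℝ ∞ u D)
    (i : Fin 4) : ContDiffOn ℝ ∞ (N.tuple v u i) D := by
  refine ContDiffOn.congr (f := fun p =>
    ![v p + N.a p * u p, v p + u p, v p, u p] i * N.scale i p) ?_ fun p hp => tuple_apply v u i hp
  refine ContDiffOn.mul ?_ (N.scale_smooth i)
  fin_cases i
  · exact hv.add (N.smooth_a.mul hu)
  · exact hv.add hu
  · exact hv
  · exact hu

lemma sum_tuple (v u : ℝ × ℝ → ℝ) {p : ℝ × ℝ} (hp : p ∈ D) :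
    ∑ i, N.tuple v u i p • W.form i p = 0 := by
  simp only [tuple_apply v u _ hp, mul_smul, Fin.sum_univ_four, scaled_two hp, scaled_three hp]
  change (v p + N.a p * u p) • N.ω₁ p + (v p + u p) • N.ω₂ p + v p • -(N.ω₁ p + N.ω₂ p) +
    u p • -(N.a p • N.ω₁ p + N.ω₂ p) = 0
  module

/-- The tuple of `v` and `u` solves the abelian equation if and only if `v` and `u` solve the
system for the coefficients. -/
lemma tuple_closed_iff (hD : IsOpen D) {v u : ℝ × ℝ → ℝ} (hv : ContDiffOn ℝ ∞ v D)
    (hu : ContDiffOn ℝ ∞ u D) :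
    (∀ i, ∀ p ∈ D, extD (fun q => N.tuple v u i q • W.form i q) p = 0) ↔ N.IsSolution v u := by
  have ha := N.smooth_a
  have hau := ha.mul hu
  have key : ∀ p ∈ D, (∀ i, extD (fun q => N.tuple v u i q • W.form i q) p = 0) ↔
      N.δ₁ 1 v p = -N.δ₁ 1 u p ∧ N.δ₂ 1 v p = -N.δ₁ 1 u p ∧
        N.δ₁ 1 u p = N.a p * N.δ₂ 1 u p + N.δ₂ 0 N.a p * u p := by
    intro p hp
    have hw := N.wedge_ω_ne_zero hp
    have cv := HasCov.of_smooth (N := N) hD 1 hv hp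
    have cu := HasCov.of_smooth (N := N) hD 1 hu hp
    have cau : N.HasCov 1 _ p _ _ := (HasCov.of_smooth (N := N) hD 0 ha hp).mul cu
    -- The four conditions read δ₂(v + au) = 0, δ₁(v + u) = 0, δ₁v = δ₂v and δ₁u = δ₂(au). The first
    -- follows from the others, since the four forms add up to zero.
    have E0 : extD (fun q => N.tuple v u 0 q • W.form 0 q) p =
        -(N.δ₂ 1 v p + (N.δ₂ 0 N.a p * u p + N.a p * N.δ₂ 1 u p)) * wedge N.ω₁ N.ω₂ p := by
      rw [extD_congr hD (β := fun q => (v q + N.a q * u q) • N.ω₁ q)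
        (fun q hq => by simp [tuple_apply v u _ hq, mul_smul, ω₁]) hp,
        extD_smul_ω₁ hD (hv.add hau) hp, (cv.add cau).2.2]
    have E1 : extD (fun q => N.tuple v u 1 q • W.form 1 q) p =
        (N.δ₁ 1 v p + N.δ₁ 1 u p) * wedge N.ω₁ N.ω₂ p := by
      rw [extD_congr hD (β := fun q => (v q + u q) • N.ω₂ q)
        (fun q hq => by simp [tuple_apply v u _ hq, mul_smul, ω₂]) hp,
        extD_smul_ω₂ hD (hv.add hu) hp, (cv.add cu).2.1]
    have E2 : extD (fun q => N.tuple v u 2 q • W.form 2 q) p =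
        (-N.δ₁ 1 v p - -N.δ₂ 1 v p) * wedge N.ω₁ N.ω₂ p := by
      rw [extD_congr hD (β := fun q => (-v q) • N.ω₁ q + (-v q) • N.ω₂ q)
        (fun q hq => by
          simp only [tuple_apply v u _ hq, mul_smul, scaled_two hq]
          change v q • _ = _
          module) hp,
        extD_smul_add hD hv.neg hv.neg hp, cv.neg.2.1, cv.neg.2.2]
    have E3 : extD (fun q => N.tuple v u 3 q • W.form 3 q) p =
        (-N.δ₁ 1 u p - -(N.δ₂ 0 N.a p * u p + N.a p * N.δ₂ 1 u p)) * wedge N.ω₁ N.ω₂ p := by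
      rw [extD_congr hD (β := fun q => (-(N.a q * u q)) • N.ω₁ q + (-u q) • N.ω₂ q)
        (fun q hq => by
          simp only [tuple_apply v u _ hq, mul_smul, scaled_three hq]
          change u q • _ = _
          module) hp,
        extD_smul_add hD hau.neg hu.neg hp, cu.neg.2.1, cau.neg.2.2]
    rw [Fin.forall_fin_succ, Fin.forall_fin_succ, Fin.forall_fin_succ, Fin.forall_fin_succ]
    simp only [Fin.succ_zero_eq_one, Fin.succ_one_eq_two, show (Fin.succ (2 : Fin 3)) = 3 from rfl,
      E0, E1, E2, E3, mul_eq_zero, hw, or_false, IsEmpty.forall_iff, and_true]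
    constructor
    · rintro ⟨h0, h1, h2, h3⟩
      refine ⟨?_, ?_, ?_⟩ <;> linarith
    · rintro ⟨h0, h1, h2⟩
      refine ⟨?_, ?_, ?_, ?_⟩ <;> linarith
  constructor
  · intro h
    exact ⟨hv, hu, fun p hp => (key p hp).mp fun i => h i p hp⟩
  · rintro ⟨-, -, h⟩ i p hp
    exact (key p hp).mpr (h p hp) i

lemma tuple_mem (hD : IsOpen D) {v u : ℝ × ℝ → ℝ} (h : N.IsSolution v u) :
    N.tuple v u ∈ W.abelianSolutions hD :=
  ⟨fun _ _ hp => indicator_of_notMem hp _, fun i => smooth_tuple h.1 h.2.1 i,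
    fun _ hp => sum_tuple v u hp, (tuple_closed_iff hD h.1 h.2.1).mpr h⟩

/-- Evaluating ∑ λᵢωᵢ = 0 on the two frame vectors recovers λ₁ and λ₂ from λ₃ and λ₄. -/
lemma exists_eq_tuple (hD : IsOpen D) {l : Fin 4 → ℝ × ℝ → ℝ} (hl : l ∈ W.abelianSolutions hD) :
    ∃ v u, N.IsSolution v u ∧ l = N.tuple v u := by
  obtain ⟨h1, h2, h3, h4⟩ := hl
  have hs : ∀ i, ContDiffOn ℝ ∞ (fun p => l i p / N.scale i p) D := fun i =>
    (h2 i).div (N.scale_smooth i) (N.scale_ne_zero i)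
  have e : l = N.tuple (fun p => l 2 p / N.scale 2 p) (fun p => l 3 p / N.scale 3 p) := by
    funext i p
    by_cases hp : p ∈ D
    · rw [tuple_apply _ _ _ hp]
      have hn := fun i => N.scale_ne_zero i p hp
      have hd : ∀ i, l i p • W.form i p = (l i p / N.scale i p) • N.scale i p • W.form i p :=
        fun i => by rw [smul_smul, div_mul_cancel₀ _ (hn i)]
      have h := h3 p hp
      rw [Fin.sum_univ_four, hd 0, hd 1, hd 2, hd 3, scaled_two hp, scaled_three hp] at h
      change _ • N.ω₁ p + _ • N.ω₂ p + _ + _ = 0 at h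
      have k1 := congrArg (fun φ : ℝ × ℝ →L[ℝ] ℝ => φ (N.frame₁ p)) h
      have k2 := congrArg (fun φ : ℝ × ℝ →L[ℝ] ℝ => φ (N.frame₂ p)) h
      simp [N.ω₁_frame₁ hp, N.ω₂_frame₁, N.ω₁_frame₂, N.ω₂_frame₂ hp] at k1 k2
      fin_cases i
      · rw [← div_eq_iff (hn _)]
        change l 0 p / N.scale 0 p = l 2 p / N.scale 2 p + N.a p * (l 3 p / N.scale 3 p)
        linarith
      · rw [← div_eq_iff (hn _)]
        change l 1 p / N.scale 1 p = l 2 p / N.scale 2 p + l 3 p / N.scale 3 p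
        linarith
      · exact (div_mul_cancel₀ _ (hn 2)).symm
      · exact (div_mul_cancel₀ _ (hn 3)).symm
    · rw [h1 i p hp, tuple, indicator_of_notMem hp]
  refine ⟨_, _, (tuple_closed_iff hD (hs 2) (hs 3)).mp ?_, e⟩
  rw [← e]
  exact h4

lemma tuple_eq_iff {v u v' u' : ℝ × ℝ → ℝ} {c : ℝ} :
    c • N.tuple v u = N.tuple v' u' ↔ ∀ p ∈ D, v' p = c * v p ∧ u' p = c * u p := by
  constructor
  · intro h p hp
    have k := fun i => congrFun (congrFun h i) p
    have h2 := k 2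
    have h3 := k 3
    simp only [Pi.smul_apply, tuple_apply _ _ _ hp, smul_eq_mul, ← mul_assoc] at h2 h3
    exact ⟨(mul_right_cancel₀ (N.scale_ne_zero 2 p hp) h2).symm,
      (mul_right_cancel₀ (N.scale_ne_zero 3 p hp) h3).symm⟩
  · intro h
    funext i p
    by_cases hp : p ∈ D
    · obtain ⟨e1, e2⟩ := h p hp
      simp only [Pi.smul_apply, tuple_apply _ _ _ hp, smul_eq_mul, e1, e2]
      rw [← mul_assoc]
      congr 1
      fin_cases i
      · change c * (v p + N.a p * u p) = c * v p + N.a p * (c * u p)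
        ring
      · exact mul_add _ _ _
      · rfl
      · rfl
    · simp [tuple, hp]

/-- The rank is one if and only if the solutions are the multiples of a nonzero solution. -/
theorem rank_eq_one_iff (hD : IsOpen D) : W.rank hD = 1 ↔
    ∃ v u, N.IsSolution v u ∧ (∃ p ∈ D, v p ≠ 0 ∨ u p ≠ 0) ∧
      ∀ v' u', N.IsSolution v' u' → ∃ c : ℝ, ∀ p ∈ D, v' p = c * v p ∧ u' p = c * u p := by
  rw [rank, finrank_eq_one_iff']
  constructor
  · rintro ⟨⟨l, hl⟩, hne, hspan⟩
    obtain ⟨v, u, hvu, rfl⟩ := exists_eq_tuple (N := N) hD hl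
    refine ⟨v, u, hvu, ?_, fun v' u' h' => ?_⟩
    · by_contra! h0
      refine hne (Subtype.ext ?_)
      have := (tuple_eq_iff (N := N) (v := v) (u := u) (v' := v) (u' := u) (c := 0)).mpr
        fun p hp => by simp [h0 p hp]
      exact this.symm.trans (zero_smul _ _)
    · obtain ⟨c, hc⟩ := hspan ⟨_, tuple_mem hD h'⟩
      exact ⟨c, tuple_eq_iff.mp (congrArg Subtype.val hc)⟩
  · rintro ⟨v, u, hvu, ⟨p, hp, hne⟩, hspan⟩
    refine ⟨⟨_, tuple_mem hD hvu⟩, fun h0 => ?_, ?_⟩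
    · have h1 : N.tuple v u = 0 := congrArg Subtype.val h0
      have := tuple_eq_iff.mp (show (0 : ℝ) • N.tuple v u = N.tuple v u by rw [zero_smul, h1]) p hp
      simp only [zero_mul] at this
      exact hne.elim (fun h => h this.1) fun h => h this.2
    · rintro ⟨l, hl⟩
      obtain ⟨v', u', h', rfl⟩ := exists_eq_tuple (N := N) hD hl
      obtain ⟨c, hc⟩ := hspan v' u' h'
      exact ⟨c, Subtype.ext (tuple_eq_iff.mpr hc)⟩

end Normalization

end FourWeb

end PlanarWeb

end

/-! ### The connection of rank three and its curvature. -/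

noncomputable section

namespace PlanarWeb

open Set Filter Topology

namespace FourWeb

namespace Normalization

variable {D : Set (ℝ × ℝ)} {W : FourWeb D} {N : W.Normalization}

section Invariants

lemma smooth_a₁ (hD : IsOpen D) : ContDiffOn ℝ ∞ (N.δ₁ 0 N.a) D := smooth_δ₁ hD 0 N.smooth_a

lemma smooth_a₂ (hD : IsOpen D) : ContDiffOn ℝ ∞ (N.δ₂ 0 N.a) D := smooth_δ₂ hD 0 N.smooth_a

lemma smooth_δ₁₂ (hD : IsOpen D) (w : ℕ) {u : ℝ × ℝ → ℝ} (hu : ContDiffOn ℝ ∞ u D) :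
    ContDiffOn ℝ ∞ (N.δ₁₂ w u) D :=
  ((smooth_δ₁ hD _ (smooth_δ₂ hD w hu)).add (smooth_δ₂ hD _ (smooth_δ₁ hD w hu))).div_const 2

lemma smooth_δ₁₁₂ (hD : IsOpen D) (w : ℕ) {u : ℝ × ℝ → ℝ} (hu : ContDiffOn ℝ ∞ u D) :
    ContDiffOn ℝ ∞ (N.δ₁₁₂ w u) D :=
  (((smooth_δ₁ hD _ (smooth_δ₁ hD _ (smooth_δ₂ hD w hu))).add
    (smooth_δ₁ hD _ (smooth_δ₂ hD _ (smooth_δ₁ hD w hu)))).add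
    (smooth_δ₂ hD _ (smooth_δ₁ hD _ (smooth_δ₁ hD w hu)))).div_const 3

lemma smooth_δ₁₂₂ (hD : IsOpen D) (w : ℕ) {u : ℝ × ℝ → ℝ} (hu : ContDiffOn ℝ ∞ u D) :
    ContDiffOn ℝ ∞ (N.δ₁₂₂ w u) D :=
  (((smooth_δ₁ hD _ (smooth_δ₂ hD _ (smooth_δ₂ hD w hu))).add
    (smooth_δ₂ hD _ (smooth_δ₁ hD _ (smooth_δ₂ hD w hu)))).add
    (smooth_δ₂ hD _ (smooth_δ₂ hD _ (smooth_δ₁ hD w hu)))).div_const 3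

lemma smooth_c₀ (hD : IsOpen D) : ContDiffOn ℝ ∞ N.c₀ D := by
  have ha := N.smooth_a
  have ha₁ := smooth_a₁ (N := N) hD
  have ha₂ := smooth_a₂ (N := N) hD
  have h₁₁ : ContDiffOn ℝ ∞ (N.δ₁₁ 0 N.a) D := smooth_δ₁ hD _ ha₁
  have h₂₂ : ContDiffOn ℝ ∞ (N.δ₂₂ 0 N.a) D := smooth_δ₂ hD _ ha₂
  have h₁₂ := smooth_δ₁₂ (N := N) hD 0 ha
  have hK := smooth_K (N := N) hD
  have n₀ := fun p (hp : p ∈ D) => N.a_ne_zero hp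
  have n₁ := fun p (hp : p ∈ D) => N.one_sub_a_ne_zero hp
  unfold c₀
  refine (hK.add (ContDiffOn.div (by fun_prop) (by fun_prop) fun p hp => ?_)).add
    (ContDiffOn.div (by fun_prop) (by fun_prop) fun p hp => ?_)
  · simp [n₀ p hp, n₁ p hp]
  · simp [n₀ p hp, n₁ p hp]

lemma smooth_c₁ (hD : IsOpen D) : ContDiffOn ℝ ∞ N.c₁ D := by
  have ha := N.smooth_a
  have ha₁ := smooth_a₁ (N := N) hD
  have ha₂ := smooth_a₂ (N := N) hD
  have h₂₂ : ContDiffOn ℝ ∞ (N.δ₂₂ 0 N.a) D := smooth_δ₂ hD _ ha₂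
  have h₁₂ := smooth_δ₁₂ (N := N) hD 0 ha
  have h₁₁₂ := smooth_δ₁₁₂ (N := N) hD 0 ha
  have h₁₂₂ := smooth_δ₁₂₂ (N := N) hD 0 ha
  have hK := smooth_K (N := N) hD
  have hK₁ := smooth_δ₁ (N := N) hD 2 hK
  have hK₂ := smooth_δ₂ (N := N) hD 2 hK
  have n₀ := fun p (hp : p ∈ D) => N.a_ne_zero hp
  have n₁ := fun p (hp : p ∈ D) => N.one_sub_a_ne_zero hp
  unfold c₁
  refine (((((ContDiffOn.div (by fun_prop) (by fun_prop) fun p hp => ?_).add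
    ((ContDiffOn.div (by fun_prop) (by fun_prop) fun p hp => ?_).mul hK)).add
    (ContDiffOn.div (by fun_prop) (by fun_prop) fun p hp => ?_)).add
    ((ContDiffOn.div (by fun_prop) (by fun_prop) fun p hp => ?_).mul h₂₂)).add
    ((ContDiffOn.div (by fun_prop) (by fun_prop) fun p hp => ?_).mul h₁₂)).sub
    (ContDiffOn.div (by fun_prop) (by fun_prop) fun p hp => ?_)
  all_goals simp [n₀ p hp, n₁ p hp]

lemma smooth_c₂ (hD : IsOpen D) : ContDiffOn ℝ ∞ N.c₂ D := by
  have ha := N.smooth_a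
  have ha₁ := smooth_a₁ (N := N) hD
  have ha₂ := smooth_a₂ (N := N) hD
  have hK := smooth_K (N := N) hD
  have hK₁ := smooth_δ₁ (N := N) hD 2 hK
  have hK₂ := smooth_δ₂ (N := N) hD 2 hK
  have n₀ := fun p (hp : p ∈ D) => N.a_ne_zero hp
  have n₁ := fun p (hp : p ∈ D) => N.one_sub_a_ne_zero hp
  unfold c₂
  refine (ContDiffOn.div (by fun_prop) (by fun_prop) fun p hp => ?_).add
    ((ContDiffOn.div (by fun_prop) (by fun_prop) fun p hp => ?_).mul hK)
  all_goals simp [n₀ p hp, n₁ p hp]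

lemma a₁₂_comm (hD : IsOpen D) {p : ℝ × ℝ} (hp : p ∈ D) :
    N.δ₁ 1 (N.δ₂ 0 N.a) p = N.δ₂ 1 (N.δ₁ 0 N.a) p := by
  simpa using δ_comm (N := N) hD 0 N.smooth_a hp

lemma δ₁₂_a (hD : IsOpen D) {p : ℝ × ℝ} (hp : p ∈ D) :
    N.δ₁₂ 0 N.a p = N.δ₂ 1 (N.δ₁ 0 N.a) p := by
  have := a₁₂_comm (N := N) hD hp
  simp only [δ₁₂, zero_add]
  rw [this]
  ring

lemma cov_a (hD : IsOpen D) {p : ℝ × ℝ} (hp : p ∈ D) :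
    N.HasCov 0 N.a p (N.δ₁ 0 N.a p) (N.δ₂ 0 N.a p) := HasCov.of_smooth hD 0 N.smooth_a hp

lemma cov_K (hD : IsOpen D) {p : ℝ × ℝ} (hp : p ∈ D) :
    N.HasCov 2 N.K p (N.δ₁ 2 N.K p) (N.δ₂ 2 N.K p) := HasCov.of_smooth hD 2 (smooth_K hD) hp

lemma cov_a₁ (hD : IsOpen D) {p : ℝ × ℝ} (hp : p ∈ D) :
    N.HasCov 1 (N.δ₁ 0 N.a) p (N.δ₁₁ 0 N.a p) (N.δ₁₂ 0 N.a p) := by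
  rw [δ₁₂_a hD hp]
  exact HasCov.of_smooth hD 1 (smooth_a₁ (N := N) hD) hp

lemma cov_a₂ (hD : IsOpen D) {p : ℝ × ℝ} (hp : p ∈ D) :
    N.HasCov 1 (N.δ₂ 0 N.a) p (N.δ₁₂ 0 N.a p) (N.δ₂₂ 0 N.a p) := by
  rw [δ₁₂_a hD hp, ← a₁₂_comm hD hp]
  exact HasCov.of_smooth hD 1 (smooth_a₂ (N := N) hD) hp

/-- The derivatives of `a₁₂` and `a₂₂` in terms of the symmetrized derivatives. -/
lemma cov_a₁₂ (hD : IsOpen D) {p : ℝ × ℝ} (hp : p ∈ D) :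
    N.HasCov 2 (N.δ₁₂ 0 N.a) p (N.δ₁₁₂ 0 N.a p - N.K p * N.δ₁ 0 N.a p / 3)
      (N.δ₁₂₂ 0 N.a p + N.K p * N.δ₂ 0 N.a p / 3) := by
  have h := HasCov.of_smooth (N := N) hD 2 (smooth_δ₁₂ (N := N) hD 0 N.smooth_a) hp
  have h1 := h.congr hD hp fun q hq => (a₁₂_comm (N := N) hD hq).trans (δ₁₂_a hD hq).symm
  have h2 := h.congr hD hp fun q hq => (δ₁₂_a (N := N) hD hq).symm
  -- Two of the three orders of differentiation agree because `a` has weight 0. The third differs by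
  -- a multiple of K a₁ or K a₂, and taking the mean leaves one third of it.
  have k1 := δ_comm (N := N) hD 1 (smooth_a₁ (N := N) hD) hp
  have k2 := δ_comm (N := N) hD 1 (smooth_a₂ (N := N) hD) hp
  refine ⟨h.1, ?_, ?_⟩
  · have e : N.δ₁₁₂ 0 N.a p = (N.δ₁ 2 (N.δ₁ 1 (N.δ₂ 0 N.a)) p +
        N.δ₁ 2 (N.δ₂ 1 (N.δ₁ 0 N.a)) p + N.δ₂ 2 (N.δ₁ 1 (N.δ₁ 0 N.a)) p) / 3 := rfl
    norm_num at k1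
    rw [e, ← h.2.1, h1.2.1, show N.δ₂ 2 (N.δ₁ 1 (N.δ₁ 0 N.a)) p = _ from
      (sub_eq_iff_eq_add.mp k1.symm), h2.2.1]
    ring
  · have e : N.δ₁₂₂ 0 N.a p = (N.δ₁ 2 (N.δ₂ 1 (N.δ₂ 0 N.a)) p +
        N.δ₂ 2 (N.δ₁ 1 (N.δ₂ 0 N.a)) p + N.δ₂ 2 (N.δ₂ 1 (N.δ₁ 0 N.a)) p) / 3 := rfl
    norm_num at k2
    rw [e, k2, h1.2.2, h2.2.2, ← h.2.2]
    ring

/-- The pure derivative δ₂a₂₂ is left as it stands: it drops out of the curvature, because a·m₁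
contains −a₂₂, which cancels the a₂₂ in the same entry of `conn₃`. -/
lemma cov_a₂₂ (hD : IsOpen D) {p : ℝ × ℝ} (hp : p ∈ D) :
    N.HasCov 2 (N.δ₂₂ 0 N.a) p (N.δ₁₂₂ 0 N.a p - 2 * (N.K p * N.δ₂ 0 N.a p) / 3)
      (N.δ₂ 2 (N.δ₂₂ 0 N.a) p) := by
  refine ⟨differentiableAt_of_smooth hD (smooth_δ₂ (N := N) hD 1 (smooth_a₂ (N := N) hD)) hp, ?_, rfl⟩
  have k2 := δ_comm (N := N) hD 1 (smooth_a₂ (N := N) hD) hp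
  have h1 := (cov_a₁₂ (N := N) hD hp).congr hD hp fun q hq =>
    (a₁₂_comm (N := N) hD hq).trans (δ₁₂_a hD hq).symm
  rw [h1.2.2] at k2
  refine k2.trans ?_
  push_cast
  ring

end Invariants

section RankThree

variable (N)

/-- The coefficient of `v` in the expression for `∂₂ w`, in the system for the coefficients `v, u`
of a solution and `w = ∂₂ u`. -/
def m₀ (q : ℝ × ℝ) : ℝ := N.K q / (N.a q * (N.a q - 1))

/-- The coefficient of `u` in the expression for `∂₂ w`. -/
def m₁ (q : ℝ × ℝ) : ℝ :=
  (N.a q * N.K q - (N.a q - 1) * N.δ₂₂ 0 N.a q - N.δ₁₂ 0 N.a q -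
    N.δ₂ 0 N.a q * N.δ₂ 0 N.a q) / (N.a q * (N.a q - 1))

/-- The coefficient of `w` in the expression for `∂₂ w`. -/
def m₂ (q : ℝ × ℝ) : ℝ :=
  (2 * N.δ₂ 0 N.a q - N.δ₁ 0 N.a q - 3 * (N.a q * N.δ₂ 0 N.a q)) / (N.a q * (N.a q - 1))

/-- The connection of rank three whose parallel sections are the solutions of the abelian
equation, with the components `v, u` and `∂₂ u`. -/
def conn₃ : Connection 3 where
  wt := ![1, 1, 2]
  d := ![![1, 1, 0], ![1, 1, 0], ![2, 2, 1]]
  wt_add := by decide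
  M₁ := ![![fun _ => 0, fun q => -N.δ₂ 0 N.a q, fun q => -N.a q],
    ![fun _ => 0, N.δ₂ 0 N.a, N.a],
    -- The commutator on u gives δ₁w = a δ₂w + 2a₂w + (a₂₂ − K)u for w = δ₂u.
    ![fun q => N.a q * N.m₀ q, fun q => N.a q * N.m₁ q + (N.δ₂₂ 0 N.a q - N.K q),
      fun q => N.a q * N.m₂ q + 2 * N.δ₂ 0 N.a q]]
  M₂ := ![![fun _ => 0, fun q => -N.δ₂ 0 N.a q, fun q => -N.a q],
    ![fun _ => 0, fun _ => 0, fun _ => 1], ![N.m₀, N.m₁, N.m₂]]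

variable {N}

lemma sub_one_ne_zero {p : ℝ × ℝ} (hp : p ∈ D) : N.a p - 1 ≠ 0 := sub_ne_zero.mpr (N.a_ne_one hp)

lemma a_mul_ne_zero {p : ℝ × ℝ} (hp : p ∈ D) : N.a p * (N.a p - 1) ≠ 0 :=
  mul_ne_zero (N.a_ne_zero hp) (sub_one_ne_zero hp)

lemma smooth_conn₃ (hD : IsOpen D) : (conn₃ N).SmoothOn D := by
  have ha := N.smooth_a
  have ha₁ := smooth_a₁ (N := N) hD
  have ha₂ := smooth_a₂ (N := N) hD
  have h₂₂ : ContDiffOn ℝ ∞ (N.δ₂₂ 0 N.a) D := smooth_δ₂ hD _ ha₂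
  have h₁₂ := smooth_δ₁₂ (N := N) hD 0 ha
  have hK := smooth_K (N := N) hD
  have hm₀ : ContDiffOn ℝ ∞ N.m₀ D :=
    ContDiffOn.div (by fun_prop) (by fun_prop) fun p hp => a_mul_ne_zero hp
  have hm₁ : ContDiffOn ℝ ∞ N.m₁ D :=
    ContDiffOn.div (by fun_prop) (by fun_prop) fun p hp => a_mul_ne_zero hp
  have hm₂ : ContDiffOn ℝ ∞ N.m₂ D :=
    ContDiffOn.div (by fun_prop) (by fun_prop) fun p hp => a_mul_ne_zero hp
  intro i j
  refine ⟨?_, ?_⟩ <;> fin_cases i <;> fin_cases j <;> simp [conn₃] <;> fun_prop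

lemma cov_den (hD : IsOpen D) {p : ℝ × ℝ} (hp : p ∈ D) :
    N.HasCov 0 (fun q => N.a q * (N.a q - 1)) p
      (N.δ₁ 0 N.a p * (N.a p - 1) + N.a p * N.δ₁ 0 N.a p)
      (N.δ₂ 0 N.a p * (N.a p - 1) + N.a p * N.δ₂ 0 N.a p) := by
  have h := (cov_a (N := N) hD hp).mul ((cov_a (N := N) hD hp).sub (HasCov.const 1))
  simpa using h

/-- The first two rows of the curvature vanish by construction: δ₁w and δ₂w were determined from the
commutators on u and v. -/
lemma curv_conn₃_zero (hD : IsOpen D) {p : ℝ × ℝ} (hp : p ∈ D) (j : Fin 3) :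
    (conn₃ N).curv N 0 j p = 0 := by
  have n := N.a_ne_zero hp
  have n' := sub_one_ne_zero (N := N) hp
  have ca := cov_a (N := N) hD hp
  have ca₂ := cov_a₂ (N := N) hD hp
  fin_cases j <;> simp [Connection.curv, Fin.sum_univ_three, conn₃, (HasCov.zero _).2.1,
    (HasCov.zero _).2.2, ca₂.neg.2.1, ca₂.neg.2.2, ca.neg.2.1, ca.neg.2.2, m₀, m₁, m₂] <;>
    field_simp <;> ring

lemma curv_conn₃_one (hD : IsOpen D) {p : ℝ × ℝ} (hp : p ∈ D) (j : Fin 3) :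
    (conn₃ N).curv N 1 j p = 0 := by
  have n := N.a_ne_zero hp
  have n' := sub_one_ne_zero (N := N) hp
  have c1 := HasCov.const (N := N) (p := p) 1
  have ca := cov_a (N := N) hD hp
  have ca₂ := cov_a₂ (N := N) hD hp
  fin_cases j <;> simp [Connection.curv, Fin.sum_univ_three, conn₃, (HasCov.zero _).2.1,
    (HasCov.zero _).2.2, ca₂.2.2, c1.2.1, m₀, m₁, m₂] <;>
    ring

/-- The last row, the compatibility of the two derivatives of w, is the only obstruction, and it is
the origin of c₀, c₁ and c₂. -/
lemma curv_conn₃_two_zero (hD : IsOpen D) {p : ℝ × ℝ} (hp : p ∈ D) :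
    (conn₃ N).curv N 2 0 p = 4 * N.c₂ p := by
  have n := N.a_ne_zero hp
  have n' := sub_one_ne_zero (N := N) hp
  have n'' := N.one_sub_a_ne_zero hp
  have h : N.HasCov 2 N.m₀ p _ _ := (cov_K hD hp).div (cov_den hD hp) (a_mul_ne_zero hp)
  have h' : N.HasCov 2 (fun q => N.a q * N.m₀ q) p _ _ := (cov_a hD hp).mul h
  simp [Connection.curv, Fin.sum_univ_three, conn₃, h.2.1, h'.2.2]
  simp only [m₀, m₂, c₂]
  field_simp
  ring

lemma curv_conn₃_two_two (hD : IsOpen D) {p : ℝ × ℝ} (hp : p ∈ D) :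
    (conn₃ N).curv N 2 2 p = 4 * N.c₀ p := by
  have n := N.a_ne_zero hp
  have n' := sub_one_ne_zero (N := N) hp
  have n'' := N.one_sub_a_ne_zero hp
  have h : N.HasCov 1 N.m₂ p _ _ := ((((cov_a₂ hD hp).const_mul 2).sub (cov_a₁ hD hp)).sub
    (((cov_a hD hp).mul (cov_a₂ hD hp)).const_mul 3)).div (cov_den hD hp) (a_mul_ne_zero hp)
  have h' : N.HasCov 1 (fun q => N.a q * N.m₂ q + 2 * N.δ₂ 0 N.a q) p _ _ :=
    ((cov_a hD hp).mul h).add ((cov_a₂ hD hp).const_mul 2)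
  simp [Connection.curv, Fin.sum_univ_three, conn₃, h.2.1, h'.2.2]
  simp only [m₀, m₁, m₂, c₀]
  field_simp
  ring

lemma curv_conn₃_two_one (hD : IsOpen D) {p : ℝ × ℝ} (hp : p ∈ D) :
    (conn₃ N).curv N 2 1 p = 4 * N.c₁ p := by
  have n := N.a_ne_zero hp
  have n' := sub_one_ne_zero (N := N) hp
  have n'' := N.one_sub_a_ne_zero hp
  have hK := (cov_a hD hp).mul (cov_K (N := N) hD hp)
  have h₂₂ := ((cov_a hD hp).sub (HasCov.const 1)).mul (cov_a₂₂ (N := N) hD hp)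
  have hsq : N.HasCov 2 _ p _ _ := (cov_a₂ hD hp).mul (cov_a₂ (N := N) hD hp)
  have h : N.HasCov 2 N.m₁ p _ _ := HasCov.div (w := 2) (w' := 0)
    (by simpa using ((hK.sub h₂₂).sub (cov_a₁₂ hD hp)).sub hsq) (cov_den hD hp) (a_mul_ne_zero hp)
  have h' : N.HasCov 2 (fun q => N.a q * N.m₁ q + (N.δ₂₂ 0 N.a q - N.K q)) p _ _ :=
    ((cov_a hD hp).mul h).add ((cov_a₂₂ hD hp).sub (cov_K hD hp))
  simp [Connection.curv, Fin.sum_univ_three, conn₃, h.2.1, h'.2.2]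
  simp only [m₀, m₁, m₂, c₁]
  field_simp
  ring

end RankThree

end Normalization

end FourWeb

end PlanarWeb

end

/-! ### Solutions as parallel sections, and the linear relation they satisfy. -/

noncomputable section

namespace PlanarWeb

open Set Filter Topology

namespace FourWeb

namespace Normalization

variable {D : Set (ℝ × ℝ)} {W : FourWeb D} {N : W.Normalization}

section Solutions

variable {v u : ℝ × ℝ → ℝ} {p : ℝ × ℝ}

lemma IsSolution.cov_v (hD : IsOpen D) (h : N.IsSolution v u) (hp : p ∈ D) :
    N.HasCov 1 v p (-(N.a p * N.δ₂ 1 u p + N.δ₂ 0 N.a p * u p))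
      (-(N.a p * N.δ₂ 1 u p + N.δ₂ 0 N.a p * u p)) := by
  obtain ⟨h1, h2, h3⟩ := h.2.2 p hp
  rw [← h3]
  exact ⟨differentiableAt_of_smooth hD h.1 hp, h1, h2⟩

lemma IsSolution.cov_u (hD : IsOpen D) (h : N.IsSolution v u) (hp : p ∈ D) :
    N.HasCov 1 u p (N.a p * N.δ₂ 1 u p + N.δ₂ 0 N.a p * u p) (N.δ₂ 1 u p) :=
  ⟨differentiableAt_of_smooth hD h.2.1 hp, (h.2.2 p hp).2.2, rfl⟩

lemma IsSolution.of_cov (hv : ContDiffOn ℝ ∞ v D) (hu : ContDiffOn ℝ ∞ u D)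
    {w : ℝ × ℝ → ℝ} (h : ∀ p ∈ D, N.HasCov 1 v p (-(N.a p * w p + N.δ₂ 0 N.a p * u p))
      (-(N.a p * w p + N.δ₂ 0 N.a p * u p)) ∧
      N.HasCov 1 u p (N.a p * w p + N.δ₂ 0 N.a p * u p) (w p)) : N.IsSolution v u := by
  refine ⟨hv, hu, fun p hp => ?_⟩
  obtain ⟨⟨-, h1, h2⟩, -, h3, h4⟩ := h p hp
  rw [h1, h2, h3, h4]
  exact ⟨rfl, rfl, rfl⟩

/-- The prolongation of the system for `v` and `u`. -/
lemma IsSolution.cov_δ₂ (hD : IsOpen D) (h : N.IsSolution v u) (hp : p ∈ D) :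
    N.HasCov 2 (N.δ₂ 1 u) p
      (N.a p * (N.m₀ p * v p + N.m₁ p * u p + N.m₂ p * N.δ₂ 1 u p) +
        2 * N.δ₂ 0 N.a p * N.δ₂ 1 u p + (N.δ₂₂ 0 N.a p - N.K p) * u p)
      (N.m₀ p * v p + N.m₁ p * u p + N.m₂ p * N.δ₂ 1 u p) := by
  have n := N.a_ne_zero hp
  have n' := sub_one_ne_zero (N := N) hp
  have hw := smooth_δ₂ (N := N) hD 1 h.2.1
  have cw := HasCov.of_smooth (N := N) hD 2 hw hp
  have cu := h.cov_u hD hp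
  have c : N.HasCov 2 _ p _ _ := ((cov_a hD hp).mul cw).add ((cov_a₂ hD hp).mul cu)
  have k := δ_comm (N := N) hD 1 h.2.1 hp
  have k' := δ_comm (N := N) hD 1 h.1 hp
  have e := c.congr hD hp fun q hq => (h.2.2 q hq).2.2
  have e₁ := c.neg.congr hD hp fun q hq => (h.cov_v hD hq).2.1
  have e₂ := c.neg.congr hD hp fun q hq => (h.cov_v hD hq).2.2
  norm_num at k k'
  rw [e.2.2] at k
  rw [e₁.2.2, e₂.2.1] at k'
  -- The commutator on u expresses δ₁w through δ₂w. Inserted in the commutator on v, it leaves an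
  -- equation for δ₂w with leading coefficient a(a − 1) ≠ 0.
  have E : N.δ₂ 2 (N.δ₂ 1 u) p = N.m₀ p * v p + N.m₁ p * u p + N.m₂ p * N.δ₂ 1 u p := by
    simp only [m₀, m₁, m₂]
    field_simp
    rw [k] at k'
    linear_combination -k'
  rw [E] at k cw
  refine ⟨cw.1, k.trans ?_, cw.2.2⟩
  ring

lemma IsSolution.isParallel_conn₃ (hD : IsOpen D) (h : N.IsSolution v u) (hp : p ∈ D) :
    (conn₃ N).IsParallel N (fun q => ![v q, u q, N.δ₂ 1 u q]) p := by
  have hv := h.cov_v hD hp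
  have hu := h.cov_u hD hp
  have hw := h.cov_δ₂ hD hp
  intro i
  fin_cases i
  · convert! hv using 1 <;> simp [conn₃, Fin.sum_univ_three]
  · convert! hu using 1 <;> (simp [conn₃, Fin.sum_univ_three]; try ring)
  · convert! hw using 1 <;> (simp [conn₃, Fin.sum_univ_three]; try ring)

lemma isSolution_of_isParallel_conn₃ (hD : IsOpen D) {s : ℝ × ℝ → Fin 3 → ℝ}
    (hs : ∀ p ∈ D, (conn₃ N).IsParallel N s p) :
    N.IsSolution (fun q => s q 0) (fun q => s q 1) := by
  have hsm := Connection.smooth_of_isParallel hD (smooth_conn₃ hD) hs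
  refine IsSolution.of_cov (hsm 0) (hsm 1) (w := fun q => s q 2) fun p hp => ⟨?_, ?_⟩
  · convert! hs p hp 0 using 1 <;> simp [conn₃, Fin.sum_univ_three]
  · convert! hs p hp 1 using 1 <;> (simp [conn₃, Fin.sum_univ_three]; try ring)

/-- The linear relation between `v`, `u` and `∂₂ u` for a solution. -/
lemma IsSolution.relation (hD : IsOpen D) (h : N.IsSolution v u) (hp : p ∈ D) :
    N.c₂ p * v p + N.c₁ p * u p + N.c₀ p * N.δ₂ 1 u p = 0 := by
  have := Connection.sum_curv_mul hD (smooth_conn₃ (N := N) hD)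
    (fun q hq => h.isParallel_conn₃ hD hq) hp 2
  rw [Fin.sum_univ_three, curv_conn₃_two_zero hD hp, curv_conn₃_two_one hD hp,
    curv_conn₃_two_two hD hp] at this
  simp at this
  linarith

lemma isFlatOn_conn₃ (hD : IsOpen D) (h : ∀ p ∈ D, N.c₀ p = 0 ∧ N.c₁ p = 0 ∧ N.c₂ p = 0) :
    (conn₃ N).IsFlatOn N D := by
  intro p hp i j
  obtain ⟨h0, h1, h2⟩ := h p hp
  fin_cases i
  · exact curv_conn₃_zero hD hp j
  · exact curv_conn₃_one hD hp j
  · fin_cases j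
    · exact (curv_conn₃_two_zero hD hp).trans (by rw [h2, mul_zero])
    · exact (curv_conn₃_two_one hD hp).trans (by rw [h1, mul_zero])
    · exact (curv_conn₃_two_two hD hp).trans (by rw [h0, mul_zero])

/-- The rank is not one if the coefficients `v` and `u` can be prescribed at a point. -/
lemma rank_ne_one (hD : IsOpen D) (hp : p ∈ D)
    (h : ∀ x y : ℝ, ∃ v u, N.IsSolution v u ∧ v p = x ∧ u p = y) : W.rank hD ≠ 1 := by
  rw [Ne, rank_eq_one_iff (N := N) hD]
  rintro ⟨v, u, -, -, hspan⟩
  obtain ⟨v₁, u₁, h₁, e₁, e₁'⟩ := h 1 0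
  obtain ⟨v₂, u₂, h₂, e₂, e₂'⟩ := h 0 1
  obtain ⟨c, hc⟩ := hspan v₁ u₁ h₁
  obtain ⟨c', hc'⟩ := hspan v₂ u₂ h₂
  have k := hc p hp
  have k' := hc' p hp
  rw [e₁, e₁'] at k
  rw [e₂, e₂'] at k'
  have hc0 : c ≠ 0 := fun h0 => by simp [h0] at k
  have hu0 : u p = 0 := (mul_eq_zero.mp k.2.symm).resolve_left hc0
  rw [hu0, mul_zero] at k'
  exact one_ne_zero k'.2

/-- For a flat `conn₃` the values of v, u and δ₂u at a point are all free. -/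
lemma rank_ne_one_of_flat (hD : IsOpen D) (hD' : IsSimplyConnected D)
    (h : ∀ p ∈ D, N.c₀ p = 0 ∧ N.c₁ p = 0 ∧ N.c₂ p = 0) : W.rank hD ≠ 1 := by
  obtain ⟨p, hp⟩ := hD'.nonempty
  refine rank_ne_one (N := N) hD hp fun x y => ?_
  obtain ⟨s, hs, hsp⟩ := Connection.exists_parallel hD hD' (smooth_conn₃ (N := N) hD)
    (isFlatOn_conn₃ hD h) hp ![x, y, 0]
  exact ⟨_, _, isSolution_of_isParallel_conn₃ hD hs, by simp [hsp], by simp [hsp]⟩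

end Solutions

/-! ### c₀ without zeros: the connection of rank two. -/

section RankTwo

variable (N)

/-- The coefficient of `v` in `∂₂ u`, written as a combination of `v` and `u`. -/
def e₂ (q : ℝ × ℝ) : ℝ := -N.c₂ q / N.c₀ q

/-- The coefficient of `u` in `∂₂ u`, written as a combination of `v` and `u`. -/
def e₁ (q : ℝ × ℝ) : ℝ := -N.c₁ q / N.c₀ q

/-- The connection of rank two whose parallel sections are the solutions of the abelian equation
if `c₀` has no zeros. -/
def conn₂ : Connection 2 where
  wt := ![1, 1]
  d := ![![1, 1], ![1, 1]]
  wt_add := by decide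
  M₁ := ![![fun q => -(N.a q * N.e₂ q), fun q => -(N.δ₂ 0 N.a q + N.a q * N.e₁ q)],
    ![fun q => N.a q * N.e₂ q, fun q => N.δ₂ 0 N.a q + N.a q * N.e₁ q]]
  M₂ := ![![fun q => -(N.a q * N.e₂ q), fun q => -(N.δ₂ 0 N.a q + N.a q * N.e₁ q)],
    ![N.e₂, N.e₁]]

variable {N}

lemma smooth_conn₂ (hD : IsOpen D) (h : ∀ p ∈ D, N.c₀ p ≠ 0) : (conn₂ N).SmoothOn D := by
  have ha := N.smooth_a
  have ha₂ := smooth_a₂ (N := N) hD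
  have he₂ : ContDiffOn ℝ ∞ N.e₂ D := (smooth_c₂ hD).neg.div (smooth_c₀ hD) h
  have he₁ : ContDiffOn ℝ ∞ N.e₁ D := (smooth_c₁ hD).neg.div (smooth_c₀ hD) h
  intro i j
  refine ⟨?_, ?_⟩ <;> fin_cases i <;> fin_cases j <;> simp [conn₂] <;> fun_prop

variable {v u : ℝ × ℝ → ℝ} {p : ℝ × ℝ}

lemma IsSolution.isParallel_conn₂ (hD : IsOpen D) (h : N.IsSolution v u) (hp : p ∈ D)
    (h0 : N.c₀ p ≠ 0) : (conn₂ N).IsParallel N (fun q => ![v q, u q]) p := by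
  have hv := h.cov_v hD hp
  have hu := h.cov_u hD hp
  have e : N.δ₂ 1 u p = N.e₂ p * v p + N.e₁ p * u p := by
    simp only [e₁, e₂]
    field_simp
    linear_combination h.relation hD hp
  rw [e] at hv hu
  intro i
  fin_cases i
  · convert! hv using 1 <;> (simp [conn₂, Fin.sum_univ_two]; try ring)
  · convert! hu using 1 <;> (simp [conn₂, Fin.sum_univ_two]; try ring)

lemma isSolution_of_isParallel_conn₂ (hD : IsOpen D) (h : ∀ p ∈ D, N.c₀ p ≠ 0)
    {s : ℝ × ℝ → Fin 2 → ℝ} (hs : ∀ p ∈ D, (conn₂ N).IsParallel N s p) :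
    N.IsSolution (fun q => s q 0) (fun q => s q 1) := by
  have hsm := Connection.smooth_of_isParallel hD (smooth_conn₂ hD h) hs
  refine IsSolution.of_cov (hsm 0) (hsm 1) (w := fun q => N.e₂ q * s q 0 + N.e₁ q * s q 1)
    fun p hp => ⟨?_, ?_⟩
  · convert! hs p hp 0 using 1 <;> (simp [conn₂, Fin.sum_univ_two]; try ring)
  · convert! hs p hp 1 using 1 <;> (simp [conn₂, Fin.sum_univ_two]; try ring)

lemma cov_c₀ (hD : IsOpen D) (hp : p ∈ D) :
    N.HasCov 2 N.c₀ p (N.δ₁ 2 N.c₀ p) (N.δ₂ 2 N.c₀ p) := HasCov.of_smooth hD 2 (smooth_c₀ hD) hp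

lemma cov_c₁ (hD : IsOpen D) (hp : p ∈ D) :
    N.HasCov 3 N.c₁ p (N.δ₁ 3 N.c₁ p) (N.δ₂ 3 N.c₁ p) := HasCov.of_smooth hD 3 (smooth_c₁ hD) hp

lemma cov_c₂ (hD : IsOpen D) (hp : p ∈ D) :
    N.HasCov 3 N.c₂ p (N.δ₁ 3 N.c₂ p) (N.δ₂ 3 N.c₂ p) := HasCov.of_smooth hD 3 (smooth_c₂ hD) hp

lemma cov_e₁ (hD : IsOpen D) (hp : p ∈ D) (h0 : N.c₀ p ≠ 0) :
    N.HasCov 1 N.e₁ p ((-N.δ₁ 3 N.c₁ p * N.c₀ p - -N.c₁ p * N.δ₁ 2 N.c₀ p) / N.c₀ p ^ 2)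
      ((-N.δ₂ 3 N.c₁ p * N.c₀ p - -N.c₁ p * N.δ₂ 2 N.c₀ p) / N.c₀ p ^ 2) :=
  HasCov.div (w := 1) (w' := 2) (cov_c₁ hD hp).neg (cov_c₀ hD hp) h0

lemma cov_e₂ (hD : IsOpen D) (hp : p ∈ D) (h0 : N.c₀ p ≠ 0) :
    N.HasCov 1 N.e₂ p ((-N.δ₁ 3 N.c₂ p * N.c₀ p - -N.c₂ p * N.δ₁ 2 N.c₀ p) / N.c₀ p ^ 2)
      ((-N.δ₂ 3 N.c₂ p * N.c₀ p - -N.c₂ p * N.δ₂ 2 N.c₀ p) / N.c₀ p ^ 2) :=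
  HasCov.div (w := 1) (w' := 2) (cov_c₂ hD hp).neg (cov_c₀ hD hp) h0

/-- The curvature of the connection of rank two. -/
lemma curv_conn₂ (hD : IsOpen D) (hp : p ∈ D) (h0 : N.c₀ p ≠ 0) (i j : Fin 2) :
    (conn₂ N).curv N i j p = -N.G p i j / N.c₀ p ^ 2 := by
  have h : N.HasCov 1 _ p _ _ := (cov_a (N := N) hD hp).mul (cov_e₂ hD hp h0)
  have h' : N.HasCov 1 _ p _ _ :=
    (cov_a₂ (N := N) hD hp).add (by simpa using (cov_a (N := N) hD hp).mul (cov_e₁ hD hp h0))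
  have k₁ := cov_e₁ (N := N) hD hp h0
  have k₂ := cov_e₂ (N := N) hD hp h0
  fin_cases i <;> fin_cases j
  · simp [Connection.curv, Fin.sum_univ_two, conn₂, h.neg.2.1, h.neg.2.2]
    simp only [e₁, e₂, G, G₁₁, Matrix.cons_val', Matrix.cons_val_zero, Matrix.of_apply]
    field_simp
    ring
  · simp [Connection.curv, Fin.sum_univ_two, conn₂, h'.neg.2.1, h'.neg.2.2, -neg_add_rev]
    simp only [e₁, G, G₁₂, Matrix.cons_val', Matrix.cons_val_zero, Matrix.cons_val_one,
      Matrix.of_apply]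
    field_simp
    ring
  · simp [Connection.curv, Fin.sum_univ_two, conn₂, k₂.2.1, h.2.2]
    simp only [e₁, e₂, G, G₂₁, Matrix.cons_val', Matrix.cons_val_zero, Matrix.cons_val_one,
      Matrix.of_apply]
    field_simp
    ring
  · simp [Connection.curv, Fin.sum_univ_two, conn₂, k₁.2.1, h'.2.2]
    simp only [e₁, e₂, G, G₂₂, Matrix.cons_val', Matrix.cons_val_zero, Matrix.cons_val_one,
      Matrix.of_apply]
    field_simp
    ring

/-- The curvature of `conn₂` is −G/c₀², so G = 0 makes it flat and both components can be prescribed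
at a point. -/
lemma rank_ne_one_of_G_eq_zero (hD : IsOpen D) (hD' : IsSimplyConnected D)
    (h0 : ∀ p ∈ D, N.c₀ p ≠ 0) (h : ∀ p ∈ D, N.G p = 0) : W.rank hD ≠ 1 := by
  obtain ⟨p, hp⟩ := hD'.nonempty
  refine rank_ne_one (N := N) hD hp fun x y => ?_
  obtain ⟨s, hs, hsp⟩ := Connection.exists_parallel hD hD' (smooth_conn₂ (N := N) hD h0)
    (fun q hq i j => by rw [curv_conn₂ hD hq (h0 q hq), h q hq]; simp) hp ![x, y]
  exact ⟨_, _, isSolution_of_isParallel_conn₂ hD h0 hs, by simp [hsp], by simp [hsp]⟩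

/-- The matrix `G` annihilates the solutions. -/
lemma IsSolution.G_mul (hD : IsOpen D) (h0 : ∀ p ∈ D, N.c₀ p ≠ 0) (h : N.IsSolution v u)
    (hp : p ∈ D) : N.G₁₁ p * v p + N.G₁₂ p * u p = 0 ∧ N.G₂₁ p * v p + N.G₂₂ p * u p = 0 := by
  have k := fun i => Connection.sum_curv_mul hD (smooth_conn₂ (N := N) hD h0)
    (fun q hq => h.isParallel_conn₂ hD hq (h0 q hq)) hp i
  have hc := h0 p hp
  have k0 := k 0
  have k1 := k 1
  rw [Fin.sum_univ_two, curv_conn₂ hD hp hc, curv_conn₂ hD hp hc] at k0 k1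
  simp only [G, Matrix.cons_val', Matrix.cons_val_zero, Matrix.cons_val_one,
      Matrix.of_apply] at k0 k1
  field_simp at k0 k1
  simp at k0 k1
  constructor <;> linarith

end RankTwo

end Normalization

end FourWeb

end PlanarWeb

end

/-! ### Connections of rank one and the three cases with c₀ = 0. -/

noncomputable section

namespace PlanarWeb

open Set Filter Topology

namespace FourWeb

namespace Normalization

variable {D : Set (ℝ × ℝ)} {W : FourWeb D} {N : W.Normalization}

section RankOne

/-- The connection of rank one, on functions of weight one, with the coefficients `f₁` and `f₂`. -/
def conn₁ (f₁ f₂ : ℝ × ℝ → ℝ) : Connection 1 where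
  wt := fun _ => 1
  d := fun _ _ => 1
  wt_add := by decide
  M₁ := fun _ _ => f₁
  M₂ := fun _ _ => f₂

variable {f₁ f₂ φ ψ : ℝ × ℝ → ℝ} {U : Set (ℝ × ℝ)} {p q : ℝ × ℝ}

lemma isParallel_conn₁ {s : ℝ × ℝ → Fin 1 → ℝ} :
    (conn₁ f₁ f₂).IsParallel N s p ↔
      N.HasCov 1 (fun q => s q 0) p (f₁ p * s p 0) (f₂ p * s p 0) := by
  simp [Connection.IsParallel, conn₁]

lemma curv_conn₁ (i j : Fin 1) :
    (conn₁ f₁ f₂).curv N i j p = N.δ₁ 1 f₂ p - N.δ₂ 1 f₁ p + N.K p := by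
  have : i = j := Subsingleton.elim _ _
  simp [Connection.curv, conn₁, this]
  ring

lemma smooth_conn₁ (h₁ : ContDiffOn ℝ ∞ f₁ U) (h₂ : ContDiffOn ℝ ∞ f₂ U) :
    (conn₁ f₁ f₂).SmoothOn U := fun _ _ => ⟨h₁, h₂⟩

lemma parallel_conn₁_eqOn (hD : IsOpen D) (hUo : IsOpen U) (hUc : IsPreconnected U) (hU : U ⊆ D)
    (h₁ : ContDiffOn ℝ ∞ f₁ U) (h₂ : ContDiffOn ℝ ∞ f₂ U)
    (hφ : ∀ p ∈ U, N.HasCov 1 φ p (f₁ p * φ p) (f₂ p * φ p))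
    (hψ : ∀ p ∈ U, N.HasCov 1 ψ p (f₁ p * ψ p) (f₂ p * ψ p)) (hq : q ∈ U) (h : φ q = ψ q) :
    EqOn φ ψ U := by
  have := Connection.eqOn_of_isParallel (N := N) (s := fun p _ => φ p) (t := fun p _ => ψ p) hD hUo
    hUc hU (smooth_conn₁ h₁ h₂) (fun p hp => isParallel_conn₁.mpr (hφ p hp))
    (fun p hp => isParallel_conn₁.mpr (hψ p hp)) hq (by simp [h])
  exact fun p hp => congrFun (this hp) 0

/-- A parallel section which is not zero at a point has no zeros. -/
lemma parallel_conn₁_ne_zero (hD : IsOpen D) (hDc : IsPreconnected D)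
    (h₁ : ContDiffOn ℝ ∞ f₁ D) (h₂ : ContDiffOn ℝ ∞ f₂ D)
    (hφ : ∀ p ∈ D, N.HasCov 1 φ p (f₁ p * φ p) (f₂ p * φ p)) (hq : q ∈ D) (h : φ q ≠ 0)
    (hp : p ∈ D) : φ p ≠ 0 := fun h0 => h (parallel_conn₁_eqOn (N := N) (ψ := fun _ => 0) hD hD
      hDc subset_rfl h₁ h₂ hφ (fun p _ => by simpa using HasCov.zero 1) hp h0 hq)

/-- The rank is one if the solutions are the products of two functions without common zeros by the
parallel sections of a flat connection of rank one. -/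
lemma rank_eq_one_of_flat (hD : IsOpen D) (hD' : IsSimplyConnected D)
    (h₁ : ContDiffOn ℝ ∞ f₁ D) (h₂ : ContDiffOn ℝ ∞ f₂ D)
    (hflat : ∀ p ∈ D, N.δ₁ 1 f₂ p - N.δ₂ 1 f₁ p + N.K p = 0) {ρ σ : ℝ × ℝ → ℝ}
    (hne : ∀ p ∈ D, ρ p ≠ 0 ∨ σ p ≠ 0)
    (hsol : ∀ φ, ContDiffOn ℝ ∞ φ D → (∀ p ∈ D, N.HasCov 1 φ p (f₁ p * φ p) (f₂ p * φ p)) →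
      N.IsSolution (fun p => ρ p * φ p) fun p => σ p * φ p)
    (hpar : ∀ v u, N.IsSolution v u → ∃ φ : ℝ × ℝ → ℝ, (∀ p ∈ D, N.HasCov 1 φ p (f₁ p * φ p) (f₂ p * φ p)) ∧
      ∀ p ∈ D, v p = ρ p * φ p ∧ u p = σ p * φ p) : W.rank hD = 1 := by
  obtain ⟨p, hp⟩ := hD'.nonempty
  have hDc : IsPreconnected D := hD'.isPathConnected.isConnected.isPreconnected
  have hC := smooth_conn₁ h₁ h₂
  obtain ⟨s, hs, hsp⟩ := Connection.exists_parallel (N := N) hD hD' hC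
    (fun q hq i j => (curv_conn₁ i j).trans (hflat q hq)) hp fun _ => 1
  have hs' := fun q hq => isParallel_conn₁.mp (hs q hq)
  have hsp' : s p 0 = 1 := by rw [hsp]
  rw [rank_eq_one_iff (N := N) hD]
  refine ⟨_, _, hsol _ (Connection.smooth_of_isParallel hD hC hs 0) hs', ⟨p, hp, ?_⟩, ?_⟩
  · simpa [hsp'] using hne p hp
  · intro v u h
    obtain ⟨φ, hφ, hvu⟩ := hpar v u h
    -- The section s takes the value 1 at p, so φ and φ(p)·s agree there and hence everywhere.
    have e := parallel_conn₁_eqOn (N := N) (ψ := fun q => φ p * s q 0) hD hD hDc subset_rfl h₁ h₂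
      hφ (fun q hq => by
        have := (hs' q hq).const_mul (φ p)
        rwa [mul_left_comm, mul_left_comm (φ p)] at this) hp (by simp [hsp'])
    refine ⟨φ p, fun q hq => ?_⟩
    rw [(hvu q hq).1, (hvu q hq).2, e hq]
    constructor <;> ring

/-- If the rank is one and each solution is a multiple of a parallel section of a connection of
rank one, then the connection is flat, and there is a solution which comes from a section without
zeros. -/
lemma flat_of_rank_eq_one (hD : IsOpen D) (hD' : IsSimplyConnected D)
    (h₁ : ContDiffOn ℝ ∞ f₁ D) (h₂ : ContDiffOn ℝ ∞ f₂ D) {ρ σ : ℝ × ℝ → ℝ}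
    (hpar : ∀ v u, N.IsSolution v u → ∃ φ : ℝ × ℝ → ℝ, (∀ p ∈ D, N.HasCov 1 φ p (f₁ p * φ p) (f₂ p * φ p)) ∧
      ∀ p ∈ D, v p = ρ p * φ p ∧ u p = σ p * φ p) (hr : W.rank hD = 1) :
    (∀ p ∈ D, N.δ₁ 1 f₂ p - N.δ₂ 1 f₁ p + N.K p = 0) ∧ ∃ v u φ : ℝ × ℝ → ℝ, N.IsSolution v u ∧
      ∀ p ∈ D, φ p ≠ 0 ∧ v p = ρ p * φ p ∧ u p = σ p * φ p := by
  obtain ⟨v, u, h, ⟨p, hp, hne⟩, -⟩ := (rank_eq_one_iff (N := N) hD).mp hr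
  have hDc : IsPreconnected D := hD'.isPathConnected.isConnected.isPreconnected
  obtain ⟨φ, hφ, hvu⟩ := hpar v u h
  have h0 : φ p ≠ 0 := fun h0 => by simp [hvu p hp, h0] at hne
  have hφ0 : ∀ q ∈ D, φ q ≠ 0 := fun q hq =>
    parallel_conn₁_ne_zero hD hDc h₁ h₂ hφ hp h0 hq
  refine ⟨fun q hq => ?_, v, u, φ, h, fun q hq => ⟨hφ0 q hq, hvu q hq⟩⟩
  -- The curvature annihilates φ, which has no zeros.
  have := Connection.sum_curv_mul (N := N) (s := fun p _ => φ p) hD (smooth_conn₁ h₁ h₂)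
    (fun p hp => isParallel_conn₁.mpr (hφ p hp)) hq 0
  simp only [Fin.sum_univ_one, curv_conn₁] at this
  exact (mul_eq_zero.mp this).resolve_right (hφ0 q hq)

end RankOne

/-- The derivatives of the first covariant derivatives in terms of the symmetrized derivatives. -/
lemma cov_δ₁ (hD : IsOpen D) (w : ℕ) {f : ℝ × ℝ → ℝ} (hf : ContDiffOn ℝ ∞ f D) {p : ℝ × ℝ}
    (hp : p ∈ D) : N.HasCov (w + 1) (N.δ₁ w f) p (N.δ₁₁ w f p)
      (N.δ₁₂ w f p + w / 2 * N.K p * f p) := by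
  refine ⟨differentiableAt_of_smooth hD (smooth_δ₁ hD w hf) hp, rfl, ?_⟩
  rw [δ₁₂, δ_comm hD w hf hp]
  ring

section CaseOne

variable (N) in
/-- The coefficient of the connection of rank one for `c₀ = 0` and `c₁ ≠ 0`, `c₁ ≠ c₂`. -/
def genericCoeff (q : ℝ × ℝ) : ℝ :=
  (N.c₁ q * N.δ₁ 3 N.c₂ q - N.c₂ q * N.δ₁ 3 N.c₁ q) / (N.c₁ q * (N.c₁ q - N.c₂ q))

lemma smooth_genericCoeff (hD : IsOpen D) (h : ∀ p ∈ D, N.c₁ p ≠ N.c₂ p)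
    (h' : ∀ p ∈ D, N.c₁ p ≠ 0) : ContDiffOn ℝ ∞ N.genericCoeff D := by
  have k₁ := smooth_c₁ (N := N) hD
  have k₂ := smooth_c₂ (N := N) hD
  have k₁₁ := smooth_δ₁ (N := N) hD 3 k₁
  have k₂₁ := smooth_δ₁ (N := N) hD 3 k₂
  exact ContDiffOn.div (by fun_prop) (by fun_prop) fun p hp =>
    mul_ne_zero (h' p hp) (sub_ne_zero.mpr (h p hp))

/-- The corrections (3/2)K from symmetrizing the second derivatives of c₁ and c₂ cancel in c₁c₂,₁ −
c₂c₁,₁; the K in J₂ is that of the weight one section. -/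
lemma curv_genericCoeff (hD : IsOpen D) {p : ℝ × ℝ} (hp : p ∈ D) (h : N.c₁ p ≠ N.c₂ p)
    (h' : N.c₁ p ≠ 0) : N.δ₁ 1 N.genericCoeff p - N.δ₂ 1 N.genericCoeff p + N.K p =
      N.J₂ p / (N.c₁ p * (N.c₁ p - N.c₂ p)) ^ 2 := by
  have hs := sub_ne_zero.mpr h
  have k₁ := cov_c₁ (N := N) hD hp
  have k₂ := cov_c₂ (N := N) hD hp
  have k₁₁ := cov_δ₁ (N := N) hD 3 (smooth_c₁ (N := N) hD) hp
  have k₂₁ := cov_δ₁ (N := N) hD 3 (smooth_c₂ (N := N) hD) hp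
  have k : N.HasCov 1 N.genericCoeff p _ _ := HasCov.div (w := 1) (w' := 6)
    ((k₁.mul k₂₁).sub (k₂.mul k₁₁)) (k₁.mul (k₁.sub k₂)) (mul_ne_zero h' hs)
  rw [k.2.1, k.2.2]
  simp only [J₂]
  push_cast
  field_simp
  ring

/-- With c₂v + c₁u = 0, the equation δ₁(v + u) = 0 determines δ₁v after division by c₁(c₁ − c₂), and
δ₂v = δ₁v. The equation left over, δ₁u = a δ₂u + a₂u, becomes J₁v = 0. -/
lemma IsSolution.generic (hD : IsOpen D) (h0 : ∀ p ∈ D, N.c₀ p = 0)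
    (h : ∀ p ∈ D, N.c₁ p ≠ N.c₂ p) (h' : ∀ p ∈ D, N.c₁ p ≠ 0) {v u : ℝ × ℝ → ℝ}
    (hs : N.IsSolution v u) {p : ℝ × ℝ} (hp : p ∈ D) :
    N.HasCov 1 v p (N.genericCoeff p * v p) (N.genericCoeff p * v p) ∧
      u p = -N.c₂ p / N.c₁ p * v p ∧ N.J₁ p * v p = 0 := by
  have hr : ∀ q ∈ D, 0 = N.c₂ q * v q + N.c₁ q * u q := fun q hq => by
    have := hs.relation hD hq
    rw [h0 q hq] at this
    linarith
  have hc : N.c₁ p - N.c₂ p ≠ 0 := sub_ne_zero.mpr (h p hp)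
  have hc' := h' p hp
  have cv := hs.cov_v hD hp
  have cu := hs.cov_u hD hp
  have k := (((cov_c₂ hD hp).mul cv).add ((cov_c₁ hD hp).mul cu)).congr hD hp hr
  obtain ⟨e₁, e₂⟩ := k.unique (HasCov.zero _)
  have e := hr p hp
  have ev : -(N.a p * N.δ₂ 1 u p + N.δ₂ 0 N.a p * u p) = N.genericCoeff p * v p := by
    rw [genericCoeff]
    field_simp
    linear_combination (-N.c₁ p) * e₁ - N.δ₁ 3 N.c₁ p * e
  refine ⟨ev ▸ cv, ?_, ?_⟩
  · field_simp
    linear_combination -e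
  · simp only [J₁]
    linear_combination (N.a p * N.c₁ p * N.c₂ p - N.c₁ p ^ 2) * e₁ +
      N.a p * N.c₁ p * (N.c₁ p - N.c₂ p) * e₂ +
      ((N.a p * N.c₂ p - N.c₁ p) * N.δ₁ 3 N.c₁ p + N.a p * (N.c₁ p - N.c₂ p) * N.δ₂ 3 N.c₁ p -
        N.c₁ p * (N.c₁ p - N.c₂ p) * N.δ₂ 0 N.a p) * e

lemma rank_eq_one_iff_of_generic (hD : IsOpen D) (hD' : IsSimplyConnected D)
    (h : ∀ p ∈ D, N.c₀ p = 0 ∧ N.c₁ p ≠ N.c₂ p ∧ N.c₁ p ≠ 0) :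
    W.rank hD = 1 ↔ ∀ p ∈ D, N.J₁ p = 0 ∧ N.J₂ p = 0 := by
  have h0 := fun p hp => (h p hp).1
  have h1 := fun p hp => (h p hp).2.1
  have h2 := fun p hp => (h p hp).2.2
  have hsm := smooth_genericCoeff hD h1 h2
  have hpar : ∀ v u, N.IsSolution v u → ∃ φ : ℝ × ℝ → ℝ, (∀ p ∈ D, N.HasCov 1 φ p
      (N.genericCoeff p * φ p) (N.genericCoeff p * φ p)) ∧
      ∀ p ∈ D, v p = 1 * φ p ∧ u p = -N.c₂ p / N.c₁ p * φ p := fun v u hs =>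
    ⟨v, fun p hp => (hs.generic hD h0 h1 h2 hp).1, fun p hp =>
      ⟨(one_mul _).symm, (hs.generic hD h0 h1 h2 hp).2.1⟩⟩
  constructor
  · intro hr
    obtain ⟨hf, v, u, φ, hs, hφ⟩ := flat_of_rank_eq_one hD hD' hsm hsm hpar hr
    intro p hp
    have hc := mul_ne_zero (h2 p hp) (sub_ne_zero.mpr (h1 p hp))
    have k := hf p hp
    rw [curv_genericCoeff hD hp (h1 p hp) (h2 p hp), div_eq_zero_iff] at k
    refine ⟨?_, k.resolve_right (pow_ne_zero 2 hc)⟩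
    -- Here v = φ has no zeros, so J₁v = 0 gives J₁ = 0.
    have k' := (hs.generic hD h0 h1 h2 hp).2.2
    rw [(hφ p hp).2.1, one_mul] at k'
    exact (mul_eq_zero.mp k').resolve_right (hφ p hp).1
  · intro hJ
    refine rank_eq_one_of_flat (ρ := fun _ => 1) (σ := fun p => -N.c₂ p / N.c₁ p) hD hD' hsm hsm
      (fun p hp => ?_) (fun _ _ => by simp) (fun φ hφ hc => ?_) hpar
    · rw [curv_genericCoeff hD hp (h1 p hp) (h2 p hp), (hJ p hp).2, zero_div]
    · have hρ : ContDiffOn ℝ ∞ (fun p => -N.c₂ p / N.c₁ p) D :=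
        (smooth_c₂ hD).neg.div (smooth_c₁ hD) h2
      refine IsSolution.of_cov (contDiffOn_const.mul hφ) (hρ.mul hφ)
        (w := fun p => N.δ₂ 1 (fun q => -N.c₂ q / N.c₁ q * φ q) p) fun p hp => ?_
      have n := h2 p hp
      have n' := sub_ne_zero.mpr (h1 p hp)
      have kρ : N.HasCov 0 (fun p => -N.c₂ p / N.c₁ p) p _ _ := HasCov.div (w := 0) (w' := 3)
        (cov_c₂ hD hp).neg (cov_c₁ hD hp) n
      have k : N.HasCov 1 _ p _ _ := kρ.mul (hc p hp)
      have e : N.a p * N.δ₂ 1 (fun q => -N.c₂ q / N.c₁ q * φ q) p +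
          N.δ₂ 0 N.a p * (-N.c₂ p / N.c₁ p * φ p) = -(N.genericCoeff p * φ p) := by
        have hj := (hJ p hp).1
        simp only [J₁] at hj
        rw [k.2.2, genericCoeff]
        field_simp
        linear_combination -φ p * hj
      have e' : N.δ₁ 1 (fun q => -N.c₂ q / N.c₁ q * φ q) p = -(N.genericCoeff p * φ p) := by
        rw [k.2.1, genericCoeff]
        field_simp
        ring
      rw [e, neg_neg]
      refine ⟨?_, k.1, e', rfl⟩
      simpa using hc p hp

end CaseOne

section CaseTwo

variable (N) in
/-- The coefficient of the connection of rank one for `c₀ = 0` and `c₁ = c₂ ≠ 0`. -/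
def equalCoeff (q : ℝ × ℝ) : ℝ := N.δ₂ 0 N.a q / (1 - N.a q)

lemma smooth_equalCoeff (hD : IsOpen D) : ContDiffOn ℝ ∞ N.equalCoeff D :=
  (smooth_a₂ hD).div (contDiffOn_const.sub N.smooth_a) fun _ hp => N.one_sub_a_ne_zero hp

lemma curv_equalCoeff (hD : IsOpen D) {p : ℝ × ℝ} (hp : p ∈ D) :
    N.δ₁ 1 N.equalCoeff p - N.δ₂ 1 N.equalCoeff p + N.K p = -N.J₃ p / (1 - N.a p) ^ 2 := by
  have h := N.one_sub_a_ne_zero hp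
  have k : N.HasCov 1 N.equalCoeff p _ _ := HasCov.div (w := 1) (w' := 0)
    (cov_a₂ hD hp) ((HasCov.const 1).sub (cov_a hD hp)) h
  rw [k.2.1, k.2.2]
  simp only [J₃]
  field_simp
  ring

/-- The relation says u = −v, so δ₁(v + u) = 0 is automatic. The remaining equations reduce to δ₁v =
δ₂v and (1 − a)δ₂v = a₂v: a connection of rank one and no further condition. -/
lemma rank_eq_one_iff_of_eq (hD : IsOpen D) (hD' : IsSimplyConnected D)
    (h : ∀ p ∈ D, N.c₀ p = 0 ∧ N.c₁ p = N.c₂ p ∧ N.c₁ p ≠ 0) :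
    W.rank hD = 1 ↔ ∀ p ∈ D, N.J₃ p = 0 := by
  have hpar : ∀ v u, N.IsSolution v u → ∃ φ : ℝ × ℝ → ℝ, (∀ p ∈ D, N.HasCov 1 φ p (N.equalCoeff p * φ p)
      (N.equalCoeff p * φ p)) ∧ ∀ p ∈ D, v p = 1 * φ p ∧ u p = -1 * φ p := by
    intro v u hs
    have hu : ∀ p ∈ D, u p = -v p := fun p hp => by
      obtain ⟨h0, h1, h2⟩ := h p hp
      have := hs.relation hD hp
      rw [h0, ← h1] at this
      exact mul_left_cancel₀ h2 (by linarith)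
    refine ⟨v, fun p hp => ?_, fun p hp => ⟨by ring, by rw [hu p hp]; ring⟩⟩
    have cv := hs.cov_v hD hp
    have e := ((hs.cov_u hD hp).unique (cv.neg.congr hD hp hu)).2
    have n := N.one_sub_a_ne_zero hp
    convert! cv using 1 <;>
    · rw [equalCoeff]
      field_simp
      rw [hu p hp] at e ⊢
      linear_combination N.a p * e
  constructor
  · intro hr p hp
    have := (flat_of_rank_eq_one hD hD' (smooth_equalCoeff hD) (smooth_equalCoeff hD) hpar hr).1
      p hp
    rw [curv_equalCoeff hD hp, div_eq_zero_iff] at this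
    simpa [N.one_sub_a_ne_zero hp] using this
  · intro hJ
    refine rank_eq_one_of_flat (ρ := fun _ => 1) (σ := fun _ => -1) hD hD' (smooth_equalCoeff hD)
      (smooth_equalCoeff hD) (fun p hp => ?_) (fun _ _ => by simp) (fun φ hφ hc => ?_) hpar
    · rw [curv_equalCoeff hD hp, hJ p hp]
      simp
    · refine IsSolution.of_cov (contDiffOn_const.mul hφ) (contDiffOn_const.mul hφ)
        (w := fun p => -1 * (N.equalCoeff p * φ p)) fun p hp => ?_
      have n := N.one_sub_a_ne_zero hp
      have k := hc p hp
      have e : N.a p * (-1 * (N.equalCoeff p * φ p)) + N.δ₂ 0 N.a p * (-1 * φ p) =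
          -1 * (N.equalCoeff p * φ p) := by
        rw [equalCoeff]
        field_simp
        ring
      rw [e]
      refine ⟨?_, k.const_mul (-1)⟩
      simpa using k

end CaseTwo

section CaseThree

variable (N) in
/-- The coefficient of the connection of rank one for `c₀ = c₁ = 0` and `c₂ ≠ 0`. -/
def lastCoeff (q : ℝ × ℝ) : ℝ := -N.δ₂ 0 N.a q / N.a q

lemma smooth_lastCoeff (hD : IsOpen D) : ContDiffOn ℝ ∞ N.lastCoeff D :=
  (smooth_a₂ hD).neg.div N.smooth_a fun _ hp => N.a_ne_zero hp

lemma curv_lastCoeff (hD : IsOpen D) {p : ℝ × ℝ} (hp : p ∈ D) :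
    N.δ₁ 1 N.lastCoeff p - N.δ₂ 1 (fun _ => 0) p + N.K p = -N.J₄ p / N.a p ^ 2 := by
  have h := N.a_ne_zero hp
  have k : N.HasCov 1 N.lastCoeff p _ _ := HasCov.div (w := 1) (w' := 0)
    (cov_a₂ hD hp).neg (cov_a hD hp) h
  rw [k.2.1, (HasCov.zero 1).2.2]
  simp only [J₄]
  field_simp
  ring

/-- The relation says v = 0, and the system reduces to δ₁u = 0 and a δ₂u + a₂u = 0. -/
lemma rank_eq_one_iff_of_c₁_eq_zero (hD : IsOpen D) (hD' : IsSimplyConnected D)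
    (h : ∀ p ∈ D, N.c₀ p = 0 ∧ N.c₁ p = 0 ∧ N.c₂ p ≠ 0) :
    W.rank hD = 1 ↔ ∀ p ∈ D, N.J₄ p = 0 := by
  have hpar : ∀ v u, N.IsSolution v u → ∃ φ : ℝ × ℝ → ℝ, (∀ p ∈ D, N.HasCov 1 φ p (0 * φ p)
      (N.lastCoeff p * φ p)) ∧ ∀ p ∈ D, v p = 0 * φ p ∧ u p = 1 * φ p := by
    intro v u hs
    have hv : ∀ p ∈ D, v p = 0 := fun p hp => by
      obtain ⟨h0, h1, h2⟩ := h p hp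
      have := hs.relation hD hp
      rw [h0, h1] at this
      exact mul_left_cancel₀ h2 (by linarith)
    refine ⟨u, fun p hp => ?_, fun p hp => ⟨by rw [hv p hp]; ring, by ring⟩⟩
    have cu := hs.cov_u hD hp
    have e := ((hs.cov_v hD hp).unique ((HasCov.zero 1).congr hD hp hv)).1
    have n := N.a_ne_zero hp
    convert! cu using 1
    · linarith
    · rw [lastCoeff]
      field_simp
      linear_combination e
  have h0 : ContDiffOn ℝ ∞ (fun _ : ℝ × ℝ => (0 : ℝ)) D := contDiffOn_const
  constructor
  · intro hr p hp
    have := (flat_of_rank_eq_one hD hD' h0 (smooth_lastCoeff hD) hpar hr).1 p hp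
    rw [curv_lastCoeff hD hp, div_eq_zero_iff] at this
    simpa [N.a_ne_zero hp] using this
  · intro hJ
    refine rank_eq_one_of_flat (ρ := fun _ => 0) (σ := fun _ => 1) hD hD' h0
      (smooth_lastCoeff hD) (fun p hp => ?_) (fun _ _ => by simp) (fun φ hφ hc => ?_) hpar
    · rw [curv_lastCoeff hD hp, hJ p hp]
      simp
    · refine IsSolution.of_cov (contDiffOn_const.mul hφ) (contDiffOn_const.mul hφ)
        (w := fun p => N.lastCoeff p * φ p) fun p hp => ?_
      have n := N.a_ne_zero hp
      have k := hc p hp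
      have e : N.a p * (N.lastCoeff p * φ p) + N.δ₂ 0 N.a p * (1 * φ p) = 0 := by
        rw [lastCoeff]
        field_simp
        ring
      rw [e]
      refine ⟨?_, ?_⟩
      · simpa using HasCov.zero 1
      · simpa using k

end CaseThree

end Normalization

end FourWeb

end PlanarWeb

end

/-! ### Invariant line bundles, and the necessary conditions for c₀ ≠ 0. -/

noncomputable section

namespace PlanarWeb

open Set Filter Topology

namespace FourWeb

namespace Normalization

variable {D : Set (ℝ × ℝ)} {W : FourWeb D} {N : W.Normalization}

namespace Connection

variable {n : ℕ} {C : Connection n}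

/-- The curvature of the connection induced on an invariant line bundle. -/
lemma curv_line (hD : IsOpen D) (hC : C.SmoothOn D) (hwt : ∀ i, C.wt i = 1) {U : Set (ℝ × ℝ)}
    (hUo : IsOpen U) (hU : U ⊆ D) {τ : Fin n → ℝ × ℝ → ℝ} (hτ : ∀ i, ContDiffOn ℝ ∞ (τ i) D)
    {f₁ f₂ : ℝ × ℝ → ℝ} (h₁ : ContDiffOn ℝ ∞ f₁ U) (h₂ : ContDiffOn ℝ ∞ f₂ U)
    (hcov : ∀ p ∈ U, ∀ i, N.HasCov 0 (τ i) p (∑ j, C.M₁ i j p * τ j p - f₁ p * τ i p)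
      (∑ j, C.M₂ i j p * τ j p - f₂ p * τ i p)) {p : ℝ × ℝ} (hp : p ∈ U) (i : Fin n) :
    (N.δ₁ 1 f₂ p - N.δ₂ 1 f₁ p + N.K p) * τ i p = ∑ j, C.curv N i j p * τ j p := by
  have hd : ∀ i j, C.d i j = 1 := fun i j => by
    have := C.wt_add i j
    rw [hwt, hwt] at this
    omega
  have key : ∀ (M : Fin n → Fin n → ℝ × ℝ → ℝ) (f : ℝ × ℝ → ℝ),
      (∀ i j, ContDiffOn ℝ ∞ (M i j) D) → ContDiffOn ℝ ∞ f U →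
      N.HasCov 1 (fun q => ∑ j, M i j q * τ j q - f q * τ i q) p
        (∑ j, (N.δ₁ 1 (M i j) p * τ j p +
            M i j p * (∑ k, C.M₁ j k p * τ k p - f₁ p * τ j p)) -
          (N.δ₁ 1 f p * τ i p + f p * (∑ k, C.M₁ i k p * τ k p - f₁ p * τ i p)))
        (∑ j, (N.δ₂ 1 (M i j) p * τ j p +
            M i j p * (∑ k, C.M₂ j k p * τ k p - f₂ p * τ j p)) -
          (N.δ₂ 1 f p * τ i p + f p * (∑ k, C.M₂ i k p * τ k p - f₂ p * τ i p))) := by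
    intro M f hM hf
    have cf : N.HasCov 1 f p (N.δ₁ 1 f p) (N.δ₂ 1 f p) :=
      ⟨differentiableAt_of_smooth hUo hf hp, rfl, rfl⟩
    exact (HasCov.sum fun j => (HasCov.of_smooth hD 1 (hM i j) (hU hp)).mul (hcov p hp j)).sub
      (cf.mul (hcov p hp i))
  have k₁ := (key C.M₁ f₁ (fun i j => (hC i j).1) h₁).congr hUo hp
    fun q hq => (hcov q hq i).2.1
  have k₂ := (key C.M₂ f₂ (fun i j => (hC i j).2) h₂).congr hUo hp
    fun q hq => (hcov q hq i).2.2
  -- The components of τ have weight 0, so their derivatives commute. The K on the left, from weight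
  -- one, matches the weight terms of the ambient curvature.
  have hc := δ_comm (N := N) hD 0 (hτ i) (hU hp)
  rw [zero_add, k₂.2.1, k₁.2.2] at hc
  have e₃ : ∑ j, (∑ k, (C.M₂ i k p * C.M₁ k j p - C.M₁ i k p * C.M₂ k j p)) * τ j p =
      ∑ k, C.M₂ i k p * (∑ j, C.M₁ k j p * τ j p) -
        ∑ k, C.M₁ i k p * (∑ j, C.M₂ k j p * τ j p) := by
    simp only [Finset.sum_mul, Finset.mul_sum, sub_mul, Finset.sum_sub_distrib, mul_assoc]
    congr 1 <;> exact Finset.sum_comm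
  have e₄ : ∑ j, (if i = j then (C.wt i : ℝ) * N.K p else 0) * τ j p = N.K p * τ i p := by
    simp [hwt]
  have e₅ : ∑ j, C.curv N i j p * τ j p =
      ∑ j, N.δ₁ 1 (C.M₂ i j) p * τ j p - ∑ j, N.δ₂ 1 (C.M₁ i j) p * τ j p +
        ∑ j, (∑ k, (C.M₂ i k p * C.M₁ k j p - C.M₁ i k p * C.M₂ k j p)) * τ j p +
        ∑ j, (if i = j then (C.wt i : ℝ) * N.K p else 0) * τ j p := by
    rw [← Finset.sum_sub_distrib, ← Finset.sum_add_distrib, ← Finset.sum_add_distrib]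
    exact Finset.sum_congr rfl fun k _ => by rw [curv, hd]; ring
  have e₆ : ∀ (M y : Fin n → ℝ) (f : ℝ),
      ∑ k, M k * (y k - f * τ k p) = ∑ k, M k * y k - f * ∑ k, M k * τ k p := fun M y f => by
    rw [Finset.mul_sum, ← Finset.sum_sub_distrib]
    exact Finset.sum_congr rfl fun k _ => by ring
  rw [e₅, e₃, e₄]
  simp only [Finset.sum_add_distrib, e₆] at hc
  push_cast at hc
  linear_combination -hc

/-- Local parallel sections of a line bundle on which the curvature vanishes and which is invariant
under the connection. -/
lemma exists_local_parallel_line (hD : IsOpen D) (hC : C.SmoothOn D) (hwt : ∀ i, C.wt i = 1)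
    {U : Set (ℝ × ℝ)} (hUo : IsOpen U) (hU : U ⊆ D) {τ : Fin n → ℝ × ℝ → ℝ}
    (hτ : ∀ i, ContDiffOn ℝ ∞ (τ i) D) (hne : ∀ p ∈ U, ∃ i, τ i p ≠ 0) {f₁ f₂ : ℝ × ℝ → ℝ}
    (h₁ : ContDiffOn ℝ ∞ f₁ U) (h₂ : ContDiffOn ℝ ∞ f₂ U)
    (hcov : ∀ p ∈ U, ∀ i, N.HasCov 0 (τ i) p (∑ j, C.M₁ i j p * τ j p - f₁ p * τ i p)
      (∑ j, C.M₂ i j p * τ j p - f₂ p * τ i p))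
    (hker : ∀ p ∈ U, ∀ i, ∑ j, C.curv N i j p * τ j p = 0) {p : ℝ × ℝ} (hp : p ∈ U) :
    ∃ B, IsOpen B ∧ IsPreconnected B ∧ p ∈ B ∧ B ⊆ U ∧ ∀ q ∈ B, ∀ c : ℝ, ∃ s,
      (∀ x ∈ B, C.IsParallel N s x ∧ ∃ b : ℝ, ∀ i, s x i = b * τ i x) ∧
      ∀ i, s q i = c * τ i q := by
  -- The curvature on the line times τ is the ambient curvature applied to τ, which vanishes; so the
  -- induced connection is flat without further assumptions.
  have hflat : (conn₁ f₁ f₂).IsFlatOn N U := fun q hq i j => by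
    obtain ⟨k, hk⟩ := hne q hq
    have := curv_line hD hC hwt hUo hU hτ h₁ h₂ hcov hq k
    rw [hker q hq k] at this
    exact (curv_conn₁ i j).trans ((mul_eq_zero.mp this).resolve_right hk)
  obtain ⟨B, hB, hBc, hpB, hBU, h⟩ :=
    exists_local_parallel (N := N) hD hUo hU (smooth_conn₁ h₁ h₂) hflat hp
  refine ⟨B, hB, hBc, hpB, hBU, fun q hq c => ?_⟩
  obtain ⟨φ, hφ, hφq⟩ := h q hq fun _ => c
  refine ⟨fun x i => φ x 0 * τ i x, fun x hx => ⟨fun i => ?_, φ x 0, fun _ => rfl⟩, fun i => ?_⟩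
  · rw [hwt]
    -- In the derivative of φτ the terms ±f φτ cancel, so φτ is parallel in the ambient connection.
    convert! (isParallel_conn₁.mp (hφ x hx)).mul (hcov x (hBU hx) i) using 1
    · rw [mul_sub, Finset.mul_sum]
      simp only [mul_left_comm (φ x 0)]
      ring
    · rw [mul_sub, Finset.mul_sum]
      simp only [mul_left_comm (φ x 0)]
      ring
  · simp [hφq]

end Connection

section CaseFour

variable {v u r s : ℝ × ℝ → ℝ} {p : ℝ × ℝ}

/-- Differentiating rv + su = 0, multiplying by c₀ and eliminating w gives two more linear equations
for (v, u). As (v, u) ≠ 0, their determinants with the row (r, s) vanish; these are J₁₁ and J₁₂. -/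
lemma IsSolution.J₁₁_eq_zero (hD : IsOpen D) (h : N.IsSolution v u)
    (hr : ContDiffOn ℝ ∞ r D) (hs : ContDiffOn ℝ ∞ s D) (he : ∀ p ∈ D, r p * v p + s p * u p = 0)
    (hp : p ∈ D) (hne : v p ≠ 0 ∨ u p ≠ 0) : N.J₁₁ r s p = 0 ∧ N.J₁₂ r s p = 0 := by
  have cr := HasCov.of_smooth (N := N) hD 6 hr hp
  have cs := HasCov.of_smooth (N := N) hD 6 hs hp
  have c := ((cr.mul (h.cov_v hD hp)).add (cs.mul (h.cov_u hD hp))).congr hD hp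
    fun q hq => (he q hq).symm
  obtain ⟨E₁, E₂⟩ := c.unique (HasCov.zero _)
  have e := he p hp
  have k := h.relation hD hp
  simp only [J₁₁, J₁₂]
  rcases hne with hv | hu
  · constructor <;> refine mul_right_cancel₀ hv ?_ <;> rw [zero_mul]
    · linear_combination (s p * N.c₀ p) * E₁ - (s p - r p) * s p * N.a p * k -
        (N.c₀ p * N.δ₁ 6 s p + (s p - r p) * (N.c₀ p * N.δ₂ 0 N.a p - N.a p * N.c₁ p)) * e
    · linear_combination (s p * N.c₀ p) * E₂ - s p * (s p - N.a p * r p) * k -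
        (N.c₀ p * N.δ₂ 6 s p - N.c₁ p * (s p - N.a p * r p) - r p * N.δ₂ 0 N.a p * N.c₀ p) * e
  · constructor <;> refine mul_right_cancel₀ hu ?_ <;> rw [zero_mul]
    · linear_combination (-r p * N.c₀ p) * E₁ + (s p - r p) * r p * N.a p * k +
        (N.c₀ p * N.δ₁ 6 r p - N.a p * N.c₂ p * (s p - r p)) * e
    · linear_combination (-r p * N.c₀ p) * E₂ + r p * (s p - N.a p * r p) * k +
        (N.c₀ p * N.δ₂ 6 r p - N.c₂ p * (s p - N.a p * r p)) * e

lemma smooth_G₁₁ (hD : IsOpen D) : ContDiffOn ℝ ∞ N.G₁₁ D := by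
  have ha := N.smooth_a
  have ha₁ := smooth_a₁ (N := N) hD
  have ha₂ := smooth_a₂ (N := N) hD
  have hK := smooth_K (N := N) hD
  have h₀ := smooth_c₀ (N := N) hD
  have h₁ := smooth_c₁ (N := N) hD
  have h₂ := smooth_c₂ (N := N) hD
  have h₀₁ := smooth_δ₁ (N := N) hD 2 h₀
  have h₀₂ := smooth_δ₂ (N := N) hD 2 h₀
  have h₂₁ := smooth_δ₁ (N := N) hD 3 h₂
  have h₂₂ := smooth_δ₂ (N := N) hD 3 h₂
  unfold G₁₁
  dsimp only
  fun_prop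

lemma smooth_G₁₂ (hD : IsOpen D) : ContDiffOn ℝ ∞ N.G₁₂ D := by
  have ha := N.smooth_a
  have ha₁ := smooth_a₁ (N := N) hD
  have ha₂ := smooth_a₂ (N := N) hD
  have ha₁₂ := smooth_δ₁₂ (N := N) hD 0 ha
  have ha₂₂ : ContDiffOn ℝ ∞ (N.δ₂₂ 0 N.a) D := smooth_δ₂ hD _ ha₂
  have h₀ := smooth_c₀ (N := N) hD
  have h₁ := smooth_c₁ (N := N) hD
  have h₀₁ := smooth_δ₁ (N := N) hD 2 h₀
  have h₀₂ := smooth_δ₂ (N := N) hD 2 h₀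
  have h₁₁ := smooth_δ₁ (N := N) hD 3 h₁
  have h₁₂ := smooth_δ₂ (N := N) hD 3 h₁
  unfold G₁₂
  dsimp only
  fun_prop

lemma smooth_G₂₁ (hD : IsOpen D) : ContDiffOn ℝ ∞ N.G₂₁ D := by
  have ha := N.smooth_a
  have ha₂ := smooth_a₂ (N := N) hD
  have h₀ := smooth_c₀ (N := N) hD
  have h₂ := smooth_c₂ (N := N) hD
  have h₀₁ := smooth_δ₁ (N := N) hD 2 h₀
  have h₀₂ := smooth_δ₂ (N := N) hD 2 h₀
  have h₂₁ := smooth_δ₁ (N := N) hD 3 h₂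
  have h₂₂ := smooth_δ₂ (N := N) hD 3 h₂
  unfold G₂₁
  dsimp only
  fun_prop

lemma smooth_G₂₂ (hD : IsOpen D) : ContDiffOn ℝ ∞ N.G₂₂ D := by
  have ha := N.smooth_a
  have ha₂ := smooth_a₂ (N := N) hD
  have ha₂₂ : ContDiffOn ℝ ∞ (N.δ₂₂ 0 N.a) D := smooth_δ₂ hD _ ha₂
  have hK := smooth_K (N := N) hD
  have h₀ := smooth_c₀ (N := N) hD
  have h₁ := smooth_c₁ (N := N) hD
  have h₂ := smooth_c₂ (N := N) hD
  have h₀₁ := smooth_δ₁ (N := N) hD 2 h₀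
  have h₀₂ := smooth_δ₂ (N := N) hD 2 h₀
  have h₁₁ := smooth_δ₁ (N := N) hD 3 h₁
  have h₁₂ := smooth_δ₂ (N := N) hD 3 h₁
  unfold G₂₂
  dsimp only
  fun_prop

/-- If `c₀` has no zeros, then a solution which is not zero at a point has no zeros. -/
lemma IsSolution.ne_zero (hD : IsOpen D) (hDc : IsPreconnected D) (h0 : ∀ p ∈ D, N.c₀ p ≠ 0)
    (h : N.IsSolution v u) {q : ℝ × ℝ} (hq : q ∈ D) (hne : v q ≠ 0 ∨ u q ≠ 0) (hp : p ∈ D) :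
    v p ≠ 0 ∨ u p ≠ 0 := by
  by_contra! hz
  have := Connection.eqOn_of_isParallel (N := N) (t := fun _ _ => 0) hD hD hDc subset_rfl
    (smooth_conn₂ hD h0) (fun p hp => h.isParallel_conn₂ hD hp (h0 p hp))
    (fun p hp i => by simpa using HasCov.zero _) hp
    (by funext i; fin_cases i <;> simp [hz]) hq
  have k0 := congrFun this 0
  have k1 := congrFun this 1
  simp at k0 k1
  simp [k0, k1] at hne

/-- Both rows of G annihilate one solution without zeros, so the conditions hold for each row, also
where the other one does not vanish. -/
lemma J_eq_zero_of_rank_eq_one (hD : IsOpen D) (hD' : IsSimplyConnected D)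
    (h0 : ∀ p ∈ D, N.c₀ p ≠ 0) (hr : W.rank hD = 1) (hp : p ∈ D) :
    N.J₁₀ p = 0 ∧ (N.J₁₁ N.G₂₁ N.G₂₂ p = 0 ∧ N.J₁₂ N.G₂₁ N.G₂₂ p = 0) ∧
      N.J₁₁ N.G₁₁ N.G₁₂ p = 0 ∧ N.J₁₂ N.G₁₁ N.G₁₂ p = 0 := by
  obtain ⟨v, u, h, ⟨q, hq, hne⟩, -⟩ := (rank_eq_one_iff (N := N) hD).mp hr
  have hn := h.ne_zero hD hD'.isPathConnected.isConnected.isPreconnected h0 hq hne hp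
  have hG := fun q hq => h.G_mul (p := q) hD h0 hq
  refine ⟨?_, h.J₁₁_eq_zero hD (smooth_G₂₁ hD) (smooth_G₂₂ hD) (fun q hq => (hG q hq).2) hp hn,
    h.J₁₁_eq_zero hD (smooth_G₁₁ hD) (smooth_G₁₂ hD) (fun q hq => (hG q hq).1) hp hn⟩
  obtain ⟨k₁, k₂⟩ := hG p hp
  rw [J₁₀]
  rcases hn with hv | hu
  · refine mul_right_cancel₀ hv ?_
    linear_combination N.G₂₂ p * k₁ - N.G₁₂ p * k₂
  · refine mul_right_cancel₀ hu ?_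
    linear_combination N.G₁₁ p * k₂ - N.G₂₁ p * k₁

/-- The vanishing of `J₁₁` and `J₁₂` depends only on the ratio of the arguments. -/
lemma J₁₁_eq_zero_of_proportional (hD : IsOpen D) {r' s' : ℝ × ℝ → ℝ}
    (hr : ContDiffOn ℝ ∞ r D) (hs : ContDiffOn ℝ ∞ s D) (hr' : ContDiffOn ℝ ∞ r' D)
    (hs' : ContDiffOn ℝ ∞ s' D) (he : ∀ p ∈ D, r p * s' p = r' p * s p) (hp : p ∈ D)
    (hne : r' p ≠ 0 ∨ s' p ≠ 0) (hJ : N.J₁₁ r' s' p = 0 ∧ N.J₁₂ r' s' p = 0) :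
    N.J₁₁ r s p = 0 ∧ N.J₁₂ r s p = 0 := by
  have cr := HasCov.of_smooth (N := N) hD 6 hr hp
  have cs := HasCov.of_smooth (N := N) hD 6 hs hp
  have cr' := HasCov.of_smooth (N := N) hD 6 hr' hp
  have cs' := HasCov.of_smooth (N := N) hD 6 hs' hp
  -- No factor of proportionality is formed: the identity rs' = r's is differentiated, and the
  -- claims are proved after multiplication by r'² or s'².
  obtain ⟨E₁, E₂⟩ := ((cr.mul cs').congr hD hp fun q hq => (he q hq).symm).unique (cr'.mul cs)
  have e := he p hp
  obtain ⟨k₁, k₂⟩ := hJ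
  simp only [J₁₁, J₁₂] at k₁ k₂ ⊢
  set c := N.c₀ p
  rcases hne with h | h
  · have h2 := pow_ne_zero 2 h
    constructor <;> refine mul_right_cancel₀ h2 ?_ <;> rw [zero_mul]
    · linear_combination c * r p * r' p * E₁ + r p ^ 2 * k₁ -
        (c * (N.δ₁ 6 r p * r' p + r p * N.δ₁ 6 r' p) -
          N.a p * N.c₂ p * (s p * r' p + s' p * r p) +
          (N.a p * N.c₂ p - N.δ₂ 0 N.a p * c + N.a p * N.c₁ p) * r p * r' p) * e
    · linear_combination c * r p * r' p * E₂ + r p ^ 2 * k₂ -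
        (c * (N.δ₂ 6 r p * r' p + r p * N.δ₂ 6 r' p) -
          N.c₂ p * (s p * r' p + s' p * r p) +
          (N.a p * N.c₂ p + N.c₁ p) * r p * r' p) * e
  · have h2 := pow_ne_zero 2 h
    constructor <;> refine mul_right_cancel₀ h2 ?_ <;> rw [zero_mul]
    · linear_combination c * s p * s' p * E₁ + s p ^ 2 * k₁ +
        (-c * (N.δ₁ 6 s p * s' p + s p * N.δ₁ 6 s' p) +
          (N.δ₂ 0 N.a p * c - N.a p * N.c₁ p) * (r p * s' p + r' p * s p) +
          (N.a p * N.c₂ p - N.δ₂ 0 N.a p * c + N.a p * N.c₁ p) * s p * s' p) * e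
    · linear_combination c * s p * s' p * E₂ + s p ^ 2 * k₂ +
        (-c * (N.δ₂ 6 s p * s' p + s p * N.δ₂ 6 s' p) +
          (N.δ₂ 0 N.a p * c - N.a p * N.c₁ p) * (r p * s' p + r' p * s p) +
          (N.a p * N.c₂ p + N.c₁ p) * s p * s' p) * e

end CaseFour

end Normalization

end FourWeb

end PlanarWeb

end

/-! ### The kernel line of G, and sufficiency for c₀ ≠ 0. -/

noncomputable section

namespace PlanarWeb

open Set Filter Topology

namespace FourWeb

namespace Normalization

variable {D : Set (ℝ × ℝ)} {W : FourWeb D} {N : W.Normalization}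

section KernelLine

variable {r s : ℝ × ℝ → ℝ} {p : ℝ × ℝ}

variable (N) in
/-- A section, of weight zero, of the line on which `r v + s u` vanishes. -/
def lineSection (r s : ℝ × ℝ → ℝ) : Fin 2 → ℝ × ℝ → ℝ :=
  -- The weight 6 of c₀³ cancels the weight of r and s, as `curv_line` requires.
  ![fun q => s q / (N.c₀ q * N.c₀ q * N.c₀ q), fun q => -r q / (N.c₀ q * N.c₀ q * N.c₀ q)]

lemma smooth_lineSection (hD : IsOpen D) (h0 : ∀ p ∈ D, N.c₀ p ≠ 0)
    (hr : ContDiffOn ℝ ∞ r D) (hs : ContDiffOn ℝ ∞ s D) (i : Fin 2) :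
    ContDiffOn ℝ ∞ (N.lineSection r s i) D := by
  have hc := smooth_c₀ (N := N) hD
  have hn : ∀ p ∈ D, N.c₀ p * N.c₀ p * N.c₀ p ≠ 0 := fun p hp =>
    mul_ne_zero (mul_ne_zero (h0 p hp) (h0 p hp)) (h0 p hp)
  fin_cases i
  · exact ContDiffOn.div (by fun_prop) (by fun_prop) hn
  · exact ContDiffOn.div (by fun_prop) (by fun_prop) hn

variable (N) in
/-- The first covariant derivative of the section in the connection of rank two, up to the sign. -/
def lineDeriv₁ (r s : ℝ × ℝ → ℝ) (i : Fin 2) (q : ℝ × ℝ) : ℝ :=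
  ∑ j, (conn₂ N).M₁ i j q * N.lineSection r s j q - N.δ₁ 0 (N.lineSection r s i) q

variable (N) in
/-- The second covariant derivative of the section, up to the sign. -/
def lineDeriv₂ (r s : ℝ × ℝ → ℝ) (i : Fin 2) (q : ℝ × ℝ) : ℝ :=
  ∑ j, (conn₂ N).M₂ i j q * N.lineSection r s j q - N.δ₂ 0 (N.lineSection r s i) q

/-- The line is invariant under the connection if `J₁₁` and `J₁₂` vanish. -/
lemma lineDeriv_proportional (hD : IsOpen D) (h0 : N.c₀ p ≠ 0) (hr : ContDiffOn ℝ ∞ r D)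
    (hs : ContDiffOn ℝ ∞ s D) (hp : p ∈ D) (hJ : N.J₁₁ r s p = 0 ∧ N.J₁₂ r s p = 0) :
    N.lineDeriv₁ r s 0 p * N.lineSection r s 1 p =
        N.lineDeriv₁ r s 1 p * N.lineSection r s 0 p ∧
      N.lineDeriv₂ r s 0 p * N.lineSection r s 1 p =
        N.lineDeriv₂ r s 1 p * N.lineSection r s 0 p := by
  have cr := HasCov.of_smooth (N := N) hD 6 hr hp
  have cs := HasCov.of_smooth (N := N) hD 6 hs hp
  have cc := ((cov_c₀ (N := N) hD hp).mul (cov_c₀ hD hp)).mul (cov_c₀ hD hp)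
  have hn := mul_ne_zero (mul_ne_zero h0 h0) h0
  have k₀ : N.HasCov 0 (fun q => s q / (N.c₀ q * N.c₀ q * N.c₀ q)) p _ _ :=
    HasCov.div (w := 0) (w' := 6) cs cc hn
  have k₁ : N.HasCov 0 (fun q => -r q / (N.c₀ q * N.c₀ q * N.c₀ q)) p _ _ :=
    HasCov.div (w := 0) (w' := 6) cr.neg cc hn
  obtain ⟨j₁, j₂⟩ := hJ
  simp only [J₁₁, J₁₂] at j₁ j₂
  constructor
  · simp [lineDeriv₁, lineSection, conn₂, Fin.sum_univ_two, k₀.2.1, k₁.2.1]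
    simp only [e₁, e₂]
    field_simp
    linear_combination -j₁
  · simp [lineDeriv₂, lineSection, conn₂, Fin.sum_univ_two, k₀.2.2, k₁.2.2]
    simp only [e₁, e₂]
    field_simp
    linear_combination -j₂

/-- Orthogonal projection gives the factor between parallel vectors by one formula, smooth wherever
(x, y) ≠ 0, with no choice of a nonzero coordinate. -/
lemma div_mul_of_proportional {x y a b : ℝ} (h : a * y = b * x) (hne : x ^ 2 + y ^ 2 ≠ 0) :
    (a * x + b * y) / (x ^ 2 + y ^ 2) * x = a ∧ (a * x + b * y) / (x ^ 2 + y ^ 2) * y = b := by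
  constructor
  · field_simp
    linear_combination -y * h
  · field_simp
    linear_combination x * h

/-- Local parallel sections of the line on which `r v + s u` vanishes. -/
lemma exists_local_parallel_kernel (hD : IsOpen D) (h0 : ∀ p ∈ D, N.c₀ p ≠ 0)
    (hr : ContDiffOn ℝ ∞ r D) (hs : ContDiffOn ℝ ∞ s D) {U : Set (ℝ × ℝ)} (hUo : IsOpen U)
    (hU : U ⊆ D) (hne : ∀ p ∈ U, r p ≠ 0 ∨ s p ≠ 0)
    (hJ : ∀ p ∈ U, N.J₁₁ r s p = 0 ∧ N.J₁₂ r s p = 0)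
    (hker : ∀ p ∈ U, N.G₁₁ p * s p = N.G₁₂ p * r p ∧ N.G₂₁ p * s p = N.G₂₂ p * r p)
    (hp : p ∈ U) :
    ∃ B, IsOpen B ∧ IsPreconnected B ∧ p ∈ B ∧ B ⊆ U ∧ ∀ q ∈ B, ∀ e : Fin 2 → ℝ,
      r q * e 0 + s q * e 1 = 0 → ∃ t, (∀ x ∈ B, (conn₂ N).IsParallel N t x ∧
        r x * t x 0 + s x * t x 1 = 0) ∧ t q = e := by
  set τ := N.lineSection r s with hτ
  have hC := smooth_conn₂ hD h0
  have hsm := smooth_lineSection hD h0 hr hs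
  have hn : ∀ q ∈ D, N.c₀ q * N.c₀ q * N.c₀ q ≠ 0 := fun q hq =>
    mul_ne_zero (mul_ne_zero (h0 q hq) (h0 q hq)) (h0 q hq)
  have hτ0 : ∀ q, τ 0 q = s q / (N.c₀ q * N.c₀ q * N.c₀ q) := fun q => rfl
  have hτ1 : ∀ q, τ 1 q = -r q / (N.c₀ q * N.c₀ q * N.c₀ q) := fun q => rfl
  have hpos : ∀ q ∈ U, τ 0 q ^ 2 + τ 1 q ^ 2 ≠ 0 := fun q hq h => by
    obtain ⟨k0, k1⟩ := (add_eq_zero_iff_of_nonneg (sq_nonneg _) (sq_nonneg _)).mp h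
    rw [hτ0] at k0
    rw [hτ1] at k1
    have hc := hn q (hU hq)
    simp only [ne_eq, OfNat.ofNat_ne_zero, not_false_eq_true, pow_eq_zero_iff, div_eq_zero_iff, hc,
      or_false, neg_eq_zero] at k0 k1
    exact (hne q hq).elim (fun h => h k1) fun h => h k0
  have hd₁ : ∀ i, ContDiffOn ℝ ∞ (N.lineDeriv₁ r s i) D := fun i =>
    (ContDiffOn.sum fun j _ => (hC i j).1.mul (hsm j)).sub (smooth_δ₁ hD 0 (hsm i))
  have hd₂ : ∀ i, ContDiffOn ℝ ∞ (N.lineDeriv₂ r s i) D := fun i =>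
    (ContDiffOn.sum fun j _ => (hC i j).2.mul (hsm j)).sub (smooth_δ₂ hD 0 (hsm i))
  have hf : ∀ A : Fin 2 → ℝ × ℝ → ℝ, (∀ i, ContDiffOn ℝ ∞ (A i) D) → ContDiffOn ℝ ∞
      (fun q => (A 0 q * τ 0 q + A 1 q * τ 1 q) / (τ 0 q ^ 2 + τ 1 q ^ 2)) U := fun A hA =>
    ((((hA 0).mul (hsm 0)).add ((hA 1).mul (hsm 1))).mono hU).div
      ((((hsm 0).pow 2).add ((hsm 1).pow 2)).mono hU) hpos
  have hcov : ∀ q ∈ U, ∀ i, N.HasCov 0 (τ i) q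
      (∑ j, (conn₂ N).M₁ i j q * τ j q - (N.lineDeriv₁ r s 0 q * τ 0 q +
        N.lineDeriv₁ r s 1 q * τ 1 q) / (τ 0 q ^ 2 + τ 1 q ^ 2) * τ i q)
      (∑ j, (conn₂ N).M₂ i j q * τ j q - (N.lineDeriv₂ r s 0 q * τ 0 q +
        N.lineDeriv₂ r s 1 q * τ 1 q) / (τ 0 q ^ 2 + τ 1 q ^ 2) * τ i q) := by
    intro q hq i
    obtain ⟨k₁, k₂⟩ := lineDeriv_proportional hD (h0 q (hU hq)) hr hs (hU hq) (hJ q hq)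
    have l₁ := div_mul_of_proportional k₁ (hpos q hq)
    have l₂ := div_mul_of_proportional k₂ (hpos q hq)
    have c := HasCov.of_smooth (N := N) hD 0 (hsm i) (hU hq)
    convert! c using 1
    · fin_cases i
      · exact (congrArg _ l₁.1).trans (sub_sub_cancel _ _)
      · exact (congrArg _ l₁.2).trans (sub_sub_cancel _ _)
    · fin_cases i
      · exact (congrArg _ l₂.1).trans (sub_sub_cancel _ _)
      · exact (congrArg _ l₂.2).trans (sub_sub_cancel _ _)
  -- τ is a multiple of (s, −r), which both rows of G annihilate.
  have hk : ∀ q ∈ U, ∀ i, ∑ j, (conn₂ N).curv N i j q * τ j q = 0 := by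
    intro q hq i
    have hc := h0 q (hU hq)
    obtain ⟨k₁, k₂⟩ := hker q hq
    rw [Fin.sum_univ_two, curv_conn₂ hD (hU hq) hc, curv_conn₂ hD (hU hq) hc, hτ0, hτ1]
    fin_cases i
    · simp [G]
      field_simp
      linear_combination -k₁
    · simp [G]
      field_simp
      linear_combination -k₂
  obtain ⟨B, hB, hBc, hpB, hBU, h⟩ := Connection.exists_local_parallel_line (N := N) hD hC
    (fun i => by fin_cases i <;> rfl) hUo hU hsm (fun q hq => by
      by_contra! hz
      exact hpos q hq (by simp [hτ, hz])) (hf _ hd₁) (hf _ hd₂) hcov hk hp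
  refine ⟨B, hB, hBc, hpB, hBU, fun q hq e he => ?_⟩
  obtain ⟨t, ht, htq⟩ := h q hq ((e 0 * τ 0 q + e 1 * τ 1 q) / (τ 0 q ^ 2 + τ 1 q ^ 2))
  refine ⟨t, fun x hx => ⟨(ht x hx).1, ?_⟩, ?_⟩
  · obtain ⟨b, hb⟩ := (ht x hx).2
    rw [hb, hb]
    change r x * (b * τ 0 x) + s x * (b * τ 1 x) = 0
    rw [hτ0, hτ1]
    ring
  · have hl := div_mul_of_proportional (x := τ 0 q) (y := τ 1 q) (a := e 0) (b := e 1) (by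
      rw [hτ0, hτ1, mul_div_assoc', mul_div_assoc']
      congr 1
      linear_combination -he) (hpos q (hBU hq))
    funext i
    rw [htq]
    fin_cases i
    · exact hl.1
    · exact hl.2

end KernelLine

section CaseFour

lemma G_ne_zero_iff {p : ℝ × ℝ} : N.G p ≠ 0 ↔
    (N.G₁₁ p ≠ 0 ∨ N.G₁₂ p ≠ 0) ∨ N.G₂₁ p ≠ 0 ∨ N.G₂₂ p ≠ 0 := by
  rw [← not_iff_not]
  simp [G, ← Matrix.ext_iff, Fin.forall_fin_two, and_assoc]

variable (N) in
/-- The kernel of the matrix `G`. -/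
def kernelG (p : ℝ × ℝ) : Set (Fin 2 → ℝ) :=
  {e | N.G₁₁ p * e 0 + N.G₁₂ p * e 1 = 0 ∧ N.G₂₁ p * e 0 + N.G₂₂ p * e 1 = 0}

/-- Two rows which are proportional, the second not zero: the second determines the kernel. -/
lemma row_mul_eq_zero {a b c d x y : ℝ} (h : a * d = c * b) (hne : c ≠ 0 ∨ d ≠ 0)
    (hxy : c * x + d * y = 0) : a * x + b * y = 0 := by
  rcases hne with hc | hd
  · refine mul_left_cancel₀ hc ?_
    linear_combination a * hxy - y * h
  · refine mul_left_cancel₀ hd ?_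
    linear_combination b * hxy + x * h

lemma isOpen_ne_zero_or (hD : IsOpen D) {r s : ℝ × ℝ → ℝ} (hr : ContDiffOn ℝ ∞ r D)
    (hs : ContDiffOn ℝ ∞ s D) : IsOpen {p | p ∈ D ∧ (r p ≠ 0 ∨ s p ≠ 0)} := by
  have h₁ := hr.continuousOn.isOpen_inter_preimage hD isOpen_ne (t := {x : ℝ | x ≠ 0})
  have h₂ := hs.continuousOn.isOpen_inter_preimage hD isOpen_ne (t := {x : ℝ | x ≠ 0})
  convert! h₁.union h₂ using 1
  ext p
  simp [and_or_left]

/-- Near each point some row of G has no zeros, and as det G = 0 that row alone cuts out the kernel.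
-/
lemma exists_local_parallel_kernelG (hD : IsOpen D) (h0 : ∀ p ∈ D, N.c₀ p ≠ 0)
    (hG : ∀ p ∈ D, N.G p ≠ 0) (h₁₀ : ∀ p ∈ D, N.J₁₀ p = 0)
    (h₂ : ∀ p ∈ D, N.J₁₁ N.G₂₁ N.G₂₂ p = 0 ∧ N.J₁₂ N.G₂₁ N.G₂₂ p = 0)
    (h₁ : ∀ p ∈ D, N.G₂₁ p = 0 ∧ N.G₂₂ p = 0 → N.J₁₁ N.G₁₁ N.G₁₂ p = 0 ∧ N.J₁₂ N.G₁₁ N.G₁₂ p = 0)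
    {p : ℝ × ℝ} (hp : p ∈ D) :
    ∃ B, IsOpen B ∧ IsPreconnected B ∧ p ∈ B ∧ B ⊆ D ∧ ∀ q ∈ B, ∀ e ∈ N.kernelG q, ∃ t,
      (∀ x ∈ B, (conn₂ N).IsParallel N t x ∧ t x ∈ N.kernelG x) ∧ t q = e := by
  have s₁₁ := smooth_G₁₁ (N := N) hD
  have s₁₂ := smooth_G₁₂ (N := N) hD
  have s₂₁ := smooth_G₂₁ (N := N) hD
  have s₂₂ := smooth_G₂₂ (N := N) hD
  have hdet : ∀ q ∈ D, N.G₁₁ q * N.G₂₂ q = N.G₂₁ q * N.G₁₂ q := fun q hq =>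
    sub_eq_zero.mp (h₁₀ q hq)
  by_cases hrow : N.G₂₁ p ≠ 0 ∨ N.G₂₂ p ≠ 0
  · obtain ⟨B, hB, hBc, hpB, hBU, h⟩ := exists_local_parallel_kernel hD h0 s₂₁ s₂₂
      (isOpen_ne_zero_or hD s₂₁ s₂₂) (fun q hq => hq.1) (fun q hq => hq.2) (fun q hq => h₂ q hq.1)
      (fun q hq => ⟨by linarith [hdet q hq.1], mul_comm _ _⟩) ⟨hp, hrow⟩
    refine ⟨B, hB, hBc, hpB, fun q hq => (hBU hq).1, fun q hq e he => ?_⟩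
    obtain ⟨t, ht, htq⟩ := h q hq e he.2
    exact ⟨t, fun x hx => ⟨(ht x hx).1,
      row_mul_eq_zero (hdet x (hBU hx).1) (hBU hx).2 (ht x hx).2, (ht x hx).2⟩, htq⟩
  -- The second row vanishes at p but perhaps not nearby. The conditions for the first row follow by
  -- proportionality where the second is nonzero, and from h₁ where it vanishes.
  · have hrow' := (G_ne_zero_iff.mp (hG p hp)).resolve_right hrow
    obtain ⟨B, hB, hBc, hpB, hBU, h⟩ := exists_local_parallel_kernel hD h0 s₁₁ s₁₂
      (isOpen_ne_zero_or hD s₁₁ s₁₂) (fun q hq => hq.1) (fun q hq => hq.2) (fun q hq => by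
        by_cases hq' : N.G₂₁ q ≠ 0 ∨ N.G₂₂ q ≠ 0
        · exact J₁₁_eq_zero_of_proportional hD s₁₁ s₁₂ s₂₁ s₂₂ hdet hq.1 hq' (h₂ q hq.1)
        · push Not at hq'
          exact h₁ q hq.1 hq')
      (fun q hq => ⟨mul_comm _ _, by linarith [hdet q hq.1]⟩) ⟨hp, hrow'⟩
    refine ⟨B, hB, hBc, hpB, fun q hq => (hBU hq).1, fun q hq e he => ?_⟩
    obtain ⟨t, ht, htq⟩ := h q hq e he.1
    exact ⟨t, fun x hx => ⟨(ht x hx).1, (ht x hx).2,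
      row_mul_eq_zero (by linarith [hdet x (hBU hx).1]) (hBU hx).2 (ht x hx).2⟩, htq⟩

/-- The kernel of G is a line at each point. Its parallel sections extend over D, which gives a
nonzero solution; any solution lies in the kernel at p, so it is a multiple of this one by
uniqueness. -/
lemma rank_eq_one_of_J_eq_zero (hD : IsOpen D) (hD' : IsSimplyConnected D)
    (h0 : ∀ p ∈ D, N.c₀ p ≠ 0) (hG : ∀ p ∈ D, N.G p ≠ 0) (h₁₀ : ∀ p ∈ D, N.J₁₀ p = 0)
    (h₂ : ∀ p ∈ D, N.J₁₁ N.G₂₁ N.G₂₂ p = 0 ∧ N.J₁₂ N.G₂₁ N.G₂₂ p = 0)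
    (h₁ : ∀ p ∈ D, N.G₂₁ p = 0 ∧ N.G₂₂ p = 0 →
      N.J₁₁ N.G₁₁ N.G₁₂ p = 0 ∧ N.J₁₂ N.G₁₁ N.G₁₂ p = 0) : W.rank hD = 1 := by
  obtain ⟨p, hp⟩ := hD'.nonempty
  have hDc : IsPreconnected D := hD'.isPathConnected.isConnected.isPreconnected
  have hC := smooth_conn₂ hD h0
  have hdet : N.G₁₁ p * N.G₂₂ p = N.G₂₁ p * N.G₁₂ p := sub_eq_zero.mp (h₁₀ p hp)
  obtain ⟨e, he, hker⟩ : ∃ e : Fin 2 → ℝ, (e ∈ N.kernelG p ∧ (e 0 ≠ 0 ∨ e 1 ≠ 0)) ∧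
      ∀ e' ∈ N.kernelG p, ∃ c : ℝ, e' = c • e := by
    have key : ∀ r s : ℝ, (r ≠ 0 ∨ s ≠ 0) →
        (∀ x : Fin 2 → ℝ, r * x 0 + s * x 1 = 0 ↔ x ∈ N.kernelG p) →
        ∃ e : Fin 2 → ℝ, (e ∈ N.kernelG p ∧ (e 0 ≠ 0 ∨ e 1 ≠ 0)) ∧
          ∀ e' ∈ N.kernelG p, ∃ c : ℝ, e' = c • e := by
      intro r s hne hk
      have hpos : s ^ 2 + (-r) ^ 2 ≠ 0 := fun h => by
        obtain ⟨k0, k1⟩ := (add_eq_zero_iff_of_nonneg (sq_nonneg _) (sq_nonneg _)).mp h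
        simp only [ne_eq, OfNat.ofNat_ne_zero, not_false_eq_true, pow_eq_zero_iff,
          neg_eq_zero] at k0 k1
        exact hne.elim (fun h => h k1) fun h => h k0
      refine ⟨![s, -r], ⟨(hk _).mp ?_, by simpa using hne.symm⟩, fun x hx => ?_⟩
      · simp
        ring
      · have hl := div_mul_of_proportional (x := s) (y := -r) (a := x 0) (b := x 1)
          (by linear_combination -(hk x).mpr hx) hpos
        refine ⟨(x 0 * s + x 1 * -r) / (s ^ 2 + (-r) ^ 2), ?_⟩
        funext i
        fin_cases i
        · exact hl.1.symm
        · exact hl.2.symm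
    rcases G_ne_zero_iff.mp (hG p hp) with hne | hne
    · exact key _ _ hne fun x => ⟨fun h => ⟨h, row_mul_eq_zero (by linarith) hne h⟩, fun h => h.1⟩
    · exact key _ _ hne fun x => ⟨fun h => ⟨row_mul_eq_zero hdet hne h, h⟩, fun h => h.2⟩
  obtain ⟨t, ht, htp⟩ := Connection.exists_global_parallel (N := N) hD hD' hC N.kernelG
    (fun q hq => exists_local_parallel_kernelG hD h0 hG h₁₀ h₂ h₁ hq) hp he.1
  rw [rank_eq_one_iff (N := N) hD]
  refine ⟨_, _, isSolution_of_isParallel_conn₂ hD h0 fun q hq => (ht q hq).1,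
    ⟨p, hp, by rw [htp]; exact he.2⟩, fun v u h => ?_⟩
  obtain ⟨c, hc⟩ := hker ![v p, u p] (h.G_mul hD h0 hp)
  refine ⟨c, fun q hq => ?_⟩
  have := Connection.eqOn_of_isParallel (N := N) (t := fun x => c • t x) hD hD hDc subset_rfl hC
    (fun q hq => h.isParallel_conn₂ hD hq (h0 q hq))
    (fun q hq i => by
      convert! ((ht q hq).1 i).const_mul c using 1 <;>
      · rw [Finset.mul_sum]
        exact Finset.sum_congr rfl fun j _ => by simp; ring) hp (by rw [htp]; exact hc) hq
  exact ⟨congrFun this 0, congrFun this 1⟩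

end CaseFour

end Normalization

end FourWeb

end PlanarWeb

end

/-! ### Assembly of the cases. -/

theorem mainTheorem6 (D : Set (ℝ × ℝ)) (hD : IsOpen D) (hD' : IsSimplyConnected D)
    (W : PlanarWeb.FourWeb D) (N : W.Normalization) (hN : N.IsRegular) :
    W.rank hD = 1 ↔
      (∀ p ∈ D, N.c₀ p = 0 ∧ N.J₁ p = 0 ∧ N.J₂ p = 0 ∧ N.c₁ p ≠ N.c₂ p ∧ N.c₁ p ≠ 0) ∨
      (∀ p ∈ D, N.c₀ p = 0 ∧ N.c₁ p = N.c₂ p ∧ N.c₁ p ≠ 0 ∧ N.J₃ p = 0) ∨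
      (∀ p ∈ D, N.c₀ p = 0 ∧ N.c₁ p = 0 ∧ N.c₂ p ≠ 0 ∧ N.J₄ p = 0) ∨
      (∀ p ∈ D, N.c₀ p ≠ 0 ∧ N.G p ≠ 0 ∧ N.J₁₀ p = 0 ∧
        N.J₁₁ N.G₂₁ N.G₂₂ p = 0 ∧ N.J₁₂ N.G₂₁ N.G₂₂ p = 0 ∧
        (N.G₂₁ p = 0 ∧ N.G₂₂ p = 0 →
          N.J₁₁ N.G₁₁ N.G₁₂ p = 0 ∧ N.J₁₂ N.G₁₁ N.G₁₂ p = 0)) := by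
  open PlanarWeb.FourWeb.Normalization in
  constructor
  · intro hr
    rcases hN with ⟨h0, h1, h12⟩ | ⟨h0, hG⟩
    · rcases h1 with h1 | h1 <;> rcases h12 with h12 | h12
      -- Here c₀ = c₁ = c₂ = 0 and the rank is not one.
      · exact absurd hr (rank_ne_one_of_flat (N := N) hD hD' fun p hp =>
          ⟨h0 p hp, h1 p hp, (h12 p hp).symm.trans (h1 p hp)⟩)
      · have h2 : ∀ p ∈ D, N.c₂ p ≠ 0 := fun p hp h => h12 p hp ((h1 p hp).trans h.symm)
        have hJ := (rank_eq_one_iff_of_c₁_eq_zero hD hD' fun p hp =>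
          ⟨h0 p hp, h1 p hp, h2 p hp⟩).mp hr
        exact Or.inr (Or.inr (Or.inl fun p hp => ⟨h0 p hp, h1 p hp, h2 p hp, hJ p hp⟩))
      · have hJ := (rank_eq_one_iff_of_eq hD hD' fun p hp => ⟨h0 p hp, h12 p hp, h1 p hp⟩).mp hr
        exact Or.inr (Or.inl fun p hp => ⟨h0 p hp, h12 p hp, h1 p hp, hJ p hp⟩)
      · have hJ := (rank_eq_one_iff_of_generic hD hD' fun p hp =>
          ⟨h0 p hp, h12 p hp, h1 p hp⟩).mp hr
        exact Or.inl fun p hp => ⟨h0 p hp, (hJ p hp).1, (hJ p hp).2, h12 p hp, h1 p hp⟩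
    · rcases hG with hG | hG
      · exact absurd hr (rank_ne_one_of_G_eq_zero hD hD' h0 hG)
      · refine Or.inr (Or.inr (Or.inr fun p hp => ?_))
        obtain ⟨h₁₀, h₂, h₁⟩ := J_eq_zero_of_rank_eq_one hD hD' h0 hr hp
        exact ⟨h0 p hp, hG p hp, h₁₀, h₂.1, h₂.2, fun _ => h₁⟩
  · rintro (h | h | h | h)
    · exact (rank_eq_one_iff_of_generic hD hD' fun p hp =>
        ⟨(h p hp).1, (h p hp).2.2.2⟩).mpr fun p hp => ⟨(h p hp).2.1, (h p hp).2.2.1⟩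
    · exact (rank_eq_one_iff_of_eq hD hD' fun p hp =>
        ⟨(h p hp).1, (h p hp).2.1, (h p hp).2.2.1⟩).mpr fun p hp => (h p hp).2.2.2
    · exact (rank_eq_one_iff_of_c₁_eq_zero hD hD' fun p hp =>
        ⟨(h p hp).1, (h p hp).2.1, (h p hp).2.2.1⟩).mpr fun p hp => (h p hp).2.2.2
    · exact rank_eq_one_of_J_eq_zero hD hD' (fun p hp => (h p hp).1) (fun p hp => (h p hp).2.1)
        (fun p hp => (h p hp).2.2.1) (fun p hp => ⟨(h p hp).2.2.2.1, (h p hp).2.2.2.2.1⟩)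
        fun p hp => (h p hp).2.2.2.2.2
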